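/- **Quadratic master loop equation of the Cauchy two-matrix model.** Let $N\ge 1$ be an integer, $T>0$, and for $i=1,2$ let $$V_i(x)=-t^{(i)}_{-1}\ln x+\sum_{k=1}^{d_i}t^{(i)}_kx^k,\qquad t^{(i)}_k\in\mathbb R,\quad t^{(i)}_{-1}>0,\quad d_i\ge 1,\quad t^{(i)}_{d_i}>0 ,$$ with $V_i'(x)=-t^{(i)}_{-1}x^{-1}+\sum_{k=1}^{d_i}k\,t^{(i)}_kx^{k-1}$. On pairs $(M_1,M_2)$ of positive definite Hermitian $N\times N$ matrices put $$w(M_1,M_2)=\frac{e^{-\frac NT\operatorname{tr}(V_1(M_1)+V_2(M_2))}}{\det(M_1\otimes\mathbb I+\mathbb I\otimes M_2)},\qquad \mathcal Z=\int_{M_i>0}w\,dM_1\,dM_2,\qquad \langle F\rangle=\frac1{\mathcal Z}\int_{M_i>0}F\,w\,dM_1\,dM_2,$$ where $dM=\prod_i dM_{ii}\prod_{i<j}d(\operatorname{Re}M_{ij})\,d(\operatorname{Im}M_{ij})$. Define $$W_1(x)=\tfrac TN\operatorname{tr}\tfrac1{x-M_1},\qquad W_2(x)=-\tfrac TN\operatorname{tr}\tfrac1{x+M_2},$$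 $$P_1(x)=\tfrac TN\operatorname{tr}\tfrac{V_1'(x)-V_1'(M_1)}{x-M_1},\qquad P_2(x)=-\tfrac TN\operatorname{tr}\tfrac{V_2'(-x)-V_2'(M_2)}{x+M_2},$$ $$I_1=\tfrac TN\operatorname{tr}V_1'(M_1)+\tfrac{T^2}{N^2}\operatorname{Tr}\tfrac1{M_1\otimes\mathbb I+\mathbb I\otimes M_2},\qquad I_2=-\Big(\tfrac TN\operatorname{tr}V_2'(M_2)+\tfrac{T^2}{N^2}\operatorname{Tr}\tfrac1{M_1\otimes\mathbb I+\mathbb I\otimes M_2}\Big),$$ with $\operatorname{Tr}$ the full trace on $\mathbb C^N\otimes\mathbb C^N$, and $$Y_1(x)=\tfrac{2V_1'(x)-V_2'(-x)}3-W_1(x),\qquad Y_2(x)=\tfrac{-V_1'(x)+2V_2'(-x)}3-W_2(x),$$ $$R(x)=\tfrac13\big(V_1'(x)^2+V_2'(-x)^2-V_1'(x)V_2'(-x)\big)-P_1(x)-P_2(x).$$ Then $w$ is integrable, $0<\mathcal Z<\infty$, and $I_1+I_2$ has an absolutely convergent average. For every $x\in\mathbb C\setminus\mathbb R$ the random variables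 $Y_1(x)^2$, $Y_2(x)^2$, $Y_1(x)Y_2(x)$ and $R(x)$ have absolutely convergent averages, and $$\langle Y_1(x)^2\rangle+\langle Y_2(x)^2\rangle+\langle Y_1(x)Y_2(x)\rangle=\langle R(x)\rangle-\frac1x\langle I_1+I_2\rangle .$$ The same holds when $x$ is a formal variable and $W_i$, $P_i$, $Y_i$, $R$ are expanded as formal Laurent series in $x^{-1}$ (with $\frac1{x-M}=\sum_{k\ge0}M^kx^{-k-1}$): for each $n\in\mathbb Z$, the coefficients of $x^{-n}$ in $Y_1(x)^2$, $Y_2(x)^2$, $Y_1(x)Y_2(x)$ and $R(x)$ have absolutely convergent averages, and the identity holds between the averaged coefficients of $x^{-n}$. -/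

import Mathlib

open MeasureTheory
open scoped Matrix Kronecker ComplexOrder

noncomputable section

namespace CauchyModel

/-- A potential `V(x) = -t₋₁ ln x + ∑_{k=1}^d t_k x^k` with `t₋₁ > 0`, `d ≥ 1` and `t_d > 0`;
the other coefficients are arbitrary real numbers. -/
structure Potential where
  /-- the number `t₋₁`, so that `V` contains the term `-t₋₁ ln x` -/
  tLog : ℝ
  /-- the degree `d` of the polynomial part -/
  d : ℕ
  /-- the coefficients `t_k`; only `t 1, …, t d` are used -/
  t : ℕ → ℝ
  tLog_pos : 0 < tLog
  one_le_d : 1 ≤ d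
  t_d_pos : 0 < t d

/-- The value `V(x)` at a real number (meaningful for `x > 0`). -/
def Potential.eval (V : Potential) (x : ℝ) : ℝ :=
  -V.tLog * Real.log x + ∑ k ∈ Finset.Icc 1 V.d, V.t k * x ^ k

/-- The rational function `V'(x) = -t₋₁ / x + ∑_{k=1}^d k t_k x^(k-1)`, evaluated at an element of
a complex algebra with an inversion: a complex number, a formal series or a square matrix. -/
def Potential.deriv (V : Potential) {A : Type*} [Ring A] [Algebra ℂ A] [Inv A] (a : A) : A :=
  -((V.tLog : ℂ) • a⁻¹) + ∑ k ∈ Finset.Icc 1 V.d, ((k : ℂ) * (V.t k : ℂ)) • a ^ (k - 1)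

/-- `V'` is the derivative of `V` on the positive half line. -/
theorem Potential.hasDerivAt_eval (V : Potential) {x : ℝ} (hx : 0 < x) :
    ∃ v : ℝ, HasDerivAt V.eval v x ∧ (v : ℂ) = V.deriv (x : ℂ) := by
  refine ⟨-V.tLog * x⁻¹ + ∑ k ∈ Finset.Icc 1 V.d, V.t k * ((k : ℝ) * x ^ (k - 1)), ?_, ?_⟩
  · unfold Potential.eval
    refine ((Real.hasDerivAt_log hx.ne').const_mul _).add ?_
    refine HasDerivAt.fun_sum fun k _ => ?_
    exact (hasDerivAt_pow k x).const_mul _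
  · simp only [Potential.deriv, smul_eq_mul]
    push_cast
    congr 1
    · ring
    · exact Finset.sum_congr rfl fun k _ => by ring

/-- `N × N` complex matrices. -/
abbrev Mat (N : ℕ) : Type := Matrix (Fin N) (Fin N) ℂ

/-- The Hermitian matrix `M` with real coordinates `a`: `M_ii = a_ii` on the diagonal, and
`Re M_ij = a_ij`, `Im M_ij = a_ji` for `i < j`. -/
def hermitianOf {N : ℕ} (a : Fin N → Fin N → ℝ) : Mat N := Matrix.of fun i j =>
  if i = j then (a i i : ℂ)
  else if i < j then (a i j : ℂ) + (a j i : ℂ) * Complex.I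
  else (a j i : ℂ) - (a i j : ℂ) * Complex.I

/-- The coordinates parametrize exactly the Hermitian matrices, each one once. -/
theorem bijOn_hermitianOf (N : ℕ) :
    Set.BijOn (hermitianOf (N := N)) Set.univ {M : Mat N | M.IsHermitian} := by
  refine ⟨fun a _ => ?_, fun a _ b _ h => ?_, fun M hM => ?_⟩
  · refine Matrix.IsHermitian.ext fun i j => ?_
    rcases lt_trichotomy i j with hij | hij | hij
    · simp [hermitianOf, hij.ne, hij.ne', hij, hij.not_gt, sub_eq_add_neg]
    · subst hij
      simp [hermitianOf]
    · simp [hermitianOf, hij.ne, hij.ne', hij, hij.not_gt, sub_eq_add_neg]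
  · funext i j
    rcases lt_trichotomy i j with hij | hij | hij
    · simpa [hermitianOf, hij.ne, hij] using congrArg Complex.re (congrFun (congrFun h i) j)
    · subst hij
      simpa [hermitianOf] using congrArg Complex.re (congrFun (congrFun h i) i)
    · simpa [hermitianOf, hij.ne, hij] using congrArg Complex.im (congrFun (congrFun h j) i)
  · refine ⟨fun i j => if i ≤ j then (M i j).re else (M j i).im, trivial, ?_⟩
    ext i j
    have hij' : star (M j i) = M i j := hM.apply i j
    rcases lt_trichotomy i j with hij | hij | hij
    · simp [hermitianOf, hij.ne, hij, hij.le, hij.not_ge]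
    · subst hij
      have := Complex.conj_eq_iff_re.1 hij'
      simp [hermitianOf, this]
    · rw [← hij']
      apply Complex.ext <;> simp [hermitianOf, hij.ne', hij.not_gt, hij.le, hij.not_ge]

/-- The matrix `M₁ ⊗ 𝕀 + 𝕀 ⊗ M₂` of size `N² × N²`. -/
def tensorSum {N : ℕ} (M₁ M₂ : Mat N) : Matrix (Fin N × Fin N) (Fin N × Fin N) ℂ :=
  M₁ ⊗ₖ (1 : Mat N) + (1 : Mat N) ⊗ₖ M₂

/-- The unnormalized density `exp (-(N/T) tr (V₁(M₁) + V₂(M₂))) / det (M₁ ⊗ 𝕀 + 𝕀 ⊗ M₂)`, where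
`V_i(M_i)` is the functional calculus of the Hermitian matrix `M_i`. The trace and the determinant
are real for positive definite matrices. -/
def weight (V₁ V₂ : Potential) {N : ℕ} (T : ℝ) (M₁ M₂ : Mat N) : ℝ :=
  Real.exp (-(N / T) * (Matrix.trace (cfc V₁.eval M₁ + cfc V₂.eval M₂)).re) /
    (tensorSum M₁ M₂).det.re

/-- The domain of integration (in coordinates): both matrices are positive definite. -/
def posDefPairs (N : ℕ) : Set ((Fin N → Fin N → ℝ) × (Fin N → Fin N → ℝ)) :=
  {p | (hermitianOf p.1).PosDef ∧ (hermitianOf p.2).PosDef}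

/-- The partition function, for `dM = ∏_i dM_ii ∏_{i<j} d(Re M_ij) d(Im M_ij)`. -/
def partitionFunction (V₁ V₂ : Potential) (N : ℕ) (T : ℝ) : ℝ :=
  ∫ p in posDefPairs N, weight V₁ V₂ T (hermitianOf p.1) (hermitianOf p.2)

/-- The random variable `F(M₁, M₂)` has a well-defined average (absolute convergence). -/
def HasAverage (V₁ V₂ : Potential) {N : ℕ} (T : ℝ) (F : Mat N → Mat N → ℂ) : Prop :=
  IntegrableOn (fun p : (Fin N → Fin N → ℝ) × (Fin N → Fin N → ℝ) =>
    F (hermitianOf p.1) (hermitianOf p.2) *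
      (weight V₁ V₂ T (hermitianOf p.1) (hermitianOf p.2) : ℂ)) (posDefPairs N)

/-- The average `⟨F⟩` of the random variable `F(M₁, M₂)` in the Cauchy model. -/
def cauchyAverage (V₁ V₂ : Potential) {N : ℕ} (T : ℝ) (F : Mat N → Mat N → ℂ) : ℂ :=
  (1 / (partitionFunction V₁ V₂ N T : ℂ)) *
    ∫ p in posDefPairs N, F (hermitianOf p.1) (hermitianOf p.2) *
      (weight V₁ V₂ T (hermitianOf p.1) (hermitianOf p.2) : ℂ)

/-- `I₁ = (T/N) tr V₁'(M₁) + (T²/N²) Tr₁₂ (M₁ ⊗ 𝕀 + 𝕀 ⊗ M₂)⁻¹`. -/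
def I₁ (V₁ : Potential) {N : ℕ} (T : ℝ) (M₁ M₂ : Mat N) : ℂ :=
  (T / N : ℂ) * (V₁.deriv M₁).trace + (T ^ 2 / N ^ 2 : ℂ) * ((tensorSum M₁ M₂)⁻¹).trace

/-- `I₂ = -((T/N) tr V₂'(M₂) + (T²/N²) Tr₁₂ (M₁ ⊗ 𝕀 + 𝕀 ⊗ M₂)⁻¹)`. -/
def I₂ (V₂ : Potential) {N : ℕ} (T : ℝ) (M₁ M₂ : Mat N) : ℂ :=
  -((T / N : ℂ) * (V₂.deriv M₂).trace + (T ^ 2 / N ^ 2 : ℂ) * ((tensorSum M₁ M₂)⁻¹).trace)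

/-! The spectral parameter `x` lives in a field `K` containing `ℂ`. The case `K = ℂ` gives the
functions of a complex variable, and the case of `x = z⁻¹` in the field of formal Laurent series
in `z` gives their formal expansions in powers of `x⁻¹`. -/

section SpectralParameter

variable {K : Type*} [Field K] [Algebra ℂ K]

/-- A complex matrix, viewed as a matrix over `K`. -/
def toK (K : Type*) [Field K] [Algebra ℂ K] {N : ℕ} (M : Mat N) : Matrix (Fin N) (Fin N) K :=
  M.map (algebraMap ℂ K)

/-- `W₁(x) = (T/N) tr (x - M₁)⁻¹`. -/
def W₁ {N : ℕ} (T : ℝ) (x : K) (M₁ : Mat N) : K :=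
  (T / N : ℂ) • ((x • (1 : Matrix (Fin N) (Fin N) K) - toK K M₁)⁻¹).trace

/-- `W₂(x) = -(T/N) tr (x + M₂)⁻¹`. -/
def W₂ {N : ℕ} (T : ℝ) (x : K) (M₂ : Mat N) : K :=
  -((T / N : ℂ) • ((x • (1 : Matrix (Fin N) (Fin N) K) + toK K M₂)⁻¹).trace)

/-- `P₁(x) = (T/N) tr ((V₁'(x) - V₁'(M₁)) (x - M₁)⁻¹)`. -/
def P₁ (V₁ : Potential) {N : ℕ} (T : ℝ) (x : K) (M₁ : Mat N) : K :=
  (T / N : ℂ) • ((V₁.deriv x • (1 : Matrix (Fin N) (Fin N) K) - toK K (V₁.deriv M₁)) *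
    (x • (1 : Matrix (Fin N) (Fin N) K) - toK K M₁)⁻¹).trace

/-- `P₂(x) = -(T/N) tr ((V₂'(-x) - V₂'(M₂)) (x + M₂)⁻¹)`. -/
def P₂ (V₂ : Potential) {N : ℕ} (T : ℝ) (x : K) (M₂ : Mat N) : K :=
  -((T / N : ℂ) • ((V₂.deriv (-x) • (1 : Matrix (Fin N) (Fin N) K) - toK K (V₂.deriv M₂)) *
    (x • (1 : Matrix (Fin N) (Fin N) K) + toK K M₂)⁻¹).trace)

/-- `U₁'(x) = (2 V₁'(x) - V₂'(-x)) / 3`. -/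
def dU₁ (V₁ V₂ : Potential) (x : K) : K := (2 * V₁.deriv x - V₂.deriv (-x)) / 3

/-- `U₂'(x) = (-V₁'(x) + 2 V₂'(-x)) / 3`. -/
def dU₂ (V₁ V₂ : Potential) (x : K) : K := (-V₁.deriv x + 2 * V₂.deriv (-x)) / 3

/-- `Y₁(x) = U₁'(x) - W₁(x)`. -/
def Y₁ (V₁ V₂ : Potential) {N : ℕ} (T : ℝ) (x : K) (M₁ : Mat N) : K :=
  dU₁ V₁ V₂ x - W₁ T x M₁

/-- `Y₂(x) = U₂'(x) - W₂(x)`. -/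
def Y₂ (V₁ V₂ : Potential) {N : ℕ} (T : ℝ) (x : K) (M₂ : Mat N) : K :=
  dU₂ V₁ V₂ x - W₂ T x M₂

/-- `R(x) = (V₁'(x)² + V₂'(-x)² - V₁'(x) V₂'(-x)) / 3 - P₁(x) - P₂(x)`. -/
def R (V₁ V₂ : Potential) {N : ℕ} (T : ℝ) (x : K) (M₁ M₂ : Mat N) : K :=
  (V₁.deriv x ^ 2 + V₂.deriv (-x) ^ 2 - V₁.deriv x * V₂.deriv (-x)) / 3
    - P₁ V₁ T x M₁ - P₂ V₂ T x M₂

/-- The equivalent expression of `R(x)` through `U₁'` and `U₂'`. -/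
theorem R_eq (V₁ V₂ : Potential) {N : ℕ} (T : ℝ) (x : K) (M₁ M₂ : Mat N) :
    R V₁ V₂ T x M₁ M₂ = dU₁ V₁ V₂ x ^ 2 + dU₂ V₁ V₂ x ^ 2 + dU₁ V₁ V₂ x * dU₂ V₁ V₂ x
      - P₁ V₁ T x M₁ - P₂ V₂ T x M₂ := by
  have : CharZero K := charZero_of_injective_algebraMap (algebraMap ℂ K).injective
  unfold R dU₁ dU₂
  field_simp
  ring

end SpectralParameter

/-- The field `ℂ((x⁻¹))`: the `n`-th coefficient of a series is its coefficient of `x⁻ⁿ`. -/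
abbrev FormalSeries : Type := LaurentSeries ℂ

/-- The usual structure of a complex algebra: a scalar acts on each coefficient. -/
instance instAlgebraFormalSeries : Algebra ℂ FormalSeries := HahnSeries.instAlgebra

theorem algebraMap_formalSeries (c : ℂ) :
    algebraMap ℂ FormalSeries c = HahnSeries.single 0 c := rfl

/-- The formal spectral parameter `x`, which is the inverse of the variable `x⁻¹`. -/
def formalX : FormalSeries := HahnSeries.single (-1) 1

theorem one_div_formalX : 1 / formalX = HahnSeries.single 1 1 := by
  rw [one_div, eq_comm]
  apply eq_inv_of_mul_eq_one_left
  simp [formalX]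

end CauchyModel

end

open CauchyModel

/-! The identity is a Schwinger–Dyson equation: the integral of the divergence of a vector field
times the density vanishes. The field is `F(M₁)` in the direction of `M₁` minus `F(-M₂)` in the
direction of `M₂`, with `F(M) = (x - M)⁻¹`, or `F(M) = M ^ k` for the formal version. The divergence
produces products of two traces, and the potentials produce `tr V₁'(M₁) F(M₁)` and `tr V₂'(M₂)
F(-M₂)`. The Cauchy factor closes the equation: with `S = M₁ ⊗ 𝕀 + 𝕀 ⊗ M₂`, its derivative is the
trace of `S⁻¹ (F(M₁) ⊗ 𝕀 - 𝕀 ⊗ F(-M₂))`, and the bracket is `S` times the divided difference of `F`,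
so `S` cancels and a mixed product of traces remains (`logDeriv_apply_sub`). Thus `W₁² + W₂² + W₁
W₂` has the same average as a one-trace expression (`modelIntegral_loopVariable`), and pointwise
algebra turns this into the statement about `Y₁`, `Y₂`, `R` (`quadratic_identity`). The choice `F =
1` shows that `I₁ + I₂` has average zero, so the term in `1/x` contributes nothing.

The analytic difficulty is that `t₋₁` may be arbitrarily small: near the boundary the density
vanishes only like a small power of the determinants, while `V'` brings a factor `1 / det M` and `1
/ det S` blows up at the origin. With `D_k` the leading principal minors, the bound `∏ D_k(M₁) ∏
D_k(M₂) det M₂ ≤ 2^(N²) det S` (products over `k < N`) and its mirror image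
(`minorProd_mul_det_le_det_tensorSum`) dominate the integrand by a product of one-matrix densities
`det M ^ (α - 1) / ∏ D_k(M) * exp (-ε tr M)` with `α > 0`. Successive Schur complements reduce the
integral of such a density to the Gamma integral of `m ^ (α - 1) * exp (-ε m)`
(`lintegral_coneWeight_lt_top`). Hence every random variable with at most a simple pole in the
determinants has an average (`Singular.hasAverage`).

Boundary terms are removed by a cutoff in `det M₁ * det M₂` whose logarithmic derivative is bounded
uniformly in the scale (`setIntegral_hasLineDerivAt_eq_zero`); this needs integrability only, not
decay at the boundary. -/

noncomputable section

namespace CauchyModel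

open MeasureTheory
open scoped Matrix Kronecker ComplexOrder

/-! ### Schur complements and leading minors -/

section Schur

variable {N : ℕ}

/-- The Schur complement of the entry `(0, 0)`. -/
def schur (M : Mat (N + 1)) : Mat N :=
  Matrix.of fun i j => M i.succ j.succ - M i.succ 0 * M 0 j.succ / M 0 0

theorem det_eq_mul_det_schur (M : Mat (N + 1)) (h : M 0 0 ≠ 0) :
    M.det = M 0 0 * (schur M).det := by
  let B : Mat (N + 1) := Matrix.of fun i j => if i = 0 then M 0 j else M i j - M i 0 / M 0 0 * M 0 j
  have hB : M.det = B.det := by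
    refine Matrix.det_eq_of_forall_row_eq_smul_add_const
      (fun i => if i = 0 then 0 else M i 0 / M 0 0) 0 (by simp) fun i j => ?_
    by_cases hi : i = 0
    · subst hi; simp [B]
    · simp [B, hi]
  rw [hB, Matrix.det_succ_column_zero, Fin.sum_univ_succ, Finset.sum_eq_zero, add_zero]
  · simp only [Fin.val_zero, pow_zero, one_mul]
    congr 2
    ext i j
    simp [B, schur, Matrix.submatrix]
    ring
  · intro i _
    have : B i.succ 0 = 0 := by simp [B, h]
    simp [this]

/-- The matrix whose columns eliminate the first row. -/
def schurFrame (M : Mat (N + 1)) : Matrix (Fin (N + 1)) (Fin N) ℂ :=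
  Matrix.of fun i j => if i = 0 then -(M 0 j.succ / M 0 0) else if i = j.succ then 1 else 0

/-- The congruence form, with an injective frame, is what transfers positive definiteness to the
Schur complement. -/
theorem schur_eq_conj {M : Mat (N + 1)} (hM : M.IsHermitian) (h : M 0 0 ≠ 0) :
    schur M = (schurFrame M)ᴴ * M * schurFrame M := by
  ext i j
  have h0 : star (M 0 0) = M 0 0 := hM.apply 0 0
  have hi : star (M 0 i.succ) = M i.succ 0 := hM.apply _ _
  simp only [schur, schurFrame, Matrix.of_apply, Matrix.mul_apply, Fin.sum_univ_succ,
    Matrix.conjTranspose_apply, if_true, Fin.succ_ne_zero, if_false, star_neg, star_div₀, h0, hi,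
    Fin.succ_inj, apply_ite star, star_one, star_zero, ite_mul, mul_ite, one_mul, zero_mul, mul_one,
    mul_zero, Finset.sum_ite_eq', Finset.mem_univ]
  field_simp
  ring

theorem schur_posDef {M : Mat (N + 1)} (hM : M.PosDef) : (schur M).PosDef := by
  rw [schur_eq_conj hM.isHermitian hM.diag_pos.ne']
  refine hM.conjTranspose_mul_mul_same fun x y hxy => ?_
  funext i
  have := congrFun hxy i.succ
  simpa [schurFrame, Matrix.mulVec, dotProduct, Fin.succ_inj] using this

theorem entry_zero_pos {M : Mat (N + 1)} (hM : M.PosDef) : 0 < (M 0 0).re :=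
  (Complex.pos_iff.1 hM.diag_pos).1

theorem entry_zero_eq {M : Mat (N + 1)} (hM : M.IsHermitian) : ((M 0 0).re : ℂ) = M 0 0 :=
  Complex.conj_eq_iff_re.1 (hM.apply 0 0)

theorem det_re_pos {ι : Type*} [Fintype ι] [DecidableEq ι] {M : Matrix ι ι ℂ} (hM : M.PosDef) :
    0 < M.det.re :=
  (Complex.pos_iff.1 hM.det_pos).1

theorem det_re_eq {ι : Type*} [Fintype ι] [DecidableEq ι] {M : Matrix ι ι ℂ}
    (hM : M.IsHermitian) : (M.det.re : ℂ) = M.det := by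
  refine Complex.conj_eq_iff_re.1 ?_
  have := Matrix.det_conjTranspose M
  rw [hM.eq] at this
  exact this.symm

theorem det_re_eq_mul_schur {M : Mat (N + 1)} (hM : M.PosDef) :
    M.det.re = (M 0 0).re * (schur M).det.re := by
  rw [det_eq_mul_det_schur M hM.diag_pos.ne', ← entry_zero_eq hM.isHermitian,
    Complex.re_ofReal_mul, Complex.ofReal_re]

/-- By the matrix determinant lemma the right side is `det A * (1 + c v* A⁻¹ v)`, and `v* A⁻¹ v ≥
0`. -/
theorem det_le_det_add_vecMulVec {ι : Type*} [Fintype ι] [DecidableEq ι] {A : Matrix ι ι ℂ}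
    (hA : A.PosDef) (v : ι → ℂ) {c : ℝ} (hc : 0 ≤ c) :
    A.det.re ≤ (A + (c : ℂ) • Matrix.vecMulVec v (star v)).det.re := by
  have hu : IsUnit A.det := hA.det_pos.ne'.isUnit
  have h1 : A + (c : ℂ) • Matrix.vecMulVec v (star v)
      = A + Matrix.replicateCol Unit ((c : ℂ) • v) * Matrix.replicateRow Unit (star v) := by
    congr 1
    ext i j
    simp [Matrix.vecMulVec, Matrix.mul_apply, mul_assoc]
  rw [h1, Matrix.det_add_replicateCol_mul_replicateRow hu]
  have h2 : (Matrix.replicateRow Unit (star v) * A⁻¹ * Matrix.replicateCol Unit ((c : ℂ) • v)).det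
      = c * (star v ⬝ᵥ (A⁻¹ *ᵥ v)) := by
    rw [Matrix.det_unique, Matrix.mul_assoc, ← Matrix.replicateCol_mulVec]
    simp [Matrix.mul_apply, dotProduct, Matrix.mulVec_smul, Finset.mul_sum, mul_left_comm]
  have h3 : (1 + Matrix.replicateRow Unit (star v) * A⁻¹ *
      Matrix.replicateCol Unit ((c : ℂ) • v)).det = 1 + c * (star v ⬝ᵥ (A⁻¹ *ᵥ v)) := by
    rw [← h2, Matrix.det_unique, Matrix.det_unique]; rfl
  have h4 := Complex.nonneg_iff.1 (hA.inv.posSemidef.dotProduct_mulVec_nonneg v)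
  rw [h3, ← det_re_eq hA.isHermitian, Complex.re_ofReal_mul, Complex.ofReal_re, Complex.add_re,
    Complex.re_ofReal_mul, Complex.one_re]
  have := det_re_pos hA
  nlinarith [mul_nonneg hc h4.1, mul_nonneg this.le (mul_nonneg hc h4.1)]

/-- The leading principal minors, computed with successive Schur complements. -/
def leadingMinor : (k : ℕ) → {N : ℕ} → Mat N → ℝ
  | 0, _, _ => 1
  | _ + 1, 0, _ => 1
  | k + 1, _ + 1, M => (M 0 0).re * leadingMinor k (schur M)

theorem leadingMinor_pos (k : ℕ) : ∀ {N : ℕ} {M : Mat N}, M.PosDef → 0 < leadingMinor k M := by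
  induction k with
  | zero => intro N M _; simp [leadingMinor]
  | succ k ih =>
    intro N M hM
    cases N with
    | zero => simp [leadingMinor]
    | succ N => exact mul_pos (entry_zero_pos hM) (ih (schur_posDef hM))

theorem posDef_add_smul_one {M : Mat N} (hM : M.PosDef) {t : ℝ} (ht : 0 ≤ t) :
    (M + (t : ℂ) • (1 : Mat N)).PosDef :=
  hM.add_posSemidef (Matrix.PosSemidef.one.smul (by exact_mod_cast ht))

/-- In Gaussian elimination of `M + t` every pivot is at least the pivot of `M` plus `t`, because
the Schur complement of `M + t` dominates that of `M` shifted by `t`. The first `k` factors are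
bounded below by the pivots of `M`, the remaining ones by `t`. -/
theorem pow_mul_leadingMinor_le_det (k : ℕ) : ∀ {N : ℕ} {M : Mat N} (_ : M.PosDef) {t : ℝ}
    (_ : 0 ≤ t) (_ : k ≤ N), t ^ (N - k) * leadingMinor k M ≤ (M + (t : ℂ) • (1 : Mat N)).det.re := by
  have step : ∀ {N : ℕ} {M : Mat (N + 1)} (_ : M.PosDef) {t : ℝ} (_ : 0 ≤ t),
      ((M 0 0).re + t) * (schur M + (t : ℂ) • (1 : Mat N)).det.re
        ≤ (M + (t : ℂ) • (1 : Mat (N + 1))).det.re := by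
    intro N M hM t ht
    have hMt := posDef_add_smul_one hM ht
    rw [det_re_eq_mul_schur hMt]
    have h00 : ((M + (t : ℂ) • (1 : Mat (N + 1))) 0 0).re = (M 0 0).re + t := by simp
    have hm := entry_zero_pos hM
    rw [h00]
    refine mul_le_mul_of_nonneg_left ?_ (by linarith)
    -- With `m` the corner entry, the coefficient is `1/m - 1/(m + t)`: raising the pivot subtracts
    -- less of the rank-one term.
    have hS : schur (M + (t : ℂ) • (1 : Mat (N + 1)))
        = (schur M + (t : ℂ) • (1 : Mat N)) + ((t / ((M 0 0).re * ((M 0 0).re + t)) : ℝ) : ℂ) •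
          Matrix.vecMulVec (fun i : Fin N => M i.succ 0) (star fun i : Fin N => M i.succ 0) := by
      ext i j
      have hj : star (M j.succ 0) = M 0 j.succ := hM.isHermitian.apply _ _
      have hj' : (starRingEnd ℂ) (M j.succ 0) = M 0 j.succ := hj
      have e0 := entry_zero_eq hM.isHermitian
      have n0 : ((M 0 0).re : ℂ) ≠ 0 := by exact_mod_cast hm.ne'
      have n1 : ((M 0 0).re : ℂ) + t ≠ 0 := by exact_mod_cast (by linarith : (M 0 0).re + t ≠ 0)
      simp only [schur, Matrix.add_apply, Matrix.smul_apply, Matrix.of_apply, Matrix.vecMulVec_apply,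
        Pi.star_apply, hj, Matrix.one_apply, Fin.succ_ne_zero, (Fin.succ_ne_zero _).symm,
        Fin.succ_inj, if_true, if_false, smul_eq_mul, mul_zero, add_zero, mul_one]
      push_cast
      generalize hz : ((M 0 0).re : ℂ) = z at *
      rw [← e0]
      field_simp
      ring
    rw [hS]
    exact det_le_det_add_vecMulVec (posDef_add_smul_one (schur_posDef hM) ht) _ (by positivity)
  have zero : ∀ {N : ℕ} {M : Mat N} (_ : M.PosDef) {t : ℝ} (_ : 0 ≤ t),
      t ^ N ≤ (M + (t : ℂ) • (1 : Mat N)).det.re := by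
    intro N
    induction N with
    | zero => intro M _ t _; simp
    | succ N ih =>
      intro M hM t ht
      refine le_trans ?_ (step hM ht)
      rw [pow_succ']
      have := ih (schur_posDef hM) ht
      have := entry_zero_pos hM
      gcongr
      linarith
  induction k with
  | zero => intro N M hM t ht _; simpa [leadingMinor] using zero hM ht
  | succ k ih =>
    intro N M hM t ht hk
    cases N with
    | zero => omega
    | succ N =>
      refine le_trans ?_ (step hM ht)
      have h1 := ih (schur_posDef hM) ht (by omega)
      have h2 := entry_zero_pos hM
      have h3 := leadingMinor_pos k (schur_posDef hM)
      have h4 : (0:ℝ) ≤ t ^ (N - k) * leadingMinor k (schur M) := by positivity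
      rw [Nat.succ_sub_succ]
      calc t ^ (N - k) * leadingMinor (k + 1) M
          = (M 0 0).re * (t ^ (N - k) * leadingMinor k (schur M)) := by simp [leadingMinor]; ring
        _ ≤ _ := by gcongr; linarith

/-- The product of the leading principal minors of size less than `N`. -/
def minorProd (M : Mat N) : ℝ := ∏ k ∈ Finset.range N, leadingMinor k M

theorem minorProd_pos {M : Mat N} (hM : M.PosDef) : 0 < minorProd M :=
  Finset.prod_pos fun _ _ => leadingMinor_pos _ hM

theorem minorProd_succ (M : Mat (N + 1)) :
    minorProd M = (M 0 0).re ^ N * minorProd (schur M) := by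
  rw [minorProd, Finset.prod_range_succ']
  simp [leadingMinor, minorProd, Finset.prod_mul_distrib]

end Schur

/-! ### Diagonalization -/

section Diagonalization

variable {N : ℕ}

/-- The decreasing order serves to compare the `k`-th leading minor with the product of the `k`
largest eigenvalues. -/
theorem exists_antitone_diagonalization {M : Mat N} (hM : M.IsHermitian) :
    ∃ (U : Mat N) (l : Fin N → ℝ), Antitone l ∧ U * Uᴴ = 1 ∧ Uᴴ * U = 1 ∧
      M = U * Matrix.diagonal (fun i => (l i : ℂ)) * Uᴴ := by
  let l₀ : Fin N → ℝ := hM.eigenvalues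
  let U₀ : Mat N := hM.eigenvectorUnitary
  have hM' : M = U₀ * Matrix.diagonal (fun i => (l₀ i : ℂ)) * U₀ᴴ := by
    have := hM.spectral_theorem
    rw [Unitary.conjStarAlgAut_apply] at this
    exact this
  have h1 : U₀ * U₀ᴴ = 1 := Unitary.mul_star_self_of_mem hM.eigenvectorUnitary.2
  have h2 : U₀ᴴ * U₀ = 1 := Unitary.star_mul_self_of_mem hM.eigenvectorUnitary.2
  let σ : Equiv.Perm (Fin N) := Tuple.sort (fun i => -l₀ i)
  have hσ : Monotone ((fun i => -l₀ i) ∘ σ) := Tuple.monotone_sort _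
  refine ⟨U₀.submatrix id σ, l₀ ∘ σ, fun i j hij => by simpa using hσ hij, ?_, ?_, ?_⟩
  · rw [Matrix.conjTranspose_submatrix, Matrix.submatrix_mul_equiv, h1]; simp
  · rw [Matrix.conjTranspose_submatrix, ← Matrix.submatrix_mul U₀ᴴ U₀ σ id σ Function.bijective_id,
      h2]; simp
  · have : (Matrix.diagonal fun i => (((l₀ ∘ σ) i : ℝ) : ℂ))
        = (Matrix.diagonal fun i => (l₀ i : ℂ)).submatrix σ σ := by
      rw [Matrix.submatrix_diagonal_equiv]; rfl
    rw [this, Matrix.conjTranspose_submatrix, Matrix.submatrix_mul_equiv, Matrix.submatrix_mul_equiv,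
      ← hM']
    simp

theorem diagonalization_pos {M U : Mat N} {l : Fin N → ℝ} (hM : M.PosDef)
    (h1 : Uᴴ * U = 1) (h : M = U * Matrix.diagonal (fun i => (l i : ℂ)) * Uᴴ) (i : Fin N) :
    0 < l i := by
  have hd : Uᴴ * M * U = Matrix.diagonal (fun i => (l i : ℂ)) := by
    rw [h]
    calc Uᴴ * (U * Matrix.diagonal (fun i => (l i : ℂ)) * Uᴴ) * U
        = (Uᴴ * U) * Matrix.diagonal (fun i => (l i : ℂ)) * (Uᴴ * U) := by noncomm_ring
      _ = _ := by simp [h1]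
  have h2 : (Uᴴ * M * U).PosDef := by
    refine hM.conjTranspose_mul_mul_same fun x y hxy => ?_
    have := congrArg (fun z => Uᴴ *ᵥ z) hxy
    simpa [Matrix.mulVec_mulVec, h1] using this
  rw [hd] at h2
  have := h2.diag_pos (i := i)
  simpa using this

/-- Adding a scalar acts on the eigenvalues. -/
theorem det_add_smul_one_of_diagonalization {M U : Mat N} {l : Fin N → ℝ} (h1 : U * Uᴴ = 1)
    (h : M = U * Matrix.diagonal (fun i => (l i : ℂ)) * Uᴴ) (t : ℂ) :
    (M + t • (1 : Mat N)).det = ∏ i, ((l i : ℂ) + t) := by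
  have : M + t • (1 : Mat N) = U * Matrix.diagonal (fun i => (l i : ℂ) + t) * Uᴴ := by
    have hd : Matrix.diagonal (fun i => (l i : ℂ) + t)
        = Matrix.diagonal (fun i => (l i : ℂ)) + t • (1 : Mat N) := by
      ext i j
      by_cases hij : i = j
      · subst hij; simp
      · simp [hij]
    rw [hd, mul_add, add_mul, ← h]
    simp [h1]
  have hU : U.det * Uᴴ.det = 1 := by rw [← Matrix.det_mul, h1, Matrix.det_one]
  rw [this, Matrix.det_mul, Matrix.det_mul, Matrix.det_diagonal, mul_right_comm, hU, one_mul]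

/-- The joint diagonalization of `M₁ ⊗ 𝕀 + 𝕀 ⊗ M₂`. -/
theorem tensorSum_diagonalization {M₁ M₂ U V : Mat N} {l m : Fin N → ℝ} (hU : U * Uᴴ = 1)
    (hV : V * Vᴴ = 1) (h₁ : M₁ = U * Matrix.diagonal (fun i => (l i : ℂ)) * Uᴴ)
    (h₂ : M₂ = V * Matrix.diagonal (fun i => (m i : ℂ)) * Vᴴ) :
    tensorSum M₁ M₂ = (U ⊗ₖ V) * Matrix.diagonal (fun p => (l p.1 : ℂ) + m p.2) * (Uᴴ ⊗ₖ Vᴴ) := by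
  have hd : (Matrix.diagonal (fun p : Fin N × Fin N => (l p.1 : ℂ) + m p.2))
      = Matrix.diagonal (fun i => (l i : ℂ)) ⊗ₖ (1 : Mat N)
        + (1 : Mat N) ⊗ₖ Matrix.diagonal (fun i => (m i : ℂ)) := by
    rw [← Matrix.diagonal_one, Matrix.diagonal_kronecker_diagonal,
      Matrix.diagonal_kronecker_diagonal, Matrix.diagonal_add]
    simp
  rw [hd, mul_add, add_mul, ← Matrix.mul_kronecker_mul, ← Matrix.mul_kronecker_mul,
    ← Matrix.mul_kronecker_mul, ← Matrix.mul_kronecker_mul, ← h₁, ← h₂]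
  simp [hU, hV, tensorSum]

theorem kronecker_unitary {U V : Mat N} (hU : U * Uᴴ = 1) (hV : V * Vᴴ = 1) :
    (U ⊗ₖ V) * (Uᴴ ⊗ₖ Vᴴ) = 1 := by
  rw [← Matrix.mul_kronecker_mul, hU, hV, Matrix.one_kronecker_one]

theorem det_tensorSum_of_diagonalization {M₁ M₂ U V : Mat N} {l m : Fin N → ℝ}
    (hU : U * Uᴴ = 1) (hV : V * Vᴴ = 1)
    (h₁ : M₁ = U * Matrix.diagonal (fun i => (l i : ℂ)) * Uᴴ)
    (h₂ : M₂ = V * Matrix.diagonal (fun i => (m i : ℂ)) * Vᴴ) :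
    (tensorSum M₁ M₂).det = ∏ p : Fin N × Fin N, ((l p.1 : ℂ) + m p.2) := by
  have h : (U ⊗ₖ V).det * (Uᴴ ⊗ₖ Vᴴ).det = 1 := by
    rw [← Matrix.det_mul, kronecker_unitary hU hV, Matrix.det_one]
  rw [tensorSum_diagonalization hU hV h₁ h₂, Matrix.det_mul, Matrix.det_mul, Matrix.det_diagonal,
    mul_right_comm, h, one_mul]

theorem tensorSum_posDef {M₁ M₂ : Mat N} (h₁ : M₁.PosDef) (h₂ : M₂.PosDef) :
    (tensorSum M₁ M₂).PosDef :=
  (h₁.kronecker Matrix.PosDef.one).add (Matrix.PosDef.one.kronecker h₂)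

theorem det_tensorSum_comm {M₁ M₂ : Mat N} (h₁ : M₁.IsHermitian) (h₂ : M₂.IsHermitian) :
    (tensorSum M₁ M₂).det = (tensorSum M₂ M₁).det := by
  obtain ⟨U, l, -, hU, -, e₁⟩ := exists_antitone_diagonalization h₁
  obtain ⟨V, m, -, hV, -, e₂⟩ := exists_antitone_diagonalization h₂
  rw [det_tensorSum_of_diagonalization hU hV e₁ e₂, det_tensorSum_of_diagonalization hV hU e₂ e₁,
    ← (Equiv.prodComm _ _).prod_comp]
  exact Finset.prod_congr rfl fun p _ => add_comm _ _

end Diagonalization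

end CauchyModel

end

noncomputable section
namespace CauchyModel
open MeasureTheory
open scoped Matrix Kronecker ComplexOrder

/-! ### A lower bound for the Cauchy determinant -/

section LowerBound

variable {N : ℕ}

/-- Take `t = m k` in `pow_mul_leadingMinor_le_det`. In `det (M + t) = ∏ (m i + m k)` each factor is
at most twice the larger of the two eigenvalues, and `m k ^ (N - k)` cancels. -/
theorem leadingMinor_le_prod {M U : Mat N} {m : Fin N → ℝ} (hM : M.PosDef) (hU : U * Uᴴ = 1)
    (h : M = U * Matrix.diagonal (fun i => (m i : ℂ)) * Uᴴ) (hm : ∀ i, 0 < m i) (ha : Antitone m)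
    (k : Fin N) : leadingMinor k M ≤ 2 ^ N * ∏ i, (if i < k then m i else 1) := by
  have h1 := pow_mul_leadingMinor_le_det (k : ℕ) hM (hm k).le k.2.le
  have h2 : (M + ((m k : ℝ) : ℂ) • (1 : Mat N)).det.re = ∏ i, (m i + m k) := by
    rw [det_add_smul_one_of_diagonalization hU h]
    exact_mod_cast Complex.ofReal_re (∏ i, (m i + m k))
  have h3 : ∏ i, (m i + m k) ≤ ∏ i, (2 * ((if i < k then m i else 1) * if i < k then 1 else m k)) := by
    refine Finset.prod_le_prod (fun i _ => (add_pos (hm i) (hm k)).le) fun i _ => ?_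
    by_cases hik : i < k
    · have := ha hik.le
      simp only [hik, if_true]; linarith
    · have := ha (not_lt.1 hik)
      simp only [hik, if_false]; linarith
  have h4 : ∏ i, (if i < k then 1 else m k) = m k ^ (N - k) := by
    rw [Finset.prod_ite, Finset.prod_const_one, one_mul, Finset.prod_const]
    congr 1
    have : Finset.univ.filter (fun i => ¬ i < k) = Finset.Ici k := by ext; simp
    rw [this, Fin.card_Ici]
  rw [Finset.prod_mul_distrib, Finset.prod_mul_distrib, h4] at h3
  simp only [Finset.prod_const, Finset.card_univ, Fintype.card_fin] at h3
  rw [h2] at h1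
  have h5 : 0 < m k ^ (N - k) := pow_pos (hm k) _
  refine le_of_mul_le_mul_left (h1.trans (h3.trans (le_of_eq ?_))) h5
  ring

/-- The determinant of the tensor sum is the product of `det (M₁ + m j)` over the eigenvalues `m j`
of `M₂`. The `j`-th factor is bounded below through the `j`-th minor of `M₁`, so that larger
eigenvalues carry larger powers; these powers in turn dominate `det M₂` times the minors of `M₂`. -/
theorem minorProd_mul_det_le_det_tensorSum {M₁ M₂ : Mat N} (h₁ : M₁.PosDef) (h₂ : M₂.PosDef) :
    minorProd M₁ * minorProd M₂ * M₂.det.re ≤ 2 ^ (N * N) * (tensorSum M₁ M₂).det.re := by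
  obtain ⟨U, l, -, hU, hU', e₁⟩ := exists_antitone_diagonalization h₁.isHermitian
  obtain ⟨V, m, ha, hV, hV', e₂⟩ := exists_antitone_diagonalization h₂.isHermitian
  have hm := diagonalization_pos h₂ hV' e₂
  have hdet : (tensorSum M₁ M₂).det.re = ∏ j, (M₁ + ((m j : ℝ) : ℂ) • (1 : Mat N)).det.re := by
    have : ∀ j, (M₁ + ((m j : ℝ) : ℂ) • (1 : Mat N)).det.re = ∏ i, (l i + m j) := fun j => by
      rw [det_add_smul_one_of_diagonalization hU e₁]
      exact_mod_cast Complex.ofReal_re (∏ i, (l i + m j))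
    rw [det_tensorSum_of_diagonalization hU hV e₁ e₂, Finset.prod_congr rfl fun j _ => this j,
      Fintype.prod_prod_type_right]
    exact_mod_cast Complex.ofReal_re (∏ j, ∏ i, (l i + m j))
  have hdet₂ : M₂.det.re = ∏ i, m i := by
    have := det_add_smul_one_of_diagonalization hV e₂ 0
    simp only [zero_smul, add_zero] at this
    rw [this]
    exact_mod_cast Complex.ofReal_re (∏ i, m i)
  have hlow : ∏ j : Fin N, (m j ^ (N - j) * leadingMinor j M₁) ≤ (tensorSum M₁ M₂).det.re := by
    rw [hdet]
    exact Finset.prod_le_prod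
      (fun j _ => mul_nonneg (pow_nonneg (hm j).le _) (leadingMinor_pos _ h₁).le)
      fun j _ => pow_mul_leadingMinor_le_det j h₁ (hm j).le j.2.le
  have hQ : minorProd M₂ ≤ 2 ^ (N * N) * ∏ j : Fin N, m j ^ (N - 1 - j) := by
    calc minorProd M₂ = ∏ k : Fin N, leadingMinor k M₂ := by rw [minorProd, Finset.prod_range]
      _ ≤ ∏ k : Fin N, (2 ^ N * ∏ i, (if i < k then m i else 1)) :=
        Finset.prod_le_prod (fun k _ => (leadingMinor_pos _ h₂).le)
          fun k _ => leadingMinor_le_prod h₂ hV e₂ hm ha k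
      _ = 2 ^ (N * N) * ∏ i, ∏ k : Fin N, (if i < k then m i else 1) := by
        rw [Finset.prod_mul_distrib, Finset.prod_comm]
        simp [pow_mul]
      -- The eigenvalue of index `i` occurs once for each `k > i`.
      _ = 2 ^ (N * N) * ∏ j : Fin N, m j ^ (N - 1 - j) := by
        congr 1
        refine Finset.prod_congr rfl fun i _ => ?_
        rw [Finset.prod_ite, Finset.prod_const_one, mul_one, Finset.prod_const]
        congr 1
        have : Finset.univ.filter (fun k => i < k) = Finset.Ioi i := by ext; simp
        rw [this, Fin.card_Ioi]
  -- One factor is split off each power `m j ^ (N - j)`, and together these form `det M₂`.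
  have hP : ∏ j : Fin N, (m j ^ (N - j) * leadingMinor j M₁)
      = minorProd M₁ * (M₂.det.re * ∏ j : Fin N, m j ^ (N - 1 - j)) := by
    have e : ∏ j : Fin N, m j ^ (N - j) = M₂.det.re * ∏ j : Fin N, m j ^ (N - 1 - j) := by
      rw [hdet₂, ← Finset.prod_mul_distrib]
      refine Finset.prod_congr rfl fun j _ => ?_
      rw [← pow_succ']
      congr 1
      have := j.2
      omega
    rw [Finset.prod_mul_distrib, e, minorProd, Finset.prod_range]
    ring
  have p1 := minorProd_pos h₁
  have p2 := det_re_pos h₂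
  calc minorProd M₁ * minorProd M₂ * M₂.det.re
      ≤ minorProd M₁ * (2 ^ (N * N) * ∏ j : Fin N, m j ^ (N - 1 - j)) * M₂.det.re := by gcongr
    _ = 2 ^ (N * N) * ∏ j : Fin N, (m j ^ (N - j) * leadingMinor j M₁) := by rw [hP]; ring
    _ ≤ _ := by gcongr

theorem minorProd_mul_det_le_det_tensorSum' {M₁ M₂ : Mat N} (h₁ : M₁.PosDef) (h₂ : M₂.PosDef) :
    minorProd M₁ * minorProd M₂ * M₁.det.re ≤ 2 ^ (N * N) * (tensorSum M₁ M₂).det.re := by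
  rw [det_tensorSum_comm h₁.isHermitian h₂.isHermitian, mul_comm (minorProd M₁)]
  exact minorProd_mul_det_le_det_tensorSum h₂ h₁

end LowerBound

end CauchyModel
end

noncomputable section
namespace CauchyModel
open MeasureTheory
open scoped Matrix Kronecker ComplexOrder

/-! ### Integrability on the cone of positive definite matrices -/

section Cone

variable {N : ℕ}

/-- Coordinates of the Schur complement. -/
def schurCoord (m : ℝ) (u v : Fin N → ℝ) (b : Fin N → Fin N → ℝ) : Fin N → Fin N → ℝ :=
  b - fun i j => (if i ≤ j then u i * u j + v i * v j else v i * u j - u i * v j) / m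

theorem hermitianOf_zero_zero (a : Fin (N + 1) → Fin (N + 1) → ℝ) :
    hermitianOf a 0 0 = (a 0 0 : ℂ) := by simp [hermitianOf]

/-- With the first row and column fixed, taking the Schur complement is a translation of the
remaining coordinates, hence invisible to Lebesgue measure. -/
theorem hermitianOf_schurCoord (a : Fin (N + 1) → Fin (N + 1) → ℝ) :
    hermitianOf (schurCoord (a 0 0) (fun j => a 0 j.succ) (fun i => a i.succ 0)
      fun i j => a i.succ j.succ) = schur (hermitianOf a) := by
  ext i j
  have h1 : hermitianOf a i.succ 0 = (a 0 i.succ : ℂ) - a i.succ 0 * Complex.I := by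
    simp [hermitianOf, Fin.succ_ne_zero]
  have h2 : hermitianOf a 0 j.succ = (a 0 j.succ : ℂ) + a j.succ 0 * Complex.I := by
    simp [hermitianOf, (Fin.succ_ne_zero _).symm]
  simp only [schur, Matrix.of_apply, h1, h2, hermitianOf_zero_zero]
  rcases lt_trichotomy i j with hij | hij | hij
  · simp only [hermitianOf, schurCoord, Matrix.of_apply, hij.ne, hij, hij.le, hij.not_ge, if_true,
      if_false, Fin.succ_inj, Fin.succ_lt_succ_iff, Pi.sub_apply]
    push_cast
    ring_nf
    rw [Complex.I_sq]
    ring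
  · subst hij
    simp only [hermitianOf, schurCoord, Matrix.of_apply, if_true, le_refl, Pi.sub_apply]
    push_cast
    ring_nf
    rw [Complex.I_sq]
    ring
  · simp only [hermitianOf, schurCoord, Matrix.of_apply, hij.ne', hij.not_gt, hij.le, hij.not_ge,
      if_true, if_false, Fin.succ_inj, Fin.succ_lt_succ_iff, Pi.sub_apply]
    push_cast
    ring_nf
    rw [Complex.I_sq]
    ring

theorem trace_hermitianOf (a : Fin N → Fin N → ℝ) :
    (hermitianOf a).trace.re = ∑ i, a i i := by
  simp [Matrix.trace, hermitianOf]

/-- The density of the first pivot. -/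
def pivotWeight (α ε : ℝ) (N : ℕ) (m : ℝ) : ENNReal :=
  if 0 < m then ENNReal.ofReal (m ^ (α - N) * Real.exp (-ε * m)) else 0

/-- The Gaussian density of the entries of the first row or column. -/
def rowWeight (ε m : ℝ) (u : Fin N → ℝ) : ENNReal :=
  ENNReal.ofReal (∏ i, Real.exp (-(ε / m) * u i ^ 2))

/-- The recursive form of the density `det M ^ α / ∏_{k < N} D_k(M) * exp (-ε tr M)` on the cone of
positive definite matrices, where the `D_k` are the leading principal minors. -/
def coneWeight (α ε : ℝ) : (N : ℕ) → (Fin N → Fin N → ℝ) → ENNReal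
  | 0, _ => 1
  | N + 1, a =>
    pivotWeight α ε N (a 0 0) * (rowWeight ε (a 0 0) (fun j => a 0 j.succ) *
      rowWeight ε (a 0 0) fun i => a i.succ 0) *
      coneWeight α ε N (schurCoord (a 0 0) (fun j => a 0 j.succ) (fun i => a i.succ 0)
        fun i j => a i.succ j.succ)

/-- With pivot `m`, the trace is `m`, plus the trace of the Schur complement, plus the squared
moduli of the first row divided by `m`. The exponential therefore factors into Gaussians, and the
determinant and the minors contribute `m ^ α / m ^ N`. -/
theorem coneWeight_eq (α ε : ℝ) : ∀ {N : ℕ} (a : Fin N → Fin N → ℝ), (hermitianOf a).PosDef →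
    coneWeight α ε N a = ENNReal.ofReal ((hermitianOf a).det.re ^ α * (minorProd (hermitianOf a))⁻¹ *
      Real.exp (-ε * (hermitianOf a).trace.re))
  | 0, a, _ => by simp [coneWeight, minorProd, Matrix.trace]
  | N + 1, a, ha => by
    have hm : 0 < a 0 0 := by
      have := entry_zero_pos ha
      rwa [hermitianOf_zero_zero, Complex.ofReal_re] at this
    have hS := schur_posDef ha
    have ih := coneWeight_eq α ε (schurCoord (a 0 0) (fun j => a 0 j.succ) (fun i => a i.succ 0)
      fun i j => a i.succ j.succ) (by rwa [hermitianOf_schurCoord])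
    rw [coneWeight, ih, pivotWeight, rowWeight, rowWeight, if_pos hm, hermitianOf_schurCoord, det_re_eq_mul_schur ha, minorProd_succ,
      hermitianOf_zero_zero, Complex.ofReal_re]
    have hd := det_re_pos hS
    have hq := minorProd_pos hS
    rw [← ENNReal.ofReal_mul (by positivity), ← ENNReal.ofReal_mul (by positivity),
      ← ENNReal.ofReal_mul (by positivity)]
    congr 1
    have htr : (hermitianOf a).trace.re = a 0 0 + (schur (hermitianOf a)).trace.re
        + (∑ i : Fin N, a 0 i.succ ^ 2 / a 0 0 + ∑ i : Fin N, a i.succ 0 ^ 2 / a 0 0) := by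
      rw [← hermitianOf_schurCoord, trace_hermitianOf, trace_hermitianOf, Fin.sum_univ_succ,
        add_assoc, ← Finset.sum_add_distrib, ← Finset.sum_add_distrib]
      congr 1
      refine Finset.sum_congr rfl fun i _ => ?_
      simp only [schurCoord, Pi.sub_apply, le_refl, if_true]
      ring
    rw [htr, ← Real.exp_sum, ← Real.exp_sum, Real.mul_rpow hm.le hd.le, Real.rpow_sub hm,
      Real.rpow_natCast, mul_inv, mul_add, mul_add, mul_add, Real.exp_add, Real.exp_add,
      Real.exp_add, Finset.mul_sum, Finset.mul_sum]
    have e : ∀ w : Fin N → ℝ, ∑ i, -(ε / a 0 0) * w i ^ 2 = ∑ i, -ε * (w i ^ 2 / a 0 0) :=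
      fun w => Finset.sum_congr rfl fun i _ => by ring
    rw [e, e]
    field_simp

/-! ### Finiteness of the cone integral by splitting off the first row and column -/

theorem measurable_schurCoord :
    Measurable fun p : (ℝ × (Fin N → ℝ)) × (Fin N → ℝ) × (Fin N → Fin N → ℝ) =>
      schurCoord p.1.1 p.1.2 p.2.1 p.2.2 := by
  refine measurable_pi_lambda _ fun i => measurable_pi_lambda _ fun j => ?_
  simp only [schurCoord, Pi.sub_apply]
  split_ifs <;> fun_prop

theorem measurable_pivotWeight (α ε : ℝ) (N : ℕ) : Measurable (pivotWeight α ε N) :=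
  Measurable.ite (measurableSet_lt measurable_const measurable_id) (by fun_prop) measurable_const

theorem measurable_rowWeight (ε : ℝ) :
    Measurable fun p : ℝ × (Fin N → ℝ) => rowWeight ε p.1 p.2 := by
  unfold rowWeight
  fun_prop

/-- The density `coneWeight` of size `N + 1` in terms of the first row, the first column and the
remaining entries. -/
def splitWeight (α ε : ℝ) (p : (ℝ × (Fin N → ℝ)) × (Fin N → ℝ) × (Fin N → Fin N → ℝ)) : ENNReal :=
  pivotWeight α ε N p.1.1 * (rowWeight ε p.1.1 p.1.2 * rowWeight ε p.1.1 p.2.1) *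
    coneWeight α ε N (schurCoord p.1.1 p.1.2 p.2.1 p.2.2)

theorem measurable_splitWeight {α ε : ℝ} (h : Measurable (coneWeight α ε N)) :
    Measurable (splitWeight (N := N) α ε) := by
  have h1 : Measurable fun p : (ℝ × (Fin N → ℝ)) × (Fin N → ℝ) × (Fin N → Fin N → ℝ) =>
      pivotWeight α ε N p.1.1 := (measurable_pivotWeight α ε N).comp (by fun_prop)
  have h2 : Measurable fun p : (ℝ × (Fin N → ℝ)) × (Fin N → ℝ) × (Fin N → Fin N → ℝ) =>
      rowWeight ε p.1.1 p.1.2 := (measurable_rowWeight ε).comp measurable_fst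
  have h3 : Measurable fun p : (ℝ × (Fin N → ℝ)) × (Fin N → ℝ) × (Fin N → Fin N → ℝ) =>
      rowWeight ε p.1.1 p.2.1 :=
    (measurable_rowWeight ε).comp ((measurable_fst.comp measurable_fst).prodMk
      (measurable_fst.comp measurable_snd))
  exact (h1.mul (h2.mul h3)).mul (h.comp measurable_schurCoord)

theorem measurable_coneWeight (α ε : ℝ) : ∀ N : ℕ, Measurable (coneWeight α ε N)
  | 0 => measurable_const
  | N + 1 => (measurable_splitWeight (measurable_coneWeight α ε N)).comp
      (g := splitWeight α ε) (f := fun a : Fin (N + 1) → Fin (N + 1) → ℝ =>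
        ((a 0 0, fun j => a 0 j.succ), (fun i => a i.succ 0, fun i j => a i.succ j.succ)))
        (by fun_prop)

/-- Splitting off the first row and the first column preserves Lebesgue measure. -/
theorem measurePreserving_splitFirst (N : ℕ) :
    MeasurePreserving (fun a : Fin (N + 1) → Fin (N + 1) → ℝ =>
      (((a 0 0, fun j => a 0 j.succ), (fun i => a i.succ 0, fun i j => a i.succ j.succ)) :
        (ℝ × (Fin N → ℝ)) × (Fin N → ℝ) × (Fin N → Fin N → ℝ))) volume volume := by
  have h1 := volume_preserving_piFinSuccAbove (fun _ : Fin (N + 1) => Fin (N + 1) → ℝ) 0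
  have h2 := volume_preserving_piFinSuccAbove (fun _ : Fin (N + 1) => ℝ) 0
  have h3 : MeasurePreserving (fun (c : Fin N → Fin (N + 1) → ℝ) i =>
      MeasurableEquiv.piFinSuccAbove (fun _ : Fin (N + 1) => ℝ) 0 (c i)) volume volume :=
    volume_preserving_pi (fun _ => h2)
  have h4 := (volume_measurePreserving_arrowProdEquivProdArrow ℝ (Fin N → ℝ) (Fin N)).comp h3
  exact (h2.prod h4).comp h1

theorem lintegral_prod_gaussian {c : ℝ} (hc : 0 < c) :
    ∫⁻ u : Fin N → ℝ, ENNReal.ofReal (∏ i, Real.exp (-c * u i ^ 2))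
      = ENNReal.ofReal (√(Real.pi / c) ^ N) := by
  have h := integrable_exp_neg_mul_sq hc
  rw [← ofReal_integral_eq_lintegral_ofReal]
  · rw [integral_fintype_prod_volume_eq_pow (fun x : ℝ => Real.exp (-c * x ^ 2)), integral_gaussian]
    simp
  · exact Integrable.fintype_prod (f := fun _ x => Real.exp (-c * x ^ 2)) fun _ => h
  · exact Filter.Eventually.of_forall fun u => Finset.prod_nonneg fun _ _ => (Real.exp_pos _).le

/-- Translation invariance in the lower block makes the integral of the Schur factor independent of
the first row and column. -/
theorem lintegral_splitWeight_inner {α ε : ℝ} (q : ℝ × (Fin N → ℝ)) :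
    ∫⁻ r, splitWeight α ε (q, r) = ∫⁻ v : Fin N → ℝ, pivotWeight α ε N q.1 *
      (rowWeight ε q.1 q.2 * rowWeight ε q.1 v) * ∫⁻ a, coneWeight α ε N a := by
  have hm := measurable_coneWeight α ε N
  rw [Measure.volume_eq_prod, lintegral_prod]
  · refine lintegral_congr fun v => ?_
    simp only [splitWeight]
    rw [lintegral_const_mul]
    · congr 1
      exact lintegral_sub_right_eq_self (coneWeight α ε N) _
    · exact hm.comp (measurable_schurCoord.comp (f := fun b => (q, (v, b))) (by fun_prop))
  · exact ((measurable_splitWeight hm).comp (f := fun r => (q, r)) (by fun_prop)).aemeasurable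

theorem lintegral_rowWeight {ε m : ℝ} (hε : 0 < ε) (hm : 0 < m) :
    ∫⁻ u : Fin N → ℝ, rowWeight ε m u = ENNReal.ofReal (√(Real.pi / (ε / m)) ^ N) :=
  lintegral_prod_gaussian (by positivity)

/-- The `2N` Gaussian integrals give `(π m / ε) ^ N`, which cancels the `m ^ (-N)` of the pivot
density. What remains is `m ^ α`, integrable at `0` exactly when `α > -1`, whatever the size. -/
theorem lintegral_pivotWeight_rowWeight {α ε : ℝ} (hε : 0 < ε) (C : ENNReal) (m : ℝ) :
    ∫⁻ u : Fin N → ℝ, ∫⁻ v : Fin N → ℝ, pivotWeight α ε N m *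
      (rowWeight ε m u * rowWeight ε m v) * C
        = ENNReal.ofReal ((Real.pi / ε) ^ N) * C *
          (Set.Ioi (0:ℝ)).indicator (fun m => ENNReal.ofReal (m ^ α * Real.exp (-ε * m))) m := by
  by_cases hm : 0 < m
  · have hγm : Measurable (rowWeight (N := N) ε m) :=
      (measurable_rowWeight ε).comp (f := fun u => (m, u)) (by fun_prop)
    have hG := lintegral_rowWeight (N := N) hε hm
    have h1 : ∀ u : Fin N → ℝ, ∫⁻ v : Fin N → ℝ,
        pivotWeight α ε N m * (rowWeight ε m u * rowWeight ε m v) * C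
        = pivotWeight α ε N m * C * ENNReal.ofReal (√(Real.pi / (ε / m)) ^ N) * rowWeight ε m u :=
      fun u => by
      rw [← hG]
      calc ∫⁻ v : Fin N → ℝ, pivotWeight α ε N m * (rowWeight ε m u * rowWeight ε m v) * C
          = ∫⁻ v : Fin N → ℝ, (pivotWeight α ε N m * C * rowWeight ε m u) * rowWeight ε m v :=
            lintegral_congr fun v => by ring
        _ = _ := by rw [lintegral_const_mul _ hγm]; ring
    rw [lintegral_congr h1, lintegral_const_mul _ hγm, hG, Set.indicator_of_mem (by exact hm)]
    have hs : √(Real.pi / (ε / m)) ^ N * √(Real.pi / (ε / m)) ^ N = (Real.pi / ε) ^ N * m ^ N := by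
      rw [← mul_pow, Real.mul_self_sqrt (by positivity), ← mul_pow]
      congr 1
      field_simp
    calc pivotWeight α ε N m * C * ENNReal.ofReal (√(Real.pi / (ε / m)) ^ N)
          * ENNReal.ofReal (√(Real.pi / (ε / m)) ^ N)
        = C * (pivotWeight α ε N m *
            ENNReal.ofReal (√(Real.pi / (ε / m)) ^ N * √(Real.pi / (ε / m)) ^ N)) := by
          rw [ENNReal.ofReal_mul (by positivity)]; ring
      _ = C * ENNReal.ofReal ((Real.pi / ε) ^ N * (m ^ α * Real.exp (-ε * m))) := by
          rw [pivotWeight, if_pos hm, ← ENNReal.ofReal_mul (by positivity), hs, Real.rpow_sub hm,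
            Real.rpow_natCast]
          congr 2
          field_simp
      _ = _ := by rw [ENNReal.ofReal_mul (by positivity)]; ring
  · simp [pivotWeight, hm]

theorem lintegral_coneWeight_succ_lt_top {α ε : ℝ} (hα : -1 < α) (hε : 0 < ε) (N : ℕ)
    (ih : ∫⁻ a, coneWeight α ε N a < ⊤) : ∫⁻ a, coneWeight α ε (N + 1) a < ⊤ := by
  have hm := measurable_splitWeight (measurable_coneWeight α ε N)
  have key : ∫⁻ a, coneWeight α ε (N + 1) a = ∫⁻ p, splitWeight (N := N) α ε p :=
    (measurePreserving_splitFirst N).lintegral_comp hm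
  rw [key, Measure.volume_eq_prod, lintegral_prod _ hm.aemeasurable,
    lintegral_congr fun q => lintegral_splitWeight_inner q, Measure.volume_eq_prod, lintegral_prod,
    lintegral_congr fun m => lintegral_pivotWeight_rowWeight hε _ m, lintegral_const_mul]
  · refine ENNReal.mul_lt_top (ENNReal.mul_lt_top ENNReal.ofReal_lt_top ih) ?_
    rw [lintegral_indicator measurableSet_Ioi]
    have := integrableOn_rpow_mul_exp_neg_mul_rpow hα one_pos hε
    simp only [Real.rpow_one] at this
    exact this.lintegral_lt_top
  · exact Measurable.indicator (by fun_prop) measurableSet_Ioi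
  · refine Measurable.aemeasurable ?_
    simp_rw [← lintegral_splitWeight_inner]
    exact hm.lintegral_prod_right'

theorem lintegral_coneWeight_lt_top {α ε : ℝ} (hα : -1 < α) (hε : 0 < ε) (N : ℕ) :
    ∫⁻ a, coneWeight α ε N a < ⊤ := by
  induction N with
  | zero => simp [coneWeight, volume_pi]
  | succ N ih => exact lintegral_coneWeight_succ_lt_top hα hε N ih

end Cone

end CauchyModel
end

noncomputable section
namespace CauchyModel
open MeasureTheory
open scoped Matrix Kronecker ComplexOrder

/-! ### Traces of the functional calculus and the growth of the potential -/

section Potential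

variable {N : ℕ}

theorem trace_cfc {M : Mat N} (hM : M.IsHermitian) (f : ℝ → ℝ) :
    (cfc f M).trace = ∑ i, (f (hM.eigenvalues i) : ℂ) := by
  rw [hM.cfc_eq, Matrix.IsHermitian.cfc, Unitary.conjStarAlgAut_apply, Matrix.trace_mul_cycle,
    Unitary.coe_star_mul_self, one_mul, Matrix.trace_diagonal]
  rfl

theorem trace_pow_eq_sum {M : Mat N} (hM : M.IsHermitian) (k : ℕ) :
    (M ^ k).trace = ∑ i, ((hM.eigenvalues i ^ k : ℝ) : ℂ) := by
  have h : cfc (fun x : ℝ => x ^ k) M = M ^ k := cfc_pow_id M k hM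
  rw [← trace_cfc hM fun x => x ^ k, h]

theorem trace_re_eq_sum {M : Mat N} (hM : M.IsHermitian) :
    M.trace.re = ∑ i, hM.eigenvalues i := by
  have := trace_pow_eq_sum hM 1
  rw [pow_one] at this
  rw [this, ← Complex.ofReal_sum, Complex.ofReal_re]
  simp

theorem det_re_eq_prod {M : Mat N} (hM : M.IsHermitian) :
    M.det.re = ∏ i, hM.eigenvalues i := by
  rw [hM.det_eq_prod_eigenvalues]
  exact_mod_cast Complex.ofReal_re (∏ i, hM.eigenvalues i)

/-- The logarithms of the eigenvalues add up to the logarithm of the determinant. In this form the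
density is explicit in determinants and traces of powers, where continuity and derivatives are
accessible. -/
theorem trace_cfc_eval (V : Potential) {M : Mat N} (hM : M.PosDef) :
    (cfc V.eval M).trace.re = -V.tLog * Real.log M.det.re
      + ∑ k ∈ Finset.Icc 1 V.d, V.t k * (M ^ k).trace.re := by
  have hH := hM.isHermitian
  rw [trace_cfc hH, ← Complex.ofReal_sum, Complex.ofReal_re, det_re_eq_prod hH,
    Real.log_prod fun i _ => (hM.eigenvalues_pos i).ne']
  simp only [Potential.eval, Finset.sum_add_distrib, Finset.mul_sum]
  congr 1
  rw [Finset.sum_comm]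
  refine Finset.sum_congr rfl fun k _ => ?_
  rw [trace_pow_eq_sum hH, ← Complex.ofReal_sum, Complex.ofReal_re, Finset.mul_sum]

/-- After subtraction of the linear term the leading coefficient is still positive, so the
difference is nonnegative far out and bounded below on the remaining compact interval. -/
theorem exists_linear_le_polynomial (V : Potential) :
    ∃ C : ℝ, ∀ x, 0 ≤ x → V.t V.d / 2 * x - C ≤ ∑ k ∈ Finset.Icc 1 V.d, V.t k * x ^ k := by
  let q : Polynomial ℝ := ∑ k ∈ Finset.Icc 1 V.d, Polynomial.C (V.t k) * Polynomial.X ^ k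
    - Polynomial.C (V.t V.d / 2) * Polynomial.X
  have hq : ∀ x, q.eval x = ∑ k ∈ Finset.Icc 1 V.d, V.t k * x ^ k - V.t V.d / 2 * x := fun x => by
    simp [q, Polynomial.eval_finsetSum]
  have hd := V.one_le_d
  have ht := V.t_d_pos
  have hcoeff : 0 < q.coeff V.d := by
    simp only [q, Polynomial.coeff_sub, Polynomial.finsetSum_coeff, Polynomial.coeff_C_mul,
      Polynomial.coeff_X_pow, mul_ite, mul_one, mul_zero, Polynomial.coeff_X]
    rw [Finset.sum_ite_eq (Finset.Icc 1 V.d) V.d, if_pos (by simp [hd])]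
    -- For `d = 1` the subtracted linear term meets the leading one; the slope `t_d / 2` leaves `t_d
    -- / 2 > 0`.
    split_ifs <;> linarith
  have hdeg : q.natDegree ≤ V.d := by
    refine (Polynomial.natDegree_sub_le _ _).trans (max_le ?_ ?_)
    · refine Polynomial.natDegree_sum_le_of_forall_le _ _ fun k hk => ?_
      exact (Polynomial.natDegree_C_mul_X_pow_le _ _).trans (Finset.mem_Icc.1 hk).2
    · exact (Polynomial.natDegree_C_mul_le _ _).trans (Polynomial.natDegree_X_le.trans hd)
  have hnat : q.natDegree = V.d := le_antisymm hdeg (Polynomial.le_natDegree_of_ne_zero hcoeff.ne')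
  have hlim := q.tendsto_atTop_of_leadingCoeff_nonneg
    (Polynomial.natDegree_pos_iff_degree_pos.1 (by omega))
    (by rw [Polynomial.leadingCoeff, hnat]; exact hcoeff.le)
  obtain ⟨r, hr⟩ := (Filter.tendsto_atTop.1 hlim 0).exists_forall_of_atTop
  obtain ⟨B, hB⟩ := (isCompact_Icc (a := (0:ℝ)) (b := r)).bddBelow_image
    (f := fun x => q.eval x) q.continuous.continuousOn
  refine ⟨max 0 (-B), fun x hx => ?_⟩
  have : -(max 0 (-B)) ≤ q.eval x := by
    rcases le_total r x with h | h
    · have := hr x h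
      have := le_max_left 0 (-B)
      linarith
    · have := hB (Set.mem_image_of_mem _ (Set.mem_Icc.2 ⟨hx, h⟩))
      have := le_max_right 0 (-B)
      linarith
  rw [hq] at this
  linarith

/-- The exponent of the determinant in the density. -/
def Potential.logExponent (V : Potential) (N : ℕ) (T : ℝ) : ℝ := N / T * V.tLog

theorem Potential.logExponent_pos (V : Potential) {T : ℝ} (hT : 0 < T) (hN : 0 < N) :
    0 < V.logExponent N T := by
  have := V.tLog_pos
  have : (0 : ℝ) < N := by exact_mod_cast hN
  unfold logExponent
  positivity

theorem exp_neg_trace_cfc_eq (V : Potential) (T : ℝ) {M : Mat N} (hM : M.PosDef) :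
    Real.exp (-(N / T) * (cfc V.eval M).trace.re) = M.det.re ^ V.logExponent N T *
      Real.exp (-(N / T) * ∑ k ∈ Finset.Icc 1 V.d, V.t k * (M ^ k).trace.re) := by
  rw [trace_cfc_eval V hM, mul_add, Real.exp_add, Real.rpow_def_of_pos (det_re_pos hM)]
  congr 2
  unfold Potential.logExponent
  ring

/-- The rate of exponential decay of the density. -/
def Potential.decayRate (V : Potential) (N : ℕ) (T : ℝ) : ℝ := N / T * (V.t V.d / 2)

theorem Potential.decayRate_pos (V : Potential) {T : ℝ} (hT : 0 < T) (hN : 0 < N) :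
    0 < V.decayRate N T := by
  have := V.t_d_pos
  have : (0 : ℝ) < N := by exact_mod_cast hN
  unfold decayRate
  positivity

theorem exists_exp_neg_trace_cfc_le (V : Potential) (N : ℕ) {T : ℝ} (hT : 0 < T) :
    ∃ K, 0 < K ∧ ∀ M : Mat N, M.PosDef → Real.exp (-(N / T) * (cfc V.eval M).trace.re)
      ≤ K * (M.det.re ^ V.logExponent N T * Real.exp (-V.decayRate N T * M.trace.re)) := by
  obtain ⟨C, hC⟩ := exists_linear_le_polynomial V
  refine ⟨Real.exp (N / T * (N * C)), Real.exp_pos _, fun M hM => ?_⟩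
  have hH := hM.isHermitian
  rw [exp_neg_trace_cfc_eq V T hM, mul_left_comm, ← Real.exp_add]
  refine mul_le_mul_of_nonneg_left ?_ (Real.rpow_nonneg (det_re_pos hM).le _)
  refine Real.exp_le_exp.2 ?_
  have h1 : ∑ k ∈ Finset.Icc 1 V.d, V.t k * (M ^ k).trace.re
      = ∑ i, ∑ k ∈ Finset.Icc 1 V.d, V.t k * hH.eigenvalues i ^ k := by
    rw [Finset.sum_comm]
    refine Finset.sum_congr rfl fun k _ => ?_
    rw [trace_pow_eq_sum hH, ← Complex.ofReal_sum, Complex.ofReal_re, Finset.mul_sum]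
  have h2 : V.t V.d / 2 * M.trace.re - N * C ≤ ∑ k ∈ Finset.Icc 1 V.d, V.t k * (M ^ k).trace.re := by
    rw [h1, trace_re_eq_sum hH, Finset.mul_sum]
    calc ∑ i, V.t V.d / 2 * hH.eigenvalues i - N * C
        = ∑ i, (V.t V.d / 2 * hH.eigenvalues i - C) := by simp
      _ ≤ _ := Finset.sum_le_sum fun i _ => hC _ (hM.eigenvalues_pos i).le
  have h3 : (0:ℝ) ≤ N / T := by positivity
  have h4 := mul_le_mul_of_nonneg_left h2 h3
  unfold Potential.decayRate
  linarith

end Potential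

/-! ### Bounds for the entries of functions of a matrix -/

section Entries

variable {N : ℕ}

/-- Entries of a unitary matrix have modulus at most `1`; this reduces entrywise bounds to bounds on
eigenvalues. -/
theorem norm_entry_conj_diagonal_le {ι : Type*} [Fintype ι] [DecidableEq ι] {U : Matrix ι ι ℂ}
    (hU : U * Uᴴ = 1) (c : ι → ℂ) (i j : ι) :
    ‖(U * Matrix.diagonal c * Uᴴ) i j‖ ≤ ∑ k, ‖c k‖ := by
  have hmem : U ∈ Matrix.unitaryGroup ι ℂ := Matrix.mem_unitaryGroup_iff.2 hU
  rw [Matrix.mul_apply]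
  refine norm_sum_le_of_le _ fun k _ => ?_
  rw [Matrix.mul_diagonal, Matrix.conjTranspose_apply, norm_mul, norm_mul, norm_star]
  have h1 := entry_norm_bound_of_unitary hmem i k
  have h2 := entry_norm_bound_of_unitary hmem j k
  calc ‖U i k‖ * ‖c k‖ * ‖U j k‖ ≤ 1 * ‖c k‖ * 1 := by gcongr
    _ = ‖c k‖ := by ring

theorem inv_conj_diagonal {ι : Type*} [Fintype ι] [DecidableEq ι] {U : Matrix ι ι ℂ}
    (hU : U * Uᴴ = 1) {c : ι → ℂ} (hc : ∀ i, c i ≠ 0) :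
    (U * Matrix.diagonal c * Uᴴ)⁻¹ = U * Matrix.diagonal (fun i => (c i)⁻¹) * Uᴴ := by
  have hU' : Uᴴ * U = 1 := mul_eq_one_comm.1 hU
  refine Matrix.inv_eq_right_inv ?_
  calc U * Matrix.diagonal c * Uᴴ * (U * Matrix.diagonal (fun i => (c i)⁻¹) * Uᴴ)
      = U * Matrix.diagonal c * (Uᴴ * U) * Matrix.diagonal (fun i => (c i)⁻¹) * Uᴴ := by
        noncomm_ring
    _ = U * (Matrix.diagonal c * Matrix.diagonal (fun i => (c i)⁻¹)) * Uᴴ := by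
        rw [hU', mul_one, mul_assoc U]
    _ = 1 := by
        rw [Matrix.diagonal_mul_diagonal]
        simp [hc, hU]

theorem diagonalization_trace {M U : Mat N} {l : Fin N → ℝ} (hU : U * Uᴴ = 1)
    (h : M = U * Matrix.diagonal (fun i => (l i : ℂ)) * Uᴴ) : M.trace.re = ∑ i, l i := by
  have hU' : Uᴴ * U = 1 := mul_eq_one_comm.1 hU
  rw [h, Matrix.trace_mul_cycle, hU', one_mul, Matrix.trace_diagonal, ← Complex.ofReal_sum,
    Complex.ofReal_re]

theorem diagonalization_det {M U : Mat N} {l : Fin N → ℝ} (hU : U * Uᴴ = 1)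
    (h : M = U * Matrix.diagonal (fun i => (l i : ℂ)) * Uᴴ) : M.det.re = ∏ i, l i := by
  have := det_add_smul_one_of_diagonalization hU h 0
  simp only [zero_smul, add_zero] at this
  rw [this]
  exact_mod_cast Complex.ofReal_re (∏ i, l i)

theorem trace_re_nonneg {M : Mat N} (hM : M.PosDef) : 0 ≤ M.trace.re :=
  (Complex.nonneg_iff.1 hM.posSemidef.trace_nonneg).1

theorem norm_entry_le_trace {M : Mat N} (hM : M.PosDef) (i j : Fin N) : ‖M i j‖ ≤ M.trace.re := by
  obtain ⟨U, l, -, hU, hU', e⟩ := exists_antitone_diagonalization hM.isHermitian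
  have hl := diagonalization_pos hM hU' e
  rw [diagonalization_trace hU e]
  conv_lhs => rw [e]
  refine (norm_entry_conj_diagonal_le hU _ i j).trans (le_of_eq ?_)
  exact Finset.sum_congr rfl fun k _ => by simp [abs_of_pos (hl k)]

theorem prod_le_one_add_sum_pow {ι : Type*} (s : Finset ι) {l : ι → ℝ}
    (hl : ∀ i ∈ s, 0 ≤ l i) {τ : ℝ} (hτ : 0 ≤ τ) (h : ∀ i ∈ s, l i ≤ τ) {n : ℕ} (hn : s.card ≤ n) :
    ∏ i ∈ s, l i ≤ (1 + τ) ^ n := by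
  calc ∏ i ∈ s, l i ≤ ∏ _i ∈ s, (1 + τ) :=
        Finset.prod_le_prod hl fun i hi => by linarith [h i hi]
    _ = (1 + τ) ^ s.card := by simp
    _ ≤ _ := pow_le_pow_right₀ (by linarith) hn

theorem det_re_le {M : Mat N} (hM : M.PosDef) : M.det.re ≤ (1 + M.trace.re) ^ N := by
  have hp := hM.eigenvalues_pos
  rw [det_re_eq_prod hM.isHermitian, trace_re_eq_sum hM.isHermitian]
  exact prod_le_one_add_sum_pow _ (fun i _ => (hp i).le) (Finset.sum_nonneg fun i _ => (hp i).le)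
    (fun i hi => Finset.single_le_sum (fun i _ => (hp i).le) hi) (by simp)

/-- An inverse eigenvalue is the product of the other eigenvalues over the determinant, so inversion
costs only one power of `1 / det`. -/
theorem inv_eigenvalue_le {l : Fin N → ℝ} (hl : ∀ i, 0 < l i) (k : Fin N) :
    (l k)⁻¹ ≤ (1 + ∑ i, l i) ^ N * (∏ i, l i)⁻¹ := by
  have h1 : ∏ i ∈ Finset.univ.erase k, l i ≤ (1 + ∑ i, l i) ^ N :=
    prod_le_one_add_sum_pow _ (fun i _ => (hl i).le) (Finset.sum_nonneg fun i _ => (hl i).le)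
      (fun i _ => Finset.single_le_sum (fun i _ => (hl i).le) (Finset.mem_univ i))
      ((Finset.card_le_univ _).trans (by simp))
  have h2 := Finset.mul_prod_erase Finset.univ l (Finset.mem_univ k)
  have h3 : 0 < ∏ i, l i := Finset.prod_pos fun i _ => hl i
  rw [← div_eq_mul_inv, le_div_iff₀ h3, ← h2, inv_mul_cancel_left₀ (hl k).ne']
  exact h1

theorem norm_inv_entry_le {M : Mat N} (hM : M.PosDef) (i j : Fin N) :
    ‖M⁻¹ i j‖ ≤ N * ((1 + M.trace.re) ^ N * (M.det.re)⁻¹) := by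
  obtain ⟨U, l, -, hU, hU', e⟩ := exists_antitone_diagonalization hM.isHermitian
  have hl := diagonalization_pos hM hU' e
  rw [diagonalization_trace hU e, diagonalization_det hU e]
  conv_lhs => rw [e, inv_conj_diagonal hU fun i => by exact_mod_cast (hl i).ne']
  refine (norm_entry_conj_diagonal_le hU _ i j).trans ?_
  calc ∑ k, ‖((l k : ℂ))⁻¹‖ ≤ ∑ _k : Fin N, ((1 + ∑ i, l i) ^ N * (∏ i, l i)⁻¹) :=
        Finset.sum_le_sum fun k _ => by
          rw [norm_inv, Complex.norm_real, Real.norm_of_nonneg (hl k).le]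
          exact inv_eigenvalue_le hl k
    _ = _ := by simp

/-- The eigenvalues `l i + m j` exceed `l i`, so a simple pole in `det M₁` alone suffices. -/
theorem norm_tensorSum_inv_entry_le {M₁ M₂ : Mat N} (h₁ : M₁.PosDef) (h₂ : M₂.PosDef)
    (p q : Fin N × Fin N) :
    ‖(tensorSum M₁ M₂)⁻¹ p q‖ ≤ (N * N) * ((1 + M₁.trace.re) ^ N * (M₁.det.re)⁻¹) := by
  obtain ⟨U, l, -, hU, hU', e⟩ := exists_antitone_diagonalization h₁.isHermitian
  obtain ⟨V, m, -, hV, hV', e'⟩ := exists_antitone_diagonalization h₂.isHermitian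
  have hl := diagonalization_pos h₁ hU' e
  have hm := diagonalization_pos h₂ hV' e'
  have hlm : ∀ p : Fin N × Fin N, 0 < l p.1 + m p.2 := fun p => add_pos (hl _) (hm _)
  have hW : (U ⊗ₖ V) * (U ⊗ₖ V)ᴴ = 1 := by
    rw [Matrix.conjTranspose_kronecker, kronecker_unitary hU hV]
  rw [tensorSum_diagonalization hU hV e e', ← Matrix.conjTranspose_kronecker,
    inv_conj_diagonal hW fun p => by exact_mod_cast (hlm p).ne', diagonalization_trace hU e,
    diagonalization_det hU e]
  refine (norm_entry_conj_diagonal_le hW _ p q).trans ?_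
  calc ∑ k : Fin N × Fin N, ‖((l k.1 : ℂ) + m k.2)⁻¹‖
      ≤ ∑ _k : Fin N × Fin N, ((1 + ∑ i, l i) ^ N * (∏ i, l i)⁻¹) :=
        Finset.sum_le_sum fun k _ => by
          rw [norm_inv, ← Complex.ofReal_add, Complex.norm_real, Real.norm_of_nonneg (hlm k).le]
          refine le_trans ?_ (inv_eigenvalue_le hl k.1)
          exact inv_anti₀ (hl _) (by linarith [hm k.2])
    _ = _ := by simp

theorem norm_resolvent_entry_le {M : Mat N} (hM : M.IsHermitian) {x : ℂ} (hx : x.im ≠ 0)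
    (i j : Fin N) : ‖(x • (1 : Mat N) - M)⁻¹ i j‖ ≤ N * |x.im|⁻¹ := by
  obtain ⟨U, l, -, hU, hU', e⟩ := exists_antitone_diagonalization hM
  have hne : ∀ i, x - l i ≠ 0 := fun i h => hx (by simpa using congrArg Complex.im h)
  have hxM : x • (1 : Mat N) - M = U * Matrix.diagonal (fun i => x - l i) * Uᴴ := by
    have hd : Matrix.diagonal (fun i => x - (l i : ℂ))
        = x • (1 : Mat N) - Matrix.diagonal (fun i => (l i : ℂ)) := by
      ext i j
      by_cases hij : i = j
      · subst hij; simp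
      · simp [hij]
    rw [hd, mul_sub, sub_mul, ← e]
    simp [hU]
  rw [hxM, inv_conj_diagonal hU hne]
  refine (norm_entry_conj_diagonal_le hU _ i j).trans ?_
  calc ∑ k, ‖(x - (l k : ℂ))⁻¹‖ ≤ ∑ _k : Fin N, |x.im|⁻¹ :=
        Finset.sum_le_sum fun k _ => by
          rw [norm_inv]
          refine inv_anti₀ (abs_pos.2 hx) ?_
          simpa using Complex.abs_im_le_norm (x - (l k : ℂ))
    _ = _ := by simp

theorem isUnit_det_resolvent {M : Mat N} (hM : M.IsHermitian) {x : ℂ} (hx : x.im ≠ 0) :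
    IsUnit (x • (1 : Mat N) - M).det := by
  obtain ⟨U, l, -, hU, hU', e⟩ := exists_antitone_diagonalization hM
  have h := det_add_smul_one_of_diagonalization hU e (-x)
  have h2 : x • (1 : Mat N) - M = -(M + (-x) • (1 : Mat N)) := by
    rw [neg_smul]; abel
  rw [h2, Matrix.det_neg, h]
  refine (IsUnit.pow _ (by simp)).mul (Finset.prod_ne_zero_iff.2 fun i _ h => hx ?_).isUnit
  simpa using congrArg Complex.im h

end Entries

end CauchyModel
end

noncomputable section
namespace CauchyModel
open MeasureTheory
open scoped Matrix Kronecker ComplexOrder Topology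

/-! ### The domain of integration -/

section Domain

variable {N : ℕ}

theorem continuous_hermitianOf : Continuous (hermitianOf (N := N)) := by
  refine continuous_matrix fun i j => ?_
  simp only [hermitianOf, Matrix.of_apply]
  split_ifs <;> fun_prop

theorem hermitianOf_isHermitian (a : Fin N → Fin N → ℝ) : (hermitianOf a).IsHermitian :=
  (bijOn_hermitianOf N).mapsTo (Set.mem_univ a)

theorem posDef_iff_forall_sphere {M : Mat N} (hM : M.IsHermitian) :
    M.PosDef ↔ ∀ v ∈ Metric.sphere (0 : Fin N → ℂ) 1, 0 < (star v ⬝ᵥ (M *ᵥ v)).re := by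
  refine ⟨fun h v hv => ?_, fun h => Matrix.PosDef.of_dotProduct_mulVec_pos hM fun v hv => ?_⟩
  · exact (Complex.pos_iff.1 (h.dotProduct_mulVec_pos (x := v)
      (Metric.ne_of_mem_sphere hv one_ne_zero))).1
  · have hn : 0 < ‖v‖ := norm_pos_iff.2 hv
    have h1 := h (((‖v‖⁻¹ : ℝ) : ℂ) • v) (by simp [norm_smul, hn.ne'])
    have h2 : star (((‖v‖⁻¹ : ℝ) : ℂ) • v) ⬝ᵥ (M *ᵥ (((‖v‖⁻¹ : ℝ) : ℂ) • v))
        = ((‖v‖⁻¹ * ‖v‖⁻¹ : ℝ) : ℂ) * (star v ⬝ᵥ (M *ᵥ v)) := by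
      rw [Matrix.mulVec_smul, dotProduct_smul, star_smul, smul_dotProduct]
      simp [mul_assoc]
    rw [h2, Complex.re_ofReal_mul] at h1
    have h3 : 0 < (star v ⬝ᵥ (M *ᵥ v)).re := pos_of_mul_pos_right h1 (by positivity)
    refine Complex.pos_iff.2 ⟨h3, ?_⟩
    exact (hM.im_star_dotProduct_mulVec_self v).symm

/-- Positivity of the quadratic form on the compact unit sphere persists under small perturbations.
-/
theorem isOpen_posDef_coord : IsOpen {a : Fin N → Fin N → ℝ | (hermitianOf a).PosDef} := by
  rw [isOpen_iff_mem_nhds]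
  intro a ha
  have ha' := (posDef_iff_forall_sphere (hermitianOf_isHermitian a)).1 ha
  have hc : Continuous fun z : (Fin N → Fin N → ℝ) × (Fin N → ℂ) =>
      (star z.2 ⬝ᵥ (hermitianOf z.1 *ᵥ z.2)).re := by
    have := continuous_hermitianOf (N := N)
    fun_prop
  have := (isCompact_sphere (0 : Fin N → ℂ) 1).eventually_forall_of_forall_eventually (x₀ := a)
    (P := fun a v => 0 < (star v ⬝ᵥ (hermitianOf a *ᵥ v)).re)
    fun v hv => hc.continuousAt.eventually (lt_mem_nhds (ha' v hv))
  filter_upwards [this] with b hb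
  exact (posDef_iff_forall_sphere (hermitianOf_isHermitian b)).2 hb

theorem isOpen_posDefPairs : IsOpen (posDefPairs N) :=
  (isOpen_posDef_coord.preimage continuous_fst).inter (isOpen_posDef_coord.preimage continuous_snd)

theorem measurableSet_posDefPairs : MeasurableSet (posDefPairs N) :=
  isOpen_posDefPairs.measurableSet

/-- Pairs of positive definite matrices. -/
def pdPairs (N : ℕ) : Set (Mat N × Mat N) := {M | M.1.PosDef ∧ M.2.PosDef}

theorem continuousOn_coord {Y : Type*} [TopologicalSpace Y] {F : Mat N → Mat N → Y}
    (hF : ContinuousOn (fun M : Mat N × Mat N => F M.1 M.2) (pdPairs N)) :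
    ContinuousOn (fun p : (Fin N → Fin N → ℝ) × (Fin N → Fin N → ℝ) =>
      F (hermitianOf p.1) (hermitianOf p.2)) (posDefPairs N) :=
  hF.comp (f := fun p : (Fin N → Fin N → ℝ) × (Fin N → Fin N → ℝ) =>
    (hermitianOf p.1, hermitianOf p.2))
    ((continuous_hermitianOf.comp continuous_fst).prodMk
      (continuous_hermitianOf.comp continuous_snd)).continuousOn fun _ hp => hp

theorem continuousOn_matrix_inv {X ι : Type*} [TopologicalSpace X] [Fintype ι] [DecidableEq ι]
    {f : X → Matrix ι ι ℂ} {s : Set X} (hf : ContinuousOn f s) (h : ∀ x ∈ s, (f x).det ≠ 0) :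
    ContinuousOn (fun x => (f x)⁻¹) s := by
  have hdet : ContinuousOn (fun x => (f x).det) s :=
    (Continuous.matrix_det continuous_id).comp_continuousOn hf
  have hadj : ContinuousOn (fun x => (f x).adjugate) s :=
    (Continuous.matrix_adjugate continuous_id).comp_continuousOn hf
  simp only [Matrix.inv_def, Ring.inverse_eq_inv']
  exact (hdet.inv₀ h).smul hadj

theorem continuous_tensorSum : Continuous fun M : Mat N × Mat N => tensorSum M.1 M.2 := by
  refine continuous_matrix fun p q => ?_
  simp only [tensorSum, Matrix.add_apply, Matrix.kroneckerMap_apply]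
  fun_prop

theorem weight_eq (V₁ V₂ : Potential) (T : ℝ) (M₁ M₂ : Mat N) :
    weight V₁ V₂ T M₁ M₂ = Real.exp (-(N / T) * (cfc V₁.eval M₁).trace.re) *
      Real.exp (-(N / T) * (cfc V₂.eval M₂).trace.re) / (tensorSum M₁ M₂).det.re := by
  rw [weight, Matrix.trace_add, Complex.add_re, mul_add, Real.exp_add]

theorem continuousOn_weight (V₁ V₂ : Potential) (T : ℝ) :
    ContinuousOn (fun M : Mat N × Mat N => weight V₁ V₂ T M.1 M.2) (pdPairs N) := by
  have h : ∀ M ∈ pdPairs N, weight V₁ V₂ T M.1 M.2 =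
      (M.1.det.re ^ V₁.logExponent N T *
        Real.exp (-(N / T) * ∑ k ∈ Finset.Icc 1 V₁.d, V₁.t k * (M.1 ^ k).trace.re)) *
      (M.2.det.re ^ V₂.logExponent N T *
        Real.exp (-(N / T) * ∑ k ∈ Finset.Icc 1 V₂.d, V₂.t k * (M.2 ^ k).trace.re)) /
      (tensorSum M.1 M.2).det.re := fun M hM => by
    rw [weight_eq, exp_neg_trace_cfc_eq V₁ T hM.1, exp_neg_trace_cfc_eq V₂ T hM.2]
  refine ContinuousOn.congr ?_ h
  have d1 : Continuous fun M : Mat N × Mat N => M.1.det.re := by fun_prop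
  have d2 : Continuous fun M : Mat N × Mat N => M.2.det.re := by fun_prop
  have d3 : Continuous fun M : Mat N × Mat N => (tensorSum M.1 M.2).det.re :=
    Complex.continuous_re.comp continuous_tensorSum.matrix_det
  have e1 : Continuous fun M : Mat N × Mat N => Real.exp (-(N / T) * ∑ k ∈ Finset.Icc 1 V₁.d,
    V₁.t k * (M.1 ^ k).trace.re) := by fun_prop
  have e2 : Continuous fun M : Mat N × Mat N => Real.exp (-(N / T) * ∑ k ∈ Finset.Icc 1 V₂.d,
    V₂.t k * (M.2 ^ k).trace.re) := by fun_prop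
  refine ContinuousOn.div (ContinuousOn.mul (ContinuousOn.mul ?_ e1.continuousOn)
    (ContinuousOn.mul ?_ e2.continuousOn)) d3.continuousOn fun M hM =>
      (det_re_pos (tensorSum_posDef hM.1 hM.2)).ne'
  · exact d1.continuousOn.rpow_const fun M hM => Or.inl (det_re_pos hM.1).ne'
  · exact d2.continuousOn.rpow_const fun M hM => Or.inl (det_re_pos hM.2).ne'

theorem weight_pos (V₁ V₂ : Potential) (T : ℝ) {M₁ M₂ : Mat N} (h₁ : M₁.PosDef) (h₂ : M₂.PosDef) :
    0 < weight V₁ V₂ T M₁ M₂ :=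
  div_pos (Real.exp_pos _) (det_re_pos (tensorSum_posDef h₁ h₂))

end Domain

/-! ### Random variables of moderate growth -/

section Growth

variable {N : ℕ}

/-- A measure of the size of a pair of positive definite matrices. -/
def pairSize (M₁ M₂ : Mat N) : ℝ := 1 + M₁.trace.re + M₂.trace.re

theorem one_le_pairSize {M₁ M₂ : Mat N} (h₁ : M₁.PosDef) (h₂ : M₂.PosDef) : 1 ≤ pairSize M₁ M₂ := by
  have := trace_re_nonneg h₁
  have := trace_re_nonneg h₂
  unfold pairSize
  linarith

/-- `F` is continuous and bounded by a power of the size times `g`. -/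
def HasGrowth (g : Mat N → Mat N → ℝ) (F : Mat N → Mat N → ℂ) : Prop :=
  ContinuousOn (fun M : Mat N × Mat N => F M.1 M.2) (pdPairs N) ∧
    ∃ (C : ℝ) (n : ℕ), ∀ M₁ M₂ : Mat N, M₁.PosDef → M₂.PosDef →
      ‖F M₁ M₂‖ ≤ C * pairSize M₁ M₂ ^ n * g M₁ M₂

/-- Random variables of polynomial growth. -/
abbrev Tame (F : Mat N → Mat N → ℂ) : Prop := HasGrowth (fun _ _ => 1) F

/-- Random variables with at most a simple pole in `det M₁` and in `det M₂`. -/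
abbrev Singular (F : Mat N → Mat N → ℂ) : Prop :=
  HasGrowth (fun M₁ M₂ => M₁.det.re⁻¹ + M₂.det.re⁻¹) F

variable {g : Mat N → Mat N → ℝ} {F G : Mat N → Mat N → ℂ}

/-- Only one factor may be singular: two would produce a double pole, which the available
integrability does not cover. -/
theorem Tame.mul (hF : Tame F) (hG : HasGrowth g G) :
    HasGrowth g fun M₁ M₂ => F M₁ M₂ * G M₁ M₂ := by
  obtain ⟨cF, C, n, hC⟩ := hF
  obtain ⟨cG, C', n', hC'⟩ := hG
  refine ⟨cF.mul cG, C * C', n + n', fun M₁ M₂ h₁ h₂ => ?_⟩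
  have a := hC M₁ M₂ h₁ h₂
  have b := hC' M₁ M₂ h₁ h₂
  rw [mul_one] at a
  rw [norm_mul, pow_add]
  calc ‖F M₁ M₂‖ * ‖G M₁ M₂‖
      ≤ (C * pairSize M₁ M₂ ^ n) * (C' * pairSize M₁ M₂ ^ n' * g M₁ M₂) :=
        mul_le_mul a b (norm_nonneg _) ((norm_nonneg _).trans a)
    _ = _ := by ring

theorem HasGrowth.add (hF : HasGrowth g F) (hG : HasGrowth g G) :
    HasGrowth g fun M₁ M₂ => F M₁ M₂ + G M₁ M₂ := by
  obtain ⟨cF, C, n, hC⟩ := hF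
  obtain ⟨cG, C', n', hC'⟩ := hG
  refine ⟨cF.add cG, C + C', n + n', fun M₁ M₂ h₁ h₂ => ?_⟩
  have a := hC M₁ M₂ h₁ h₂
  have b := hC' M₁ M₂ h₁ h₂
  have s := one_le_pairSize h₁ h₂
  have a' := le_mul_of_one_le_right ((norm_nonneg _).trans a) (one_le_pow₀ (n := n') s)
  have b' := le_mul_of_one_le_right ((norm_nonneg _).trans b) (one_le_pow₀ (n := n) s)
  refine (norm_add_le _ _).trans ((add_le_add (a.trans a') (b.trans b')).trans (le_of_eq ?_))
  ring

theorem tame_const (c : ℂ) : Tame (N := N) fun _ _ => c :=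
  ⟨continuousOn_const, ‖c‖, 0, fun _ _ _ _ => by simp⟩

theorem HasGrowth.const_mul (hF : HasGrowth g F) (c : ℂ) :
    HasGrowth g fun M₁ M₂ => c * F M₁ M₂ := (tame_const c).mul hF

theorem HasGrowth.neg (hF : HasGrowth g F) : HasGrowth g fun M₁ M₂ => -F M₁ M₂ := by
  simpa using hF.const_mul (-1)

theorem HasGrowth.sub (hF : HasGrowth g F) (hG : HasGrowth g G) :
    HasGrowth g fun M₁ M₂ => F M₁ M₂ - G M₁ M₂ := by
  simpa [sub_eq_add_neg] using hF.add hG.neg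

theorem singular_zero : Singular (N := N) fun _ _ => 0 :=
  ⟨continuousOn_const, 0, 0, fun _ _ _ _ => by simp⟩

/-- Since `det M₁ ≤ (1 + tr M₁) ^ N`, the constant `1` is at most a power of the size times `1 / det
M₁`. -/
theorem Tame.singular (hF : Tame F) : Singular F := by
  obtain ⟨cF, C, n, hC⟩ := hF
  refine ⟨cF, C, n + N, fun M₁ M₂ h₁ h₂ => ?_⟩
  have a := hC M₁ M₂ h₁ h₂
  rw [mul_one] at a
  have d₁ := det_re_pos h₁
  have d₂ := det_re_pos h₂
  have hd : 1 ≤ pairSize M₁ M₂ ^ N * (M₁.det.re⁻¹ + M₂.det.re⁻¹) := by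
    have h3 : M₁.det.re ≤ pairSize M₁ M₂ ^ N := by
      refine (det_re_le h₁).trans (pow_le_pow_left₀ ?_ ?_ _)
      · linarith [trace_re_nonneg h₁]
      · unfold pairSize; linarith [trace_re_nonneg h₂]
    calc (1:ℝ) = M₁.det.re * M₁.det.re⁻¹ := (mul_inv_cancel₀ d₁.ne').symm
      _ ≤ pairSize M₁ M₂ ^ N * (M₁.det.re⁻¹ + M₂.det.re⁻¹) := by
        refine mul_le_mul h3 (le_add_of_nonneg_right (inv_pos.2 d₂).le) (inv_pos.2 d₁).le
          (d₁.le.trans h3)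
  calc ‖F M₁ M₂‖ ≤ (C * pairSize M₁ M₂ ^ n) * 1 := by rw [mul_one]; exact a
    _ ≤ (C * pairSize M₁ M₂ ^ n) * (pairSize M₁ M₂ ^ N * (M₁.det.re⁻¹ + M₂.det.re⁻¹)) :=
      mul_le_mul_of_nonneg_left hd ((norm_nonneg _).trans a)
    _ = _ := by rw [pow_add]; ring

theorem tame_sum {ι : Type*} (s : Finset ι) {F : ι → Mat N → Mat N → ℂ} (h : ∀ i ∈ s, Tame (F i)) :
    Tame fun M₁ M₂ => ∑ i ∈ s, F i M₁ M₂ := by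
  classical
  induction s using Finset.induction_on with
  | empty => simpa using tame_const 0
  | insert i s hi ih =>
    simp only [Finset.sum_insert hi]
    exact (h i (Finset.mem_insert_self _ _)).add (ih fun j hj => h j (Finset.mem_insert_of_mem hj))

theorem singular_sum {ι : Type*} (s : Finset ι) {F : ι → Mat N → Mat N → ℂ}
    (h : ∀ i ∈ s, Singular (F i)) : Singular fun M₁ M₂ => ∑ i ∈ s, F i M₁ M₂ := by
  classical
  induction s using Finset.induction_on with
  | empty => simpa using singular_zero
  | insert i s hi ih =>
    simp only [Finset.sum_insert hi]
    exact (h i (Finset.mem_insert_self _ _)).add (ih fun j hj => h j (Finset.mem_insert_of_mem hj))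

/-- Random matrices with entries of polynomial growth. -/
def TameMat (A : Mat N → Mat N → Mat N) : Prop := ∀ i j, Tame fun M₁ M₂ => A M₁ M₂ i j

/-- Random matrices whose entries have at most simple poles in the determinants. -/
def SingularMat (A : Mat N → Mat N → Mat N) : Prop := ∀ i j, Singular fun M₁ M₂ => A M₁ M₂ i j

variable {A B : Mat N → Mat N → Mat N}

theorem TameMat.mul (hA : TameMat A) (hB : TameMat B) : TameMat fun M₁ M₂ => A M₁ M₂ * B M₁ M₂ :=
  fun i j => by
    simp only [Matrix.mul_apply]
    exact tame_sum _ fun k _ => (hA i k).mul (hB k j)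

theorem SingularMat.mul_tameMat (hA : SingularMat A) (hB : TameMat B) :
    SingularMat fun M₁ M₂ => A M₁ M₂ * B M₁ M₂ :=
  fun i j => by
    simp only [Matrix.mul_apply, mul_comm (A _ _ _ _)]
    exact singular_sum _ fun k _ => (hB k j).mul (hA i k)

theorem tameMat_one : TameMat (N := N) fun _ _ => 1 := fun _ _ => tame_const _

theorem TameMat.neg (hA : TameMat A) : TameMat fun M₁ M₂ => -A M₁ M₂ := fun i j => (hA i j).neg

theorem TameMat.pow (hA : TameMat A) (k : ℕ) : TameMat fun M₁ M₂ => A M₁ M₂ ^ k := by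
  induction k with
  | zero => simpa using tameMat_one
  | succ k ih => simpa only [pow_succ] using ih.mul hA

theorem TameMat.trace (hA : TameMat A) : Tame fun M₁ M₂ => (A M₁ M₂).trace :=
  tame_sum _ fun i _ => hA i i

theorem SingularMat.trace (hA : SingularMat A) : Singular fun M₁ M₂ => (A M₁ M₂).trace :=
  singular_sum _ fun i _ => hA i i

theorem tameMat_fst : TameMat (N := N) fun M₁ _ => M₁ := fun i j =>
  ⟨by fun_prop, 1, 1, fun M₁ M₂ h₁ h₂ => by
    have := norm_entry_le_trace h₁ i j
    have := trace_re_nonneg h₂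
    simp only [pairSize]
    linarith⟩

theorem tameMat_snd : TameMat (N := N) fun _ M₂ => M₂ := fun i j =>
  ⟨by fun_prop, 1, 1, fun M₁ M₂ h₁ h₂ => by
    have := norm_entry_le_trace h₂ i j
    have := trace_re_nonneg h₁
    simp only [pairSize]
    linarith⟩

theorem trace_pow_mul_inv_le {M₁ M₂ : Mat N} (h₁ : M₁.PosDef) (h₂ : M₂.PosDef) :
    (1 + M₁.trace.re) ^ N * M₁.det.re⁻¹ ≤ pairSize M₁ M₂ ^ N * (M₁.det.re⁻¹ + M₂.det.re⁻¹) ∧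
    (1 + M₂.trace.re) ^ N * M₂.det.re⁻¹ ≤ pairSize M₁ M₂ ^ N * (M₁.det.re⁻¹ + M₂.det.re⁻¹) := by
  have d₁ := det_re_pos h₁
  have d₂ := det_re_pos h₂
  have t₁ := trace_re_nonneg h₁
  have t₂ := trace_re_nonneg h₂
  unfold pairSize
  constructor
  · refine mul_le_mul (pow_le_pow_left₀ (by linarith) (by linarith) _) ?_ (inv_pos.2 d₁).le
      (pow_nonneg (by linarith) _)
    exact le_add_of_nonneg_right (inv_pos.2 d₂).le
  · refine mul_le_mul (pow_le_pow_left₀ (by linarith) (by linarith) _) ?_ (inv_pos.2 d₂).le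
      (pow_nonneg (by linarith) _)
    exact le_add_of_nonneg_left (inv_pos.2 d₁).le

theorem singularMat_inv_fst : SingularMat (N := N) fun M₁ _ => M₁⁻¹ := fun i j =>
  ⟨(continuous_apply_apply i j).comp_continuousOn
      (continuousOn_matrix_inv continuousOn_fst fun M hM => hM.1.det_pos.ne'), N, N,
    fun M₁ M₂ h₁ h₂ => (norm_inv_entry_le h₁ i j).trans (by
      rw [mul_assoc]
      exact mul_le_mul_of_nonneg_left (trace_pow_mul_inv_le h₁ h₂).1 (Nat.cast_nonneg _))⟩

theorem singularMat_inv_snd : SingularMat (N := N) fun _ M₂ => M₂⁻¹ := fun i j =>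
  ⟨(continuous_apply_apply i j).comp_continuousOn
      (continuousOn_matrix_inv continuousOn_snd fun M hM => hM.2.det_pos.ne'), N, N,
    fun M₁ M₂ h₁ h₂ => (norm_inv_entry_le h₂ i j).trans (by
      rw [mul_assoc]
      exact mul_le_mul_of_nonneg_left (trace_pow_mul_inv_le h₁ h₂).2 (Nat.cast_nonneg _))⟩

theorem singular_tensorSum_inv (p q : Fin N × Fin N) :
    Singular fun M₁ M₂ : Mat N => (tensorSum M₁ M₂)⁻¹ p q :=
  ⟨(continuous_apply_apply p q).comp_continuousOn
      (continuousOn_matrix_inv continuous_tensorSum.continuousOn fun M hM =>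
        (tensorSum_posDef hM.1 hM.2).det_pos.ne'), N * N, N,
    fun M₁ M₂ h₁ h₂ => (norm_tensorSum_inv_entry_le h₁ h₂ p q).trans (by
      rw [mul_assoc (N * N : ℝ)]
      exact mul_le_mul_of_nonneg_left (trace_pow_mul_inv_le h₁ h₂).1
        (mul_nonneg (Nat.cast_nonneg _) (Nat.cast_nonneg _)))⟩

theorem tameMat_resolvent_fst {x : ℂ} (hx : x.im ≠ 0) :
    TameMat (N := N) fun M₁ _ => (x • (1 : Mat N) - M₁)⁻¹ := fun i j =>
  ⟨(continuous_apply_apply i j).comp_continuousOn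
      (continuousOn_matrix_inv (by fun_prop) fun M hM =>
        (isUnit_det_resolvent hM.1.isHermitian hx).ne_zero), N * |x.im|⁻¹, 0,
    fun M₁ M₂ h₁ _ => by simpa using norm_resolvent_entry_le h₁.isHermitian hx i j⟩

theorem tameMat_resolvent_snd {x : ℂ} (hx : x.im ≠ 0) :
    TameMat (N := N) fun _ M₂ => (x • (1 : Mat N) - -M₂)⁻¹ := fun i j =>
  ⟨(continuous_apply_apply i j).comp_continuousOn
      (continuousOn_matrix_inv (by fun_prop) fun M hM =>
        (isUnit_det_resolvent hM.2.isHermitian.neg hx).ne_zero), N * |x.im|⁻¹, 0,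
    fun M₁ M₂ _ h₂ => by simpa using norm_resolvent_entry_le h₂.isHermitian.neg hx i j⟩

theorem singularMat_deriv_fst (V : Potential) : SingularMat (N := N) fun M₁ _ => V.deriv M₁ :=
  fun i j => by
    simp only [Potential.deriv, Matrix.add_apply, Matrix.neg_apply, Matrix.smul_apply,
      Matrix.sum_apply, smul_eq_mul]
    exact ((singularMat_inv_fst i j).const_mul _).neg.add
      (tame_sum _ fun k _ => (tameMat_fst.pow _ i j).const_mul _).singular

theorem singularMat_deriv_snd (V : Potential) : SingularMat (N := N) fun _ M₂ => V.deriv M₂ :=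
  fun i j => by
    simp only [Potential.deriv, Matrix.add_apply, Matrix.neg_apply, Matrix.smul_apply,
      Matrix.sum_apply, smul_eq_mul]
    exact ((singularMat_inv_snd i j).const_mul _).neg.add
      (tame_sum _ fun k _ => (tameMat_snd.pow _ i j).const_mul _).singular

end Growth

/-! ### Averages of random variables of moderate growth -/

section Averages

variable {N : ℕ}

theorem one_add_pow_le_exp (n : ℕ) {c t : ℝ} (hc : 0 < c) (ht : 0 ≤ t) :
    (1 + t) ^ n ≤ n.factorial / c ^ n * Real.exp c * Real.exp (c * t) := by
  have h := Real.pow_div_factorial_le_exp (c * (1 + t)) (by positivity) n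
  rw [mul_add, mul_one, Real.exp_add, ← mul_one_add, mul_pow, div_le_iff₀ (by positivity)] at h
  have hcn : 0 < c ^ n := pow_pos hc n
  have : (1 + t) ^ n = (c ^ n * (1 + t) ^ n) / c ^ n := by field_simp
  rw [this, div_le_iff₀ hcn]
  refine h.trans (le_of_eq ?_)
  field_simp

/-- Half of the exponential decay pays for any polynomial growth. -/
theorem exists_pow_mul_exp_le (n : ℕ) {ε₁ ε₂ : ℝ} (h₁ : 0 < ε₁) (h₂ : 0 < ε₂) :
    ∃ K, 0 < K ∧ ∀ s t : ℝ, 0 ≤ s → 0 ≤ t → (1 + s + t) ^ n * (Real.exp (-ε₁ * s) *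
      Real.exp (-ε₂ * t)) ≤ K * (Real.exp (-(ε₁ / 2) * s) * Real.exp (-(ε₂ / 2) * t)) := by
  set c := min (ε₁ / 2) (ε₂ / 2) with hc
  have hc0 : 0 < c := lt_min (half_pos h₁) (half_pos h₂)
  refine ⟨n.factorial / c ^ n * Real.exp c, by positivity, fun s t hs ht => ?_⟩
  have h := one_add_pow_le_exp n hc0 (add_nonneg hs ht)
  rw [← add_assoc] at h
  have e1 : c * s ≤ ε₁ / 2 * s := mul_le_mul_of_nonneg_right (min_le_left _ _) hs
  have e2 : c * t ≤ ε₂ / 2 * t := mul_le_mul_of_nonneg_right (min_le_right _ _) ht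
  calc (1 + s + t) ^ n * (Real.exp (-ε₁ * s) * Real.exp (-ε₂ * t))
      ≤ (n.factorial / c ^ n * Real.exp c * Real.exp (c * (s + t))) *
        (Real.exp (-ε₁ * s) * Real.exp (-ε₂ * t)) := by gcongr
    _ = n.factorial / c ^ n * Real.exp c *
        Real.exp (c * (s + t) + (-ε₁ * s + -ε₂ * t)) := by
        rw [Real.exp_add, Real.exp_add (-ε₁ * s)]; ring
    _ ≤ n.factorial / c ^ n * Real.exp c * Real.exp (-(ε₁ / 2) * s + -(ε₂ / 2) * t) := by
        refine mul_le_mul_of_nonneg_left (Real.exp_le_exp.2 ?_) (by positivity)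
        linarith
    _ = _ := by rw [Real.exp_add]

/-- The density `det M ^ α / ∏_{k < N} D_k(M) * exp (-ε tr M)`. -/
def coneDensity (α ε : ℝ) (M : Mat N) : ℝ :=
  M.det.re ^ α * (minorProd M)⁻¹ * Real.exp (-ε * M.trace.re)

/-- The bound decouples the two matrices: the lower bound of the Cauchy determinant by `det M₂` is
used for the pole in `det M₁`, and conversely. -/
theorem inv_det_sum_div_le {M₁ M₂ : Mat N} (h₁ : M₁.PosDef) (h₂ : M₂.PosDef) :
    (M₁.det.re⁻¹ + M₂.det.re⁻¹) / (tensorSum M₁ M₂).det.re ≤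
      2 * 2 ^ (N * N) * ((minorProd M₁)⁻¹ * (minorProd M₂)⁻¹ * (M₁.det.re⁻¹ * M₂.det.re⁻¹)) := by
  have d₁ := det_re_pos h₁
  have d₂ := det_re_pos h₂
  have q₁ := minorProd_pos h₁
  have q₂ := minorProd_pos h₂
  have d := det_re_pos (tensorSum_posDef h₁ h₂)
  have b := minorProd_mul_det_le_det_tensorSum h₁ h₂
  have b' := minorProd_mul_det_le_det_tensorSum' h₁ h₂
  rw [div_le_iff₀ d]
  have e : (M₁.det.re⁻¹ + M₂.det.re⁻¹) = (minorProd M₁ * minorProd M₂ * M₂.det.re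
      + minorProd M₁ * minorProd M₂ * M₁.det.re) *
      ((minorProd M₁)⁻¹ * (minorProd M₂)⁻¹ * (M₁.det.re⁻¹ * M₂.det.re⁻¹)) := by
    field_simp
  rw [e]
  calc (minorProd M₁ * minorProd M₂ * M₂.det.re + minorProd M₁ * minorProd M₂ * M₁.det.re) *
      ((minorProd M₁)⁻¹ * (minorProd M₂)⁻¹ * (M₁.det.re⁻¹ * M₂.det.re⁻¹))
      ≤ (2 ^ (N * N) * (tensorSum M₁ M₂).det.re + 2 ^ (N * N) * (tensorSum M₁ M₂).det.re) *
      ((minorProd M₁)⁻¹ * (minorProd M₂)⁻¹ * (M₁.det.re⁻¹ * M₂.det.re⁻¹)) := by gcongr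
    _ = _ := by ring

/-- A simple pole together with the Cauchy factor lowers the exponent of each determinant by exactly
one, apart from the minors, which the cone integral absorbs. -/
theorem exists_weight_mul_le (V₁ V₂ : Potential) (hN : 0 < N) {T : ℝ} (hT : 0 < T) (n : ℕ) :
    ∃ K, 0 < K ∧ ∀ M₁ M₂ : Mat N, M₁.PosDef → M₂.PosDef →
      pairSize M₁ M₂ ^ n * (M₁.det.re⁻¹ + M₂.det.re⁻¹) * weight V₁ V₂ T M₁ M₂ ≤
        K * (coneDensity (V₁.logExponent N T - 1) (V₁.decayRate N T / 2) M₁ *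
          coneDensity (V₂.logExponent N T - 1) (V₂.decayRate N T / 2) M₂) := by
  obtain ⟨K₁, hK₁, b₁⟩ := exists_exp_neg_trace_cfc_le V₁ N hT
  obtain ⟨K₂, hK₂, b₂⟩ := exists_exp_neg_trace_cfc_le V₂ N hT
  obtain ⟨K, hK, b⟩ := exists_pow_mul_exp_le n (V₁.decayRate_pos hT hN) (V₂.decayRate_pos hT hN)
  refine ⟨K₁ * K₂ * K * (2 * 2 ^ (N * N)), by positivity, fun M₁ M₂ h₁ h₂ => ?_⟩
  have d₁ := det_re_pos h₁
  have d₂ := det_re_pos h₂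
  have q₁ := minorProd_pos h₁
  have q₂ := minorProd_pos h₂
  have d := det_re_pos (tensorSum_posDef h₁ h₂)
  have c₁ := b₁ M₁ h₁
  have c₂ := b₂ M₂ h₂
  have c₃ := inv_det_sum_div_le h₁ h₂
  have c₄ := b _ _ (trace_re_nonneg h₁) (trace_re_nonneg h₂)
  have s : 0 ≤ pairSize M₁ M₂ := zero_le_one.trans (one_le_pairSize h₁ h₂)
  rw [weight_eq, coneDensity, coneDensity, Real.rpow_sub_one d₁.ne', Real.rpow_sub_one d₂.ne']
  calc pairSize M₁ M₂ ^ n * (M₁.det.re⁻¹ + M₂.det.re⁻¹) *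
        (Real.exp (-(N / T) * (cfc V₁.eval M₁).trace.re) *
          Real.exp (-(N / T) * (cfc V₂.eval M₂).trace.re) / (tensorSum M₁ M₂).det.re)
      = pairSize M₁ M₂ ^ n * ((M₁.det.re⁻¹ + M₂.det.re⁻¹) / (tensorSum M₁ M₂).det.re) *
        (Real.exp (-(N / T) * (cfc V₁.eval M₁).trace.re) *
          Real.exp (-(N / T) * (cfc V₂.eval M₂).trace.re)) := by ring
    _ ≤ pairSize M₁ M₂ ^ n * (2 * 2 ^ (N * N) *
          ((minorProd M₁)⁻¹ * (minorProd M₂)⁻¹ * (M₁.det.re⁻¹ * M₂.det.re⁻¹))) *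
        (K₁ * (M₁.det.re ^ V₁.logExponent N T * Real.exp (-V₁.decayRate N T * M₁.trace.re)) *
          (K₂ * (M₂.det.re ^ V₂.logExponent N T * Real.exp (-V₂.decayRate N T * M₂.trace.re)))) := by
        gcongr
    _ = (pairSize M₁ M₂ ^ n * (Real.exp (-V₁.decayRate N T * M₁.trace.re) *
          Real.exp (-V₂.decayRate N T * M₂.trace.re))) * (K₁ * K₂ * (2 * 2 ^ (N * N)) *
          ((minorProd M₁)⁻¹ * (minorProd M₂)⁻¹ * (M₁.det.re⁻¹ * M₂.det.re⁻¹)) *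
          (M₁.det.re ^ V₁.logExponent N T * M₂.det.re ^ V₂.logExponent N T)) := by ring
    _ ≤ (K * (Real.exp (-(V₁.decayRate N T / 2) * M₁.trace.re) *
          Real.exp (-(V₂.decayRate N T / 2) * M₂.trace.re))) * (K₁ * K₂ * (2 * 2 ^ (N * N)) *
          ((minorProd M₁)⁻¹ * (minorProd M₂)⁻¹ * (M₁.det.re⁻¹ * M₂.det.re⁻¹)) *
          (M₁.det.re ^ V₁.logExponent N T * M₂.det.re ^ V₂.logExponent N T)) :=
        mul_le_mul_of_nonneg_right c₄ (by positivity)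
    _ = _ := by ring

theorem lintegral_coneDensity_lt_top {α₁ α₂ ε₁ ε₂ : ℝ} (hα₁ : -1 < α₁) (hα₂ : -1 < α₂)
    (hε₁ : 0 < ε₁) (hε₂ : 0 < ε₂) (K : ℝ) :
    ∫⁻ p in posDefPairs N, ENNReal.ofReal (K * (coneDensity α₁ ε₁ (hermitianOf p.1) *
      coneDensity α₂ ε₂ (hermitianOf p.2))) < ⊤ := by
  have h : ∀ p ∈ posDefPairs N, ENNReal.ofReal (K * (coneDensity α₁ ε₁ (hermitianOf p.1) *
      coneDensity α₂ ε₂ (hermitianOf p.2)))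
        = ENNReal.ofReal K * (coneWeight α₁ ε₁ N p.1 * coneWeight α₂ ε₂ N p.2) := fun p hp => by
    have q₁ := minorProd_pos hp.1
    have q₂ := minorProd_pos hp.2
    have d₁ := det_re_pos hp.1
    have d₂ := det_re_pos hp.2
    rw [coneWeight_eq _ _ _ hp.1, coneWeight_eq _ _ _ hp.2, ← ENNReal.ofReal_mul (by positivity),
      ← ENNReal.ofReal_mul' (by positivity)]
    rfl
  rw [setLIntegral_congr_fun measurableSet_posDefPairs h]
  refine (setLIntegral_le_lintegral _ _).trans_lt ?_
  rw [Measure.volume_eq_prod, lintegral_const_mul, lintegral_prod_mul]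
  · exact ENNReal.mul_lt_top ENNReal.ofReal_lt_top (ENNReal.mul_lt_top
      (lintegral_coneWeight_lt_top hα₁ hε₁ N) (lintegral_coneWeight_lt_top hα₂ hε₂ N))
  · exact (measurable_coneWeight _ _ _).aemeasurable
  · exact (measurable_coneWeight _ _ _).aemeasurable
  · exact ((measurable_coneWeight _ _ _).comp measurable_fst).mul
      ((measurable_coneWeight _ _ _).comp measurable_snd)

/-- The dominating exponents `N t₋₁ / T - 1` are greater than `-1` because `t₋₁ > 0`; this is where
the logarithmic terms of the potentials are needed. -/
theorem Singular.hasAverage {F : Mat N → Mat N → ℂ} (hF : Singular F) (V₁ V₂ : Potential)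
    (hN : 0 < N) {T : ℝ} (hT : 0 < T) : HasAverage V₁ V₂ T F := by
  obtain ⟨cF, C, n, hC⟩ := hF
  obtain ⟨K, hK, hb⟩ := exists_weight_mul_le V₁ V₂ hN hT n
  have hc : ContinuousOn (fun p : (Fin N → Fin N → ℝ) × (Fin N → Fin N → ℝ) =>
      F (hermitianOf p.1) (hermitianOf p.2) *
        (weight V₁ V₂ T (hermitianOf p.1) (hermitianOf p.2) : ℂ)) (posDefPairs N) :=
    continuousOn_coord (F := fun M₁ M₂ => F M₁ M₂ * (weight V₁ V₂ T M₁ M₂ : ℂ))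
      (cF.mul (Complex.continuous_ofReal.comp_continuousOn (continuousOn_weight V₁ V₂ T)))
  refine ⟨hc.aestronglyMeasurable measurableSet_posDefPairs, ?_⟩
  have ha₁ := V₁.logExponent_pos hT hN
  have ha₂ := V₂.logExponent_pos hT hN
  refine lt_of_le_of_lt ?_ (lintegral_coneDensity_lt_top (N := N)
    (α₁ := V₁.logExponent N T - 1) (α₂ := V₂.logExponent N T - 1) (by linarith) (by linarith)
    (half_pos (V₁.decayRate_pos hT hN)) (half_pos (V₂.decayRate_pos hT hN)) (|C| * K))
  refine setLIntegral_mono' measurableSet_posDefPairs fun p hp => ?_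
  rw [← ofReal_norm]
  refine ENNReal.ofReal_le_ofReal ?_
  have w := weight_pos V₁ V₂ T hp.1 hp.2
  have s := zero_le_one.trans (one_le_pairSize hp.1 hp.2)
  have d₁ := det_re_pos hp.1
  have d₂ := det_re_pos hp.2
  rw [norm_mul, Complex.norm_real, Real.norm_of_nonneg w.le]
  have h1 := hC _ _ hp.1 hp.2
  calc _ ≤ (|C| * pairSize (hermitianOf p.1) (hermitianOf p.2) ^ n *
        ((hermitianOf p.1).det.re⁻¹ + (hermitianOf p.2).det.re⁻¹)) *
          weight V₁ V₂ T (hermitianOf p.1) (hermitianOf p.2) := by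
        refine mul_le_mul_of_nonneg_right (h1.trans ?_) w.le
        gcongr
        exact le_abs_self C
    _ = |C| * (pairSize (hermitianOf p.1) (hermitianOf p.2) ^ n *
        ((hermitianOf p.1).det.re⁻¹ + (hermitianOf p.2).det.re⁻¹) *
          weight V₁ V₂ T (hermitianOf p.1) (hermitianOf p.2)) := by ring
    _ ≤ |C| * (K * _) := mul_le_mul_of_nonneg_left (hb _ _ hp.1 hp.2) (abs_nonneg C)
    _ = _ := by ring

theorem isAddHaarMeasure_volume_coord (N : ℕ) :
    Measure.IsAddHaarMeasure (volume : Measure (Fin N → Fin N → ℝ)) :=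
  MeasureTheory.Measure.pi.isAddHaarMeasure (fun _ : Fin N => (volume : Measure (Fin N → ℝ)))

theorem isAddHaarMeasure_volume_coord_prod (N : ℕ) :
    Measure.IsAddHaarMeasure (volume : Measure ((Fin N → Fin N → ℝ) × (Fin N → Fin N → ℝ))) :=
  have := isAddHaarMeasure_volume_coord N
  Measure.prod.instIsAddHaarMeasure _ _

theorem integrableOn_weight (V₁ V₂ : Potential) (hN : 0 < N) {T : ℝ} (hT : 0 < T) :
    IntegrableOn (fun p : (Fin N → Fin N → ℝ) × (Fin N → Fin N → ℝ) =>
      weight V₁ V₂ T (hermitianOf p.1) (hermitianOf p.2)) (posDefPairs N) := by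
  have h := MeasureTheory.Integrable.re ((tame_const (N := N) 1).singular.hasAverage V₁ V₂ hN hT)
  simp only [one_mul] at h
  exact h

theorem partitionFunction_pos (V₁ V₂ : Potential) (hN : 0 < N) {T : ℝ} (hT : 0 < T) :
    0 < partitionFunction V₁ V₂ N T := by
  have hpos : ∀ p ∈ posDefPairs N, 0 < weight V₁ V₂ T (hermitianOf p.1) (hermitianOf p.2) :=
    fun p hp => weight_pos V₁ V₂ T hp.1 hp.2
  rw [partitionFunction, setIntegral_pos_iff_support_of_nonneg_ae
    ((ae_restrict_iff' measurableSet_posDefPairs).2 (Filter.Eventually.of_forall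
      fun p hp => (hpos p hp).le)) (integrableOn_weight V₁ V₂ hN hT)]
  have hsub : posDefPairs N ⊆ (Function.support fun p : (Fin N → Fin N → ℝ) × (Fin N → Fin N → ℝ) =>
      weight V₁ V₂ T (hermitianOf p.1) (hermitianOf p.2)) ∩ posDefPairs N :=
    fun p hp => ⟨(hpos p hp).ne', hp⟩
  have := isAddHaarMeasure_volume_coord_prod N
  refine lt_of_lt_of_le (isOpen_posDefPairs.measure_pos volume ?_) (measure_mono hsub)
  obtain ⟨a, -, ha⟩ := (bijOn_hermitianOf N).surjOn (Matrix.isHermitian_one (α := ℂ) (n := Fin N))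
  exact ⟨(a, a), by rw [ha]; exact Matrix.PosDef.one, by rw [ha]; exact Matrix.PosDef.one⟩

end Averages

end CauchyModel
end

noncomputable section
namespace CauchyModel
open MeasureTheory Filter
open scoped Matrix Kronecker ComplexOrder Topology

/-! ### Integration by parts on an open set -/

section IntegrationByParts

/-- Squaring removes the kink of the positive part, which makes the cutoff differentiable at `s =
1`. -/
theorem hasDerivAt_max_zero_sq (u : ℝ) :
    HasDerivAt (fun u : ℝ => max 0 u ^ 2) (2 * max 0 u) u := by
  rcases lt_trichotomy u 0 with h | h | h
  · have h1 : (fun u : ℝ => max 0 u ^ 2) =ᶠ[𝓝 u] fun _ => 0 := by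
      filter_upwards [gt_mem_nhds h] with v hv
      simp [max_eq_left hv.le]
    rw [max_eq_left h.le, mul_zero]
    exact (hasDerivAt_const u (0:ℝ)).congr_of_eventuallyEq h1
  · subst h
    rw [max_self, mul_zero, hasDerivAt_iff_isLittleO_nhds_zero]
    simp only [zero_add, max_self, smul_zero, sub_zero]
    have h1 : (fun h : ℝ => max 0 h ^ 2 - 0 ^ 2) =O[𝓝 0] fun h : ℝ => h ^ 2 := by
      refine Asymptotics.IsBigO.of_bound 1 (Eventually.of_forall fun h => ?_)
      rcases le_total 0 h with hh | hh
      · simp [max_eq_right hh]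
      · simp [max_eq_left hh, sq_nonneg]
    exact h1.trans_isLittleO (Asymptotics.isLittleO_pow_id one_lt_two)
  · have h1 : (fun u : ℝ => max 0 u ^ 2) =ᶠ[𝓝 u] fun v => v ^ 2 := by
      filter_upwards [lt_mem_nhds h] with v hv
      simp [max_eq_right hv.le]
    rw [max_eq_right h.le]
    simpa using (hasDerivAt_pow 2 u).congr_of_eventuallyEq h1

/-- A continuously differentiable function that vanishes for `s ≤ 1` and tends to `1` at infinity. -/
def cutoff (s : ℝ) : ℝ := max 0 (1 - s⁻¹) ^ 2

/-- The logarithmic derivative `s * cutoff' s`. -/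
def cutoffDeriv (s : ℝ) : ℝ := 2 * max 0 (1 - s⁻¹) * s⁻¹

theorem hasDerivAt_cutoff {s : ℝ} (hs : 0 < s) :
    HasDerivAt cutoff (cutoffDeriv s * s⁻¹) s := by
  have h := (hasDerivAt_max_zero_sq (1 - s⁻¹)).comp s ((hasDerivAt_inv hs.ne').const_sub 1)
  refine h.congr_deriv ?_
  unfold cutoffDeriv
  ring

theorem cutoff_eq_zero {s : ℝ} (hs : 0 < s) (h : s < 1) : cutoff s = 0 := by
  have : 1 < s⁻¹ := (one_lt_inv₀ hs).2 h
  rw [cutoff, max_eq_left (by linarith)]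
  simp

theorem abs_cutoff_le {s : ℝ} (hs : 0 < s) : |cutoff s| ≤ 1 := by
  have h1 : 0 < s⁻¹ := inv_pos.2 hs
  have h2 : 0 ≤ max 0 (1 - s⁻¹) := le_max_left _ _
  have h3 : max 0 (1 - s⁻¹) ≤ 1 := max_le zero_le_one (by linarith)
  rw [cutoff, abs_of_nonneg (by positivity)]
  exact pow_le_one₀ h2 h3

/-- The logarithmic derivative is scale invariant, so this bound dominates the cutoff terms
uniformly in `ε`. -/
theorem abs_cutoffDeriv_le {s : ℝ} (hs : 0 < s) : |cutoffDeriv s| ≤ 2 := by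
  have h1 : 0 < s⁻¹ := inv_pos.2 hs
  have h2 : 0 ≤ max 0 (1 - s⁻¹) := le_max_left _ _
  have h3 : max 0 (1 - s⁻¹) ≤ 1 := max_le zero_le_one (by linarith)
  rw [cutoffDeriv, abs_of_nonneg (by positivity)]
  rcases le_total 1 s with h | h
  · have := inv_le_one_of_one_le₀ h
    nlinarith [mul_le_one₀ h3 h1.le this]
  · have : 1 ≤ s⁻¹ := (one_le_inv₀ hs).2 h
    rw [max_eq_left (by linarith)]
    simp

theorem measurable_cutoff : Measurable cutoff := by unfold cutoff; fun_prop

theorem measurable_cutoffDeriv : Measurable cutoffDeriv := by unfold cutoffDeriv; fun_prop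

theorem tendsto_cutoff : Tendsto cutoff atTop (𝓝 1) := by
  have h : Tendsto (fun s : ℝ => max 0 (1 - s⁻¹) ^ 2) atTop (𝓝 (max 0 (1 - 0) ^ 2)) :=
    (tendsto_const_nhds.max (tendsto_const_nhds.sub tendsto_inv_atTop_zero)).pow 2
  rw [sub_zero, max_eq_right zero_le_one, one_pow] at h
  exact h

theorem tendsto_cutoffDeriv : Tendsto cutoffDeriv atTop (𝓝 0) := by
  have h : Tendsto (fun s : ℝ => 2 * max 0 (1 - s⁻¹) * s⁻¹) atTop
      (𝓝 (2 * max 0 (1 - 0) * 0)) :=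
    (tendsto_const_nhds.mul (tendsto_const_nhds.max (tendsto_const_nhds.sub
      tendsto_inv_atTop_zero))).mul tendsto_inv_atTop_zero
  rw [mul_zero] at h
  exact h

variable {E : Type*} [NormedAddCommGroup E] [NormedSpace ℝ E] [FiniteDimensional ℝ E]
  [MeasurableSpace E] [BorelSpace E] {μ : Measure E} [μ.IsAddHaarMeasure]

/-- Integration by parts on the whole space against the constant function `1`. -/
theorem integral_hasLineDerivAt_eq_zero {f f' : E → ℂ} {v : E} (hf : Integrable f μ)
    (hf' : Integrable f' μ) (h : ∀ p, HasLineDerivAt ℝ f (f' p) p v) : ∫ p, f' p ∂μ = 0 := by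
  have := integral_bilinear_hasLineDerivAt_right_eq_neg_left_of_integrable (μ := μ)
    (f := fun _ => (1 : ℂ)) (f' := fun _ => 0) (g := f) (g' := f') (v := v)
    (B := ContinuousLinearMap.mul ℝ ℂ) (by simp) (by simpa using hf') (by simpa using hf)
    (fun p _ => hasDerivAt_const (0 : ℝ) (1 : ℂ)) (fun p _ => h p)
  simpa using this

/-- The integral of a directional derivative over an open set vanishes, if `D` is a positive function
whose superlevel sets are closed and whose logarithmic derivative `δ` is tame enough. -/
theorem setIntegral_hasLineDerivAt_eq_zero {Ω : Set E} (hΩ : IsOpen Ω) {G G' : E → ℂ} {D δ : E → ℝ}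
    {v : E} (hD : ∀ p ∈ Ω, 0 < D p) (hDm : ContinuousOn D Ω)
    (hcl : ∀ ε > 0, IsClosed {p | p ∈ Ω ∧ ε ≤ D p})
    (hGd : ∀ p ∈ Ω, HasLineDerivAt ℝ G (G' p) p v)
    (hDd : ∀ p ∈ Ω, HasLineDerivAt ℝ D (D p * δ p) p v)
    (hG : IntegrableOn G Ω μ) (hG' : IntegrableOn G' Ω μ)
    (hGδ : IntegrableOn (fun p => G p * δ p) Ω μ) : ∫ p in Ω, G' p ∂μ = 0 := by
  have hms := hΩ.measurableSet
  have hDae : AEMeasurable D (μ.restrict Ω) := hDm.aemeasurable hms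
  have hχ : ∀ ε : ℝ, AEStronglyMeasurable (fun p => (cutoff (D p / ε) : ℂ)) (μ.restrict Ω) :=
    fun ε => (Complex.measurable_ofReal.comp_aemeasurable
      (measurable_cutoff.comp_aemeasurable (hDae.div_const ε))).aestronglyMeasurable
  have hχ' : ∀ ε : ℝ, AEStronglyMeasurable (fun p => (cutoffDeriv (D p / ε) : ℂ)) (μ.restrict Ω) :=
    fun ε => (Complex.measurable_ofReal.comp_aemeasurable
      (measurable_cutoffDeriv.comp_aemeasurable (hDae.div_const ε))).aestronglyMeasurable
  have hb : ∀ ε > 0, ∀ p ∈ Ω, ‖(cutoff (D p / ε) : ℂ)‖ ≤ 1 := fun ε hε p hp => by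
    rw [Complex.norm_real]; exact abs_cutoff_le (div_pos (hD p hp) hε)
  have hb' : ∀ ε > 0, ∀ p ∈ Ω, ‖(cutoffDeriv (D p / ε) : ℂ)‖ ≤ 2 := fun ε hε p hp => by
    rw [Complex.norm_real]; exact abs_cutoffDeriv_le (div_pos (hD p hp) hε)
  have hae : ∀ {P : E → Prop}, (∀ p ∈ Ω, P p) → ∀ᵐ p ∂μ.restrict Ω, P p := fun h =>
    (ae_restrict_iff' hms).2 (Eventually.of_forall h)
  have i1 : ∀ ε > 0, IntegrableOn (fun p => (cutoff (D p / ε) : ℂ) * G p) Ω μ := fun ε hε =>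
    Integrable.bdd_mul hG (hχ ε) (hae (hb ε hε))
  have i2 : ∀ ε > 0, IntegrableOn (fun p => (cutoff (D p / ε) : ℂ) * G' p +
      (cutoffDeriv (D p / ε) : ℂ) * (G p * δ p)) Ω μ := fun ε hε =>
    (Integrable.bdd_mul hG' (hχ ε) (hae (hb ε hε))).add
      (Integrable.bdd_mul hGδ (hχ' ε) (hae (hb' ε hε)))
  -- The cut-off function, extended by zero, is differentiable along `v` at every point of the
  -- space, so the whole-space statement applies to it.
  have hzero : ∀ ε > 0, ∫ p in Ω, ((cutoff (D p / ε) : ℂ) * G' p +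
      (cutoffDeriv (D p / ε) : ℂ) * (G p * δ p)) ∂μ = 0 := by
    intro ε hε
    rw [← integral_indicator hms]
    refine integral_hasLineDerivAt_eq_zero (v := v)
      (f := Ω.indicator fun p => (cutoff (D p / ε) : ℂ) * G p)
      ((integrable_indicator_iff hms).2 (i1 ε hε)) ((integrable_indicator_iff hms).2 (i2 ε hε)) ?_
    intro p
    have hline : ContinuousAt (fun t : ℝ => p + t • v) 0 := by fun_prop
    by_cases hp : p ∈ Ω
    · have hnear : ∀ᶠ t : ℝ in 𝓝 0, p + t • v ∈ Ω :=
        hline.eventually (hΩ.mem_nhds (by simpa using hp))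
      have hDp : HasDerivAt (fun t : ℝ => D (p + t • v)) (D p * δ p) 0 := hDd p hp
      have hGp : HasDerivAt (fun t : ℝ => G (p + t • v)) (G' p) 0 := hGd p hp
      -- As `D` has derivative `D δ`, the factor `D / ε` combines with the derivative of the cutoff
      -- and only `δ` is left.
      have h1 : HasDerivAt (fun t : ℝ => cutoff (D (p + t • v) / ε))
          (cutoffDeriv (D p / ε) * δ p) 0 := by
        have h2 : HasDerivAt cutoff (cutoffDeriv (D p / ε) * (D p / ε)⁻¹)
            (D (p + (0 : ℝ) • v) / ε) := by
          rw [zero_smul, add_zero]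
          exact hasDerivAt_cutoff (div_pos (hD p hp) hε)
        refine (h2.comp (0 : ℝ) (hDp.div_const ε)).congr_deriv ?_
        have := (hD p hp).ne'
        field_simp
      have h3 := h1.ofReal_comp.mul hGp
      have h4 : HasDerivAt (fun t : ℝ => Ω.indicator (fun p => (cutoff (D p / ε) : ℂ) * G p)
          (p + t • v)) ((cutoffDeriv (D p / ε) * δ p : ℝ) * G (p + (0 : ℝ) • v) +
            (cutoff (D (p + (0 : ℝ) • v) / ε) : ℂ) * G' p) 0 := by
        refine h3.congr_of_eventuallyEq ?_
        filter_upwards [hnear] with t ht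
        simp [Set.indicator_of_mem ht]
      rw [Set.indicator_of_mem hp]
      refine HasDerivAt.congr_deriv h4 ?_
      rw [zero_smul, add_zero]
      push_cast
      ring
    · rw [Set.indicator_of_notMem hp]
      -- Outside `Ω`, boundary included, closedness of the superlevel set gives a neighbourhood in
      -- which the cut-off function is identically zero.
      have hmem : p ∈ {p | p ∈ Ω ∧ ε ≤ D p}ᶜ := fun h => hp h.1
      have hnear : ∀ᶠ t : ℝ in 𝓝 0, p + t • v ∈ {p | p ∈ Ω ∧ ε ≤ D p}ᶜ :=
        hline.eventually ((hcl ε hε).isOpen_compl.mem_nhds (by simpa using hmem))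
      refine (hasDerivAt_const (0 : ℝ) (0 : ℂ)).congr_of_eventuallyEq ?_
      filter_upwards [hnear] with t ht
      by_cases hq : p + t • v ∈ Ω
      · have hlt : D (p + t • v) < ε := not_le.1 fun h => ht ⟨hq, h⟩
        rw [Set.indicator_of_mem hq, cutoff_eq_zero (div_pos (hD _ hq) hε) ((div_lt_one hε).2 hlt)]
        simp
      · rw [Set.indicator_of_notMem hq]
  -- Along `ε = 1 / (n + 1)` the cutoff tends to `1` and its logarithmic derivative to `0` at each
  -- point of `Ω`; the domination uses integrability of `G'` and `G δ`.
  have hlim : Tendsto (fun n : ℕ => ∫ p in Ω, ((cutoff (D p / (1 / ((n : ℝ) + 1))) : ℂ) * G' p +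
      (cutoffDeriv (D p / (1 / ((n : ℝ) + 1))) : ℂ) * (G p * δ p)) ∂μ) atTop
      (𝓝 (∫ p in Ω, G' p ∂μ)) := by
    refine tendsto_integral_of_dominated_convergence (fun p => ‖G' p‖ + 2 * ‖G p * δ p‖)
      (fun n => (i2 _ (by positivity)).aestronglyMeasurable)
      (hG'.norm.add (hGδ.norm.const_mul 2)) (fun n => hae fun p hp => ?_) (hae fun p hp => ?_)
    · have hn : (0 : ℝ) < 1 / ((n : ℝ) + 1) := by positivity
      refine (norm_add_le _ _).trans (add_le_add ?_ ?_)
      · rw [norm_mul]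
        exact mul_le_of_le_one_left (norm_nonneg _) (hb _ hn p hp)
      · rw [norm_mul]
        exact mul_le_mul_of_nonneg_right (hb' _ hn p hp) (norm_nonneg _)
    · have ht : Tendsto (fun n : ℕ => D p / (1 / ((n : ℝ) + 1))) atTop atTop := by
        simp only [div_div_eq_mul_div, div_one]
        exact Tendsto.const_mul_atTop (hD p hp)
          (tendsto_atTop_add_const_right _ _ tendsto_natCast_atTop_atTop)
      have t1 := (Complex.continuous_ofReal.tendsto _).comp (tendsto_cutoff.comp ht)
      have t2 := (Complex.continuous_ofReal.tendsto _).comp (tendsto_cutoffDeriv.comp ht)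
      simpa using (t1.mul_const (G' p)).add (t2.mul_const (G p * δ p))
  refine tendsto_nhds_unique hlim ?_
  simp only [hzero _ (by positivity : (0 : ℝ) < 1 / ((_ : ℕ) + 1 : ℝ))]
  exact tendsto_const_nhds

end IntegrationByParts

end CauchyModel
end

noncomputable section
namespace CauchyModel
open MeasureTheory Filter
open scoped Matrix Kronecker ComplexOrder Topology

/-! ### Derivatives of matrix functions along lines -/

section MatrixDerivatives

set_option linter.unusedSectionVars false

variable {ι : Type*} [Fintype ι] [DecidableEq ι]

/-- Entrywise derivative at `0` of a curve of matrices. -/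
def HasMatDeriv (A : ℝ → Matrix ι ι ℂ) (A' : Matrix ι ι ℂ) : Prop :=
  ∀ i j, HasDerivAt (fun t => A t i j) (A' i j) 0

variable {A B : ℝ → Matrix ι ι ℂ} {A' B' : Matrix ι ι ℂ}

theorem HasMatDeriv.mul (hA : HasMatDeriv A A') (hB : HasMatDeriv B B') :
    HasMatDeriv (fun t => A t * B t) (A' * B 0 + A 0 * B') := fun i j => by
  simp only [Matrix.mul_apply, Matrix.add_apply, ← Finset.sum_add_distrib]
  exact HasDerivAt.fun_sum fun k _ => (hA i k).mul (hB k j)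

theorem hasMatDeriv_line (M H : Matrix ι ι ℂ) : HasMatDeriv (fun t => M + t • H) H := fun i j => by
  simp only [Matrix.add_apply, Matrix.smul_apply, Complex.real_smul]
  have h := ((hasDerivAt_id (0 : ℝ)).ofReal_comp.mul_const (H i j)).const_add (M i j)
  simpa using h

theorem hasMatDeriv_const (M : Matrix ι ι ℂ) : HasMatDeriv (fun _ => M) 0 := fun i j => by
  simpa using hasDerivAt_const (0 : ℝ) (M i j)

theorem HasMatDeriv.trace (hA : HasMatDeriv A A') :
    HasDerivAt (fun t => (A t).trace) A'.trace 0 :=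
  HasDerivAt.fun_sum fun i _ => hA i i

theorem hasMatDeriv_pow (M H : Matrix ι ι ℂ) (k : ℕ) :
    HasMatDeriv (fun t => (M + t • H) ^ k) (∑ s ∈ Finset.range k, M ^ s * H * M ^ (k - 1 - s)) := by
  induction k with
  | zero => simpa using hasMatDeriv_const 1
  | succ k ih =>
    have h := ih.mul (hasMatDeriv_line M H)
    simp only [zero_smul, add_zero] at h
    simp only [pow_succ (M + _)]
    convert h using 1
    rw [Finset.sum_range_succ, Finset.sum_mul]
    congr 1
    · refine Finset.sum_congr rfl fun s hs => ?_
      have : k + 1 - 1 - s = (k - 1 - s) + 1 := by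
        have := Finset.mem_range.1 hs
        omega
      rw [this, pow_succ, ← mul_assoc]
    · simp

/-- Under the trace the `k` terms of the noncommutative Leibniz rule coincide by cyclicity. -/
theorem hasDerivAt_trace_pow (M H : Matrix ι ι ℂ) (k : ℕ) :
    HasDerivAt (fun t : ℝ => ((M + t • H) ^ k).trace) (k * (M ^ (k - 1) * H).trace) 0 := by
  refine (hasMatDeriv_pow M H k).trace.congr_deriv ?_
  rw [Matrix.trace_sum, Finset.sum_congr rfl fun s hs => ?_, Finset.sum_const, Finset.card_range,
    nsmul_eq_mul]
  rw [Matrix.trace_mul_cycle, ← pow_add]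
  congr 3
  have := Finset.mem_range.1 hs
  omega

theorem continuousAt_line (M H : Matrix ι ι ℂ) : ContinuousAt (fun t : ℝ => M + t • H) 0 := by
  fun_prop

theorem eventually_det_line_ne_zero {M : Matrix ι ι ℂ} (hM : M.det ≠ 0) (H : Matrix ι ι ℂ) :
    ∀ᶠ t : ℝ in 𝓝 0, (M + t • H).det ≠ 0 := by
  have h : ContinuousAt (fun t : ℝ => (M + t • H).det) 0 :=
    (Continuous.matrix_det continuous_id).continuousAt.comp (continuousAt_line M H)
  exact h.eventually_ne (by simpa using hM)

/-- The resolvent identity gives the difference quotient exactly as `-(M + tH)⁻¹ H M⁻¹`; continuity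
of the inverse then gives the limit. -/
theorem hasMatDeriv_inv {M : Matrix ι ι ℂ} (hM : M.det ≠ 0) (H : Matrix ι ι ℂ) :
    HasMatDeriv (fun t => (M + t • H)⁻¹) (-(M⁻¹ * H * M⁻¹)) := fun i j => by
  rw [hasDerivAt_iff_tendsto_slope]
  have hev := eventually_det_line_ne_zero hM H
  have hinv : ContinuousAt (fun t : ℝ => (M + t • H)⁻¹) 0 := by
    have h1 : ContinuousOn (fun t : ℝ => (M + t • H)⁻¹) {t | (M + t • H).det ≠ 0} :=
      continuousOn_matrix_inv (by fun_prop) fun t ht => ht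
    exact h1.continuousAt hev
  have hlim : Tendsto (fun t : ℝ => (-((M + t • H)⁻¹ * H * M⁻¹)) i j) (𝓝 0)
      (𝓝 ((-(M⁻¹ * H * M⁻¹)) i j)) := by
    have h2 : ContinuousAt (fun t : ℝ => (-((M + t • H)⁻¹ * H * M⁻¹))) 0 :=
      ((hinv.mul continuousAt_const).mul continuousAt_const).neg
    have h3 := h2.tendsto
    rw [zero_smul, add_zero] at h3
    exact tendsto_pi_nhds.1 (tendsto_pi_nhds.1 h3 i) j
  refine (hlim.mono_left nhdsWithin_le_nhds).congr' ?_
  filter_upwards [nhdsWithin_le_nhds hev, self_mem_nhdsWithin] with t ht ht0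
  have ht0' : t ≠ 0 := ht0
  have hdiff : (M + t • H)⁻¹ - M⁻¹ = t • -((M + t • H)⁻¹ * H * M⁻¹) := by
    have e1 : (M + t • H)⁻¹ * (M + t • H) = 1 := Matrix.nonsing_inv_mul _ ht.isUnit
    have e2 : M * M⁻¹ = 1 := Matrix.mul_nonsing_inv _ hM.isUnit
    calc (M + t • H)⁻¹ - M⁻¹ = (M + t • H)⁻¹ * (M * M⁻¹)
          - ((M + t • H)⁻¹ * (M + t • H)) * M⁻¹ := by rw [e1, e2, mul_one, one_mul]
      _ = _ := by
          rw [mul_add, add_mul, Matrix.mul_smul, Matrix.smul_mul, smul_neg, mul_assoc _ M]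
          abel
  have h4 := congrFun (congrFun hdiff i) j
  simp only [Matrix.sub_apply, Matrix.smul_apply] at h4
  rw [slope_def_module, sub_zero, zero_smul, add_zero, h4, inv_smul_smul₀ ht0']

/-- Jacobi's formula: factor out `M` and expand `det (1 + z M⁻¹H)` to first order in `z`. -/
theorem hasDerivAt_det_line {M : Matrix ι ι ℂ} (hM : M.det ≠ 0) (H : Matrix ι ι ℂ) :
    HasDerivAt (fun t : ℝ => (M + t • H).det) (M.det * (M⁻¹ * H).trace) 0 := by
  obtain ⟨q, hq⟩ : ∃ q : Polynomial ℂ, ∀ z : ℂ,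
      (1 + z • (M⁻¹ * H)).det = 1 + (M⁻¹ * H).trace * z + q.eval z * z ^ 2 :=
    ⟨_, fun z => Matrix.det_one_add_smul z _⟩
  have h1 : HasDerivAt (fun z : ℂ => 1 + (M⁻¹ * H).trace * z + q.eval z * z ^ 2)
      (M⁻¹ * H).trace ((0 : ℝ) : ℂ) := by
    have h := (((hasDerivAt_id ((0 : ℝ) : ℂ)).const_mul (M⁻¹ * H).trace).const_add 1).add
      ((q.hasDerivAt ((0 : ℝ) : ℂ)).mul (hasDerivAt_pow 2 ((0 : ℝ) : ℂ)))
    exact h.congr_deriv (by simp)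
  have h2 := h1.comp_ofReal
  refine (h2.const_mul M.det).congr_of_eventuallyEq (Eventually.of_forall fun t => ?_)
  simp only [← hq]
  rw [← Matrix.det_mul]
  congr 1
  rw [mul_add, mul_one, Matrix.mul_smul, ← mul_assoc, Matrix.mul_nonsing_inv _ hM.isUnit, one_mul]
  rfl

theorem trace_mul_im_eq_zero {A B : Matrix ι ι ℂ} (hA : A.IsHermitian) (hB : B.IsHermitian) :
    ((A * B).trace.re : ℂ) = (A * B).trace := by
  refine Complex.conj_eq_iff_re.1 ?_
  have h := Matrix.trace_conjTranspose (A * B)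
  rw [Matrix.conjTranspose_mul, hA.eq, hB.eq, Matrix.trace_mul_comm] at h
  exact h.symm

end MatrixDerivatives

end CauchyModel
end

noncomputable section
namespace CauchyModel
open MeasureTheory Filter
open scoped Matrix Kronecker ComplexOrder Topology

/-! ### The logarithmic derivative of the density -/

section WeightDerivative

variable {N : ℕ}

theorem hermitianOf_add (a b : Fin N → Fin N → ℝ) :
    hermitianOf (a + b) = hermitianOf a + hermitianOf b := by
  ext i j
  simp only [hermitianOf, Matrix.of_apply, Matrix.add_apply, Pi.add_apply]
  split_ifs <;> push_cast <;> ring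

theorem hermitianOf_smul (t : ℝ) (b : Fin N → Fin N → ℝ) :
    hermitianOf (t • b) = t • hermitianOf b := by
  ext i j
  simp only [hermitianOf, Matrix.of_apply, Matrix.smul_apply, Pi.smul_apply, smul_eq_mul,
    Complex.real_smul]
  split_ifs <;> push_cast <;> ring

theorem exists_hermitianOf {M : Mat N} (hM : M.IsHermitian) : ∃ a, hermitianOf a = M := by
  obtain ⟨a, -, ha⟩ := (bijOn_hermitianOf N).surjOn hM
  exact ⟨a, ha⟩

theorem eventually_posDef_line {M H : Mat N} (hM : M.PosDef) (hH : H.IsHermitian) :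
    ∀ᶠ t : ℝ in 𝓝 0, (M + t • H).PosDef := by
  obtain ⟨a, rfl⟩ := exists_hermitianOf hM.isHermitian
  obtain ⟨b, rfl⟩ := exists_hermitianOf hH
  have h : ContinuousAt (fun t : ℝ => a + t • b) 0 := by fun_prop
  have := h.eventually (isOpen_posDef_coord.mem_nhds (by simpa using hM))
  filter_upwards [this] with t ht
  rwa [← hermitianOf_smul, ← hermitianOf_add]

theorem tensorSum_add (A B C D : Mat N) :
    tensorSum (A + B) (C + D) = tensorSum A C + tensorSum B D := by
  simp only [tensorSum, Matrix.add_kronecker, Matrix.kronecker_add]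
  abel

theorem tensorSum_smul (c : ℂ) (A B : Mat N) : tensorSum (c • A) (c • B) = c • tensorSum A B := by
  simp only [tensorSum, Matrix.smul_kronecker, Matrix.kronecker_smul, smul_add]

theorem tensorSum_isHermitian {A B : Mat N} (hA : A.IsHermitian) (hB : B.IsHermitian) :
    (tensorSum A B).IsHermitian := by
  unfold tensorSum
  refine Matrix.IsHermitian.add ?_ ?_
  · rw [Matrix.IsHermitian, Matrix.conjTranspose_kronecker, hA.eq, Matrix.conjTranspose_one]
  · rw [Matrix.IsHermitian, Matrix.conjTranspose_kronecker, hB.eq, Matrix.conjTranspose_one]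

/-- The logarithmic derivative of the density, extended to a complex linear form. -/
def logDeriv (V₁ V₂ : Potential) (T : ℝ) (M₁ M₂ : Mat N) : Mat N × Mat N →ₗ[ℂ] ℂ where
  toFun H := -(N / T : ℂ) * ((V₁.deriv M₁ * H.1).trace + (V₂.deriv M₂ * H.2).trace)
    - ((tensorSum M₁ M₂)⁻¹ * tensorSum H.1 H.2).trace
  map_add' H K := by
    simp only [Prod.fst_add, Prod.snd_add, tensorSum_add, mul_add, Matrix.trace_add]
    ring
  map_smul' c H := by
    simp only [Prod.smul_fst, Prod.smul_snd, tensorSum_smul, Matrix.mul_smul, Matrix.trace_smul,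
      smul_eq_mul, RingHom.id_apply]
    ring

theorem logDeriv_apply (V₁ V₂ : Potential) (T : ℝ) (M₁ M₂ : Mat N) (H : Mat N × Mat N) :
    logDeriv V₁ V₂ T M₁ M₂ H =
      -(N / T : ℂ) * ((V₁.deriv M₁ * H.1).trace + (V₂.deriv M₂ * H.2).trace)
        - ((tensorSum M₁ M₂)⁻¹ * tensorSum H.1 H.2).trace := rfl

theorem singular_logDeriv (V₁ V₂ : Potential) (T : ℝ) (H : Mat N × Mat N) :
    Singular fun M₁ M₂ => logDeriv V₁ V₂ T M₁ M₂ H := by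
  have c : ∀ A : Mat N, TameMat fun _ _ => A := fun A i j => tame_const _
  simp only [logDeriv_apply]
  refine ((HasGrowth.add ((singularMat_deriv_fst V₁).mul_tameMat (c H.1)).trace
    ((singularMat_deriv_snd V₂).mul_tameMat (c H.2)).trace).const_mul _).sub ?_
  refine singular_sum _ fun p _ => ?_
  simp only [Matrix.diag_apply, Matrix.mul_apply, mul_comm ((tensorSum _ _)⁻¹ _ _)]
  exact singular_sum _ fun q _ => (singular_tensorSum_inv p q).const_mul _

theorem deriv_isHermitian (V : Potential) {M : Mat N} (hM : M.IsHermitian) :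
    (V.deriv M).IsHermitian := by
  have hs : ∀ r : ℝ, star (r : ℂ) = r := fun r => Complex.conj_ofReal r
  unfold Potential.deriv
  refine Matrix.IsHermitian.add (Matrix.IsHermitian.neg ?_) ?_
  · rw [Matrix.IsHermitian, Matrix.conjTranspose_smul, hM.inv.eq, hs]
  · rw [Matrix.IsHermitian, Matrix.conjTranspose_sum]
    refine Finset.sum_congr rfl fun k _ => ?_
    rw [Matrix.conjTranspose_smul, (hM.pow _).eq, star_mul, hs, star_natCast, mul_comm]

theorem hasDerivAt_det_re {ι : Type*} [Fintype ι] [DecidableEq ι] {M H : Matrix ι ι ℂ}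
    (hM : M.PosDef) :
    HasDerivAt (fun t : ℝ => (M + t • H).det.re) (M.det.re * (M⁻¹ * H).trace.re) 0 := by
  have h := hasDerivAt_det_line hM.det_pos.ne' H
  have h2 := Complex.reCLM.hasFDerivAt.comp_hasDerivAt (0 : ℝ) h
  refine h2.congr_deriv ?_
  rw [← det_re_eq hM.isHermitian]
  simp

theorem hasDerivAt_exp_trace_cfc (V : Potential) (T : ℝ) {M H : Mat N} (hM : M.PosDef)
    (hH : H.IsHermitian) :
    HasDerivAt (fun t : ℝ => Real.exp (-(N / T) * (cfc V.eval (M + t • H)).trace.re))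
      (Real.exp (-(N / T) * (cfc V.eval M).trace.re) * (-(N / T) * (V.deriv M * H).trace.re)) 0 := by
  have hD := det_re_pos hM
  have h1 : HasDerivAt (fun t : ℝ => Real.log (M + t • H).det.re) (M⁻¹ * H).trace.re 0 := by
    have h := (hasDerivAt_det_re (H := H) hM).log (by simpa using hD.ne')
    refine h.congr_deriv ?_
    rw [zero_smul, add_zero, mul_div_cancel_left₀ _ hD.ne']
  have h2 : ∀ k : ℕ, HasDerivAt (fun t : ℝ => ((M + t • H) ^ k).trace.re)
      (k * (M ^ (k - 1) * H).trace.re) 0 := fun k => by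
    have h := Complex.reCLM.hasFDerivAt.comp_hasDerivAt (0 : ℝ) (hasDerivAt_trace_pow M H k)
    refine h.congr_deriv ?_
    simp
  have h3 := ((((h1.const_mul (-V.tLog)).add (HasDerivAt.fun_sum fun k (_ : k ∈ Finset.Icc 1 V.d) =>
    (h2 k).const_mul (V.t k))).const_mul (-(N / T : ℝ))).exp)
  have h4 : (V.deriv M * H).trace.re = -V.tLog * (M⁻¹ * H).trace.re
      + ∑ k ∈ Finset.Icc 1 V.d, V.t k * (k * (M ^ (k - 1) * H).trace.re) := by
    have e : (V.deriv M * H).trace = ((-V.tLog : ℝ) : ℂ) * (M⁻¹ * H).trace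
        + ∑ k ∈ Finset.Icc 1 V.d, ((V.t k * k : ℝ) : ℂ) * (M ^ (k - 1) * H).trace := by
      simp only [Potential.deriv, add_mul, neg_mul, Matrix.smul_mul, Finset.sum_mul,
        Matrix.trace_add, Matrix.trace_neg, Matrix.trace_smul, Matrix.trace_sum, smul_eq_mul]
      push_cast
      congr 1
      · ring
      · exact Finset.sum_congr rfl fun k _ => by ring
    rw [e, Complex.add_re, Complex.re_ofReal_mul, Complex.re_sum]
    congr 1
    exact Finset.sum_congr rfl fun k _ => by rw [Complex.re_ofReal_mul]; ring
  -- The formula through `log det` is available only for positive definite matrices, hence for small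
  -- `t`, which suffices for a derivative at `0`.
  have h5 : HasDerivAt (fun t : ℝ => Real.exp (-(N / T) * (cfc V.eval (M + t • H)).trace.re)) _ 0 :=
    h3.congr_of_eventuallyEq (by
      filter_upwards [eventually_posDef_line hM hH] with t ht
      rw [trace_cfc_eval V ht]
      rfl)
  refine h5.congr_deriv ?_
  rw [h4, trace_cfc_eval V hM]
  simp

theorem hasDerivAt_weight (V₁ V₂ : Potential) (T : ℝ) {M₁ M₂ H₁ H₂ : Mat N} (h₁ : M₁.PosDef)
    (h₂ : M₂.PosDef) (k₁ : H₁.IsHermitian) (k₂ : H₂.IsHermitian) :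
    HasDerivAt (fun t : ℝ => (weight V₁ V₂ T (M₁ + t • H₁) (M₂ + t • H₂) : ℂ))
      (logDeriv V₁ V₂ T M₁ M₂ (H₁, H₂) * weight V₁ V₂ T M₁ M₂) 0 := by
  have hS := tensorSum_posDef h₁ h₂
  have hd := det_re_pos hS
  have e : ∀ t : ℝ, tensorSum (M₁ + t • H₁) (M₂ + t • H₂) = tensorSum M₁ M₂ + t • tensorSum H₁ H₂ :=
    fun t => by
      have h := tensorSum_smul (t : ℂ) H₁ H₂
      rw [tensorSum_add]
      congr 1
  have hdet : HasDerivAt (fun t : ℝ => (tensorSum (M₁ + t • H₁) (M₂ + t • H₂)).det.re)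
      ((tensorSum M₁ M₂).det.re * ((tensorSum M₁ M₂)⁻¹ * tensorSum H₁ H₂).trace.re) 0 := by
    simp only [e]
    exact hasDerivAt_det_re hS
  have h := ((hasDerivAt_exp_trace_cfc V₁ T h₁ k₁).mul (hasDerivAt_exp_trace_cfc V₂ T h₂ k₂)).div
    hdet (by simpa using hd.ne')
  -- In Hermitian directions each trace is that of a product of two Hermitian matrices, so the
  -- complex form takes a real value there.
  have hre : (logDeriv V₁ V₂ T M₁ M₂ (H₁, H₂)) = ((-(N / T) * ((V₁.deriv M₁ * H₁).trace.re
      + (V₂.deriv M₂ * H₂).trace.re) - ((tensorSum M₁ M₂)⁻¹ * tensorSum H₁ H₂).trace.re : ℝ) : ℂ) := by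
    rw [logDeriv_apply]
    push_cast
    rw [trace_mul_im_eq_zero (deriv_isHermitian V₁ h₁.isHermitian) k₁,
      trace_mul_im_eq_zero (deriv_isHermitian V₂ h₂.isHermitian) k₂,
      trace_mul_im_eq_zero hS.isHermitian.inv (tensorSum_isHermitian k₁ k₂)]
  have hw := h.ofReal_comp
  have hfun : (fun t : ℝ => (weight V₁ V₂ T (M₁ + t • H₁) (M₂ + t • H₂) : ℂ)) = fun t : ℝ =>
      ((((fun t : ℝ => Real.exp (-(N / T) * (cfc V₁.eval (M₁ + t • H₁)).trace.re)) *
        fun t : ℝ => Real.exp (-(N / T) * (cfc V₂.eval (M₂ + t • H₂)).trace.re)) /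
        fun t : ℝ => (tensorSum (M₁ + t • H₁) (M₂ + t • H₂)).det.re) t : ℂ) := by
    funext t
    rw [weight_eq]
    rfl
  rw [hfun]
  refine hw.congr_deriv ?_
  rw [hre, weight_eq, ← Complex.ofReal_mul]
  congr 1
  simp only [zero_smul, add_zero, Pi.mul_apply]
  field_simp
  ring

end WeightDerivative

/-! ### Integration by parts in the Cauchy model -/

section ModelIntegration

variable {N : ℕ}

theorem isClosed_posSemidef_coord :
    IsClosed {a : Fin N → Fin N → ℝ | (hermitianOf a).PosSemidef} := by
  have h : {a : Fin N → Fin N → ℝ | (hermitianOf a).PosSemidef}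
      = ⋂ v : Fin N → ℂ, {a | 0 ≤ (star v ⬝ᵥ (hermitianOf a *ᵥ v)).re} := by
    ext a
    simp only [Set.mem_ofPred_eq, Set.mem_iInter]
    refine ⟨fun h v => h.re_dotProduct_nonneg v, fun h =>
      Matrix.PosSemidef.of_dotProduct_mulVec_nonneg (hermitianOf_isHermitian a) fun v =>
        Complex.nonneg_iff.2 ⟨h v, ?_⟩⟩
    exact ((hermitianOf_isHermitian a).im_star_dotProduct_mulVec_self v).symm
  rw [h]
  refine isClosed_iInter fun v => isClosed_le continuous_const ?_
  have := continuous_hermitianOf (N := N)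
  fun_prop

/-- A positive semidefinite matrix with nonzero determinant is positive definite, so the open
condition may be replaced by a closed one. -/
theorem isClosed_posDefPairs_det_ge {ε : ℝ} (hε : 0 < ε) :
    IsClosed {p : (Fin N → Fin N → ℝ) × (Fin N → Fin N → ℝ) | p ∈ posDefPairs N ∧
      ε ≤ (hermitianOf p.1).det.re * (hermitianOf p.2).det.re} := by
  have h : {p : (Fin N → Fin N → ℝ) × (Fin N → Fin N → ℝ) | p ∈ posDefPairs N ∧
      ε ≤ (hermitianOf p.1).det.re * (hermitianOf p.2).det.re} =
      ((Prod.fst ⁻¹' {a | (hermitianOf a).PosSemidef}) ∩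
        (Prod.snd ⁻¹' {a | (hermitianOf a).PosSemidef})) ∩
        {p | ε ≤ (hermitianOf p.1).det.re * (hermitianOf p.2).det.re} := by
    ext p
    simp only [posDefPairs, Set.mem_ofPred_eq, Set.mem_inter_iff, Set.mem_preimage]
    refine ⟨fun h => ⟨⟨h.1.1.posSemidef, h.1.2.posSemidef⟩, h.2⟩, fun h => ⟨⟨?_, ?_⟩, h.2⟩⟩
    · refine h.1.1.posDef_iff_det_ne_zero.2 fun h0 => ?_
      have := h.2
      rw [h0, Complex.zero_re, zero_mul] at this
      linarith
    · refine h.1.2.posDef_iff_det_ne_zero.2 fun h0 => ?_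
      have := h.2
      rw [h0, Complex.zero_re, mul_zero] at this
      linarith
  have c := continuous_hermitianOf (N := N)
  rw [h]
  refine ((isClosed_posSemidef_coord.preimage continuous_fst).inter
    (isClosed_posSemidef_coord.preimage continuous_snd)).inter (isClosed_le continuous_const ?_)
  fun_prop

variable {f : Mat N → Mat N → ℂ} {f' : Mat N → Mat N → Mat N × Mat N →ₗ[ℂ] ℂ}

/-- The cutoff variable is `det M₁ * det M₂`. Its logarithmic derivative `tr M₁⁻¹H₁ + tr M₂⁻¹H₂` has
only simple poles in the determinants, so the cutoff error is integrable. -/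
theorem integral_hermitian_direction_eq_zero (V₁ V₂ : Potential) (hN : 0 < N) {T : ℝ} (hT : 0 < T)
    (hf : Tame f) (hf' : ∀ K, Tame fun M₁ M₂ => f' M₁ M₂ K)
    (hd : ∀ M₁ M₂ H₁ H₂ : Mat N, M₁.PosDef → M₂.PosDef → H₁.IsHermitian → H₂.IsHermitian →
      HasDerivAt (fun t : ℝ => f (M₁ + t • H₁) (M₂ + t • H₂)) (f' M₁ M₂ (H₁, H₂)) 0)
    {H₁ H₂ : Mat N} (k₁ : H₁.IsHermitian) (k₂ : H₂.IsHermitian) :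
    ∫ p in posDefPairs N, (f' (hermitianOf p.1) (hermitianOf p.2) (H₁, H₂) +
      f (hermitianOf p.1) (hermitianOf p.2) *
        logDeriv V₁ V₂ T (hermitianOf p.1) (hermitianOf p.2) (H₁, H₂)) *
      (weight V₁ V₂ T (hermitianOf p.1) (hermitianOf p.2) : ℂ) = 0 := by
  have := isAddHaarMeasure_volume_coord_prod N
  have c := continuous_hermitianOf (N := N)
  obtain ⟨b₁, rfl⟩ := exists_hermitianOf k₁
  obtain ⟨b₂, rfl⟩ := exists_hermitianOf k₂
  have tc : ∀ A : Mat N, TameMat fun _ _ => A := fun A i j => tame_const _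
  refine setIntegral_hasLineDerivAt_eq_zero isOpen_posDefPairs (v := (b₁, b₂))
    (G := fun p => f (hermitianOf p.1) (hermitianOf p.2) *
      (weight V₁ V₂ T (hermitianOf p.1) (hermitianOf p.2) : ℂ))
    (D := fun p => (hermitianOf p.1).det.re * (hermitianOf p.2).det.re)
    (δ := fun p => ((hermitianOf p.1)⁻¹ * hermitianOf b₁).trace.re +
      ((hermitianOf p.2)⁻¹ * hermitianOf b₂).trace.re)
    (fun p hp => mul_pos (det_re_pos hp.1) (det_re_pos hp.2)) (by fun_prop)
    (fun ε hε => isClosed_posDefPairs_det_ge hε) (fun p hp => ?_) (fun p hp => ?_)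
    (hf.singular.hasAverage V₁ V₂ hN hT)
    (Singular.hasAverage ((hf' _).singular.add (hf.mul (singular_logDeriv V₁ V₂ T _)))
      V₁ V₂ hN hT) ?_
  · have h := (hd _ _ _ _ hp.1 hp.2 k₁ k₂).mul (hasDerivAt_weight V₁ V₂ T hp.1 hp.2 k₁ k₂)
    simp only [zero_smul, add_zero] at h
    unfold HasLineDerivAt
    simp only [Prod.fst_add, Prod.snd_add, Prod.smul_fst, Prod.smul_snd, hermitianOf_add,
      hermitianOf_smul]
    refine h.congr_deriv ?_
    ring
  · have h := (hasDerivAt_det_re (H := hermitianOf b₁) hp.1).mul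
      (hasDerivAt_det_re (H := hermitianOf b₂) hp.2)
    simp only [zero_smul, add_zero] at h
    unfold HasLineDerivAt
    simp only [Prod.fst_add, Prod.snd_add, Prod.smul_fst, Prod.smul_snd, hermitianOf_add,
      hermitianOf_smul]
    refine h.congr_deriv ?_
    ring
  · have hs : Singular fun M₁ M₂ => f M₁ M₂ * ((M₁⁻¹ * hermitianOf b₁).trace +
        (M₂⁻¹ * hermitianOf b₂).trace) :=
      hf.mul ((singularMat_inv_fst.mul_tameMat (tc _)).trace.add
        (singularMat_inv_snd.mul_tameMat (tc _)).trace)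
    have h := hs.hasAverage V₁ V₂ hN hT
    refine IntegrableOn.congr_fun h (fun p hp => ?_) measurableSet_posDefPairs
    push_cast
    rw [trace_mul_im_eq_zero hp.1.isHermitian.inv k₁, trace_mul_im_eq_zero hp.2.isHermitian.inv k₂]
    ring

theorem exists_hermitian_decomposition (A : Mat N) :
    ∃ B C : Mat N, B.IsHermitian ∧ C.IsHermitian ∧ A = B + Complex.I • C := by
  refine ⟨(1 / 2 : ℂ) • (A + Aᴴ), (-Complex.I / 2) • (A - Aᴴ), ?_, ?_, ?_⟩
  · rw [Matrix.IsHermitian, Matrix.conjTranspose_smul, Matrix.conjTranspose_add,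
      Matrix.conjTranspose_conjTranspose, add_comm Aᴴ]
    simp
  · rw [Matrix.IsHermitian, Matrix.conjTranspose_smul, Matrix.conjTranspose_sub,
      Matrix.conjTranspose_conjTranspose, ← neg_sub A, smul_neg, ← neg_smul]
    simp [neg_div]
  · rw [smul_smul, ← mul_div_assoc, mul_neg, Complex.I_mul_I, neg_neg, ← smul_add]
    ext i j
    simp
    ring

/-- Integration by parts along a complex direction. -/
theorem integral_direction_eq_zero (V₁ V₂ : Potential) (hN : 0 < N) {T : ℝ} (hT : 0 < T)
    (hf : Tame f) (hf' : ∀ K, Tame fun M₁ M₂ => f' M₁ M₂ K)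
    (hd : ∀ M₁ M₂ H₁ H₂ : Mat N, M₁.PosDef → M₂.PosDef → H₁.IsHermitian → H₂.IsHermitian →
      HasDerivAt (fun t : ℝ => f (M₁ + t • H₁) (M₂ + t • H₂)) (f' M₁ M₂ (H₁, H₂)) 0)
    (K : Mat N × Mat N) :
    ∫ p in posDefPairs N, (f' (hermitianOf p.1) (hermitianOf p.2) K +
      f (hermitianOf p.1) (hermitianOf p.2) *
        logDeriv V₁ V₂ T (hermitianOf p.1) (hermitianOf p.2) K) *
      (weight V₁ V₂ T (hermitianOf p.1) (hermitianOf p.2) : ℂ) = 0 := by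
  obtain ⟨B₁, C₁, hB₁, hC₁, e₁⟩ := exists_hermitian_decomposition K.1
  obtain ⟨B₂, C₂, hB₂, hC₂, e₂⟩ := exists_hermitian_decomposition K.2
  -- The integrand is complex linear in the direction, so the Hermitian case extends to all
  -- directions, in particular to the matrix units.
  have hK : K = (B₁, B₂) + Complex.I • (C₁, C₂) := Prod.ext e₁ e₂
  have hint : ∀ L, HasAverage V₁ V₂ T fun M₁ M₂ =>
      f' M₁ M₂ L + f M₁ M₂ * logDeriv V₁ V₂ T M₁ M₂ L := fun L =>
    Singular.hasAverage ((hf' L).singular.add (hf.mul (singular_logDeriv V₁ V₂ T L))) V₁ V₂ hN hT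
  have hB := integral_hermitian_direction_eq_zero V₁ V₂ hN hT hf hf' hd hB₁ hB₂
  have hC := integral_hermitian_direction_eq_zero V₁ V₂ hN hT hf hf' hd hC₁ hC₂
  calc _ = ∫ p in posDefPairs N, (((f' (hermitianOf p.1) (hermitianOf p.2) (B₁, B₂) +
          f (hermitianOf p.1) (hermitianOf p.2) *
            logDeriv V₁ V₂ T (hermitianOf p.1) (hermitianOf p.2) (B₁, B₂)) *
          (weight V₁ V₂ T (hermitianOf p.1) (hermitianOf p.2) : ℂ)) +
        Complex.I * ((f' (hermitianOf p.1) (hermitianOf p.2) (C₁, C₂) +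
          f (hermitianOf p.1) (hermitianOf p.2) *
            logDeriv V₁ V₂ T (hermitianOf p.1) (hermitianOf p.2) (C₁, C₂)) *
          (weight V₁ V₂ T (hermitianOf p.1) (hermitianOf p.2) : ℂ))) := by
        refine integral_congr_ae (Eventually.of_forall fun p => ?_)
        simp only [hK, map_add, map_smul, smul_eq_mul]
        ring
    _ = 0 := by
        rw [integral_add (hint _) ((hint _).const_mul _), integral_const_mul, hB, hC, mul_zero,
          add_zero]

end ModelIntegration

end CauchyModel
end

noncomputable section
namespace CauchyModel
open MeasureTheory Filter
open scoped Matrix Kronecker ComplexOrder Topology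

/-! ### Loop equations -/

section LoopEquations

variable {N : ℕ}

theorem tameMat_const (A : Mat N) : TameMat fun _ _ => A := fun _ _ => tame_const _

/-- A function of a matrix together with the components `∑_s A_s ⊗ B_s` of its divided
difference. -/
structure DifferenceCalculus (N : ℕ) where
  /-- the function -/
  toFun : Mat N → Mat N
  /-- the number of terms of the divided difference -/
  n : ℕ
  /-- the first tensor factors of the divided difference -/
  A : ℕ → Mat N → Mat N
  /-- the second tensor factors of the divided difference -/
  B : ℕ → Mat N → Mat N
  hasMatDeriv : ∀ M H : Mat N, M.IsHermitian →
    HasMatDeriv (fun t => toFun (M + t • H)) (∑ s ∈ Finset.range n, A s M * H * B s M)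
  kronecker_sub : ∀ M₁ M₂ : Mat N, M₁.IsHermitian → M₂.IsHermitian →
    toFun M₁ ⊗ₖ (1 : Mat N) - (1 : Mat N) ⊗ₖ toFun (-M₂) =
      tensorSum M₁ M₂ * ∑ s ∈ Finset.range n, A s M₁ ⊗ₖ B s (-M₂)
  tame_fst : TameMat fun M₁ _ => toFun M₁
  tame_snd : TameMat fun _ M₂ => toFun (-M₂)
  tame_A_fst : ∀ s, TameMat fun M₁ _ => A s M₁
  tame_A_snd : ∀ s, TameMat fun _ M₂ => A s (-M₂)
  tame_B_fst : ∀ s, TameMat fun M₁ _ => B s M₁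
  tame_B_snd : ∀ s, TameMat fun _ M₂ => B s (-M₂)

/-- The divided difference of the resolvent. -/
def resolventCalculus (N : ℕ) {x : ℂ} (hx : x.im ≠ 0) : DifferenceCalculus N where
  toFun M := (x • (1 : Mat N) - M)⁻¹
  n := 1
  A _ M := (x • (1 : Mat N) - M)⁻¹
  B _ M := (x • (1 : Mat N) - M)⁻¹
  hasMatDeriv M H hM := by
    have h := hasMatDeriv_inv (isUnit_det_resolvent hM hx).ne_zero (-H)
    simp only [Finset.sum_range_one]
    convert h using 1
    · funext t
      congr 1
      rw [smul_neg]
      abel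
    · simp
  kronecker_sub M₁ M₂ h₁ h₂ := by
    simp only [Finset.sum_range_one]
    have u₁ := Matrix.mul_nonsing_inv _ (isUnit_det_resolvent h₁ hx)
    have u₂ := Matrix.mul_nonsing_inv _ (isUnit_det_resolvent h₂.neg hx)
    -- Written as `𝕀 ⊗ (x + M₂) - (x - M₁) ⊗ 𝕀`, the tensor sum cancels one resolvent factor in each
    -- term.
    have e : tensorSum M₁ M₂ = (1 : Mat N) ⊗ₖ (x • (1 : Mat N) - -M₂)
        - (x • (1 : Mat N) - M₁) ⊗ₖ (1 : Mat N) := by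
      simp only [tensorSum, sub_neg_eq_add, Matrix.kronecker_add, Matrix.kronecker_smul,
        sub_eq_add_neg (x • (1 : Mat N)) M₁, Matrix.add_kronecker, Matrix.smul_kronecker]
      have : (-M₁) ⊗ₖ (1 : Mat N) = -(M₁ ⊗ₖ (1 : Mat N)) := by
        rw [← neg_one_smul ℂ, Matrix.smul_kronecker, neg_one_smul]
      rw [this]
      abel
    rw [e, sub_mul, ← Matrix.mul_kronecker_mul, ← Matrix.mul_kronecker_mul, u₁, u₂, one_mul,
      one_mul]
  tame_fst := tameMat_resolvent_fst hx
  tame_snd := tameMat_resolvent_snd hx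
  tame_A_fst _ := tameMat_resolvent_fst hx
  tame_A_snd _ := tameMat_resolvent_snd hx
  tame_B_fst _ := tameMat_resolvent_fst hx
  tame_B_snd _ := tameMat_resolvent_snd hx

/-- The divided difference of a power. -/
def powCalculus (N k : ℕ) : DifferenceCalculus N where
  toFun M := M ^ k
  n := k
  A s M := M ^ s
  B s M := M ^ (k - 1 - s)
  hasMatDeriv M H _ := hasMatDeriv_pow M H k
  kronecker_sub M₁ M₂ _ _ := by
    have p₁ : ∀ j : ℕ, (M₁ ⊗ₖ (1 : Mat N)) ^ j = (M₁ ^ j) ⊗ₖ (1 : Mat N) := fun j => by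
      induction j with
      | zero => simp
      | succ j ih => rw [pow_succ, ih, ← Matrix.mul_kronecker_mul, one_mul, pow_succ]
    have p₂ : ∀ j : ℕ, ((1 : Mat N) ⊗ₖ (-M₂)) ^ j = (1 : Mat N) ⊗ₖ ((-M₂) ^ j) := fun j => by
      induction j with
      | zero => simp
      | succ j ih => rw [pow_succ, ih, ← Matrix.mul_kronecker_mul, one_mul, pow_succ]
    have hc : Commute (M₁ ⊗ₖ (1 : Mat N)) ((1 : Mat N) ⊗ₖ (-M₂)) := by
      rw [Commute, SemiconjBy, ← Matrix.mul_kronecker_mul, ← Matrix.mul_kronecker_mul]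
      simp
    have e : tensorSum M₁ M₂ = M₁ ⊗ₖ (1 : Mat N) - (1 : Mat N) ⊗ₖ (-M₂) := by
      have : (1 : Mat N) ⊗ₖ (-M₂) = -((1 : Mat N) ⊗ₖ M₂) := by
        rw [← neg_one_smul ℂ, Matrix.kronecker_smul, neg_one_smul]
      rw [this, sub_neg_eq_add, tensorSum]
    -- This is the factorization of `a ^ k - b ^ k` for the commuting elements `a = M₁ ⊗ 𝕀` and `b =
    -- 𝕀 ⊗ (-M₂)`.
    rw [← p₁, ← p₂, e, ← hc.mul_geom_sum₂]
    congr 1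
    refine Finset.sum_congr rfl fun s _ => ?_
    rw [p₁, p₂, ← Matrix.mul_kronecker_mul, one_mul, mul_one]
  tame_fst := tameMat_fst.pow k
  tame_snd := tameMat_snd.neg.pow k
  tame_A_fst s := tameMat_fst.pow s
  tame_A_snd s := tameMat_snd.neg.pow s
  tame_B_fst s := tameMat_fst.pow _
  tame_B_snd s := tameMat_snd.neg.pow _

/-- The integral of a random variable against the unnormalized density. -/
def modelIntegral (V₁ V₂ : Potential) (T : ℝ) (F : Mat N → Mat N → ℂ) : ℂ :=
  ∫ p in posDefPairs N, F (hermitianOf p.1) (hermitianOf p.2) *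
    (weight V₁ V₂ T (hermitianOf p.1) (hermitianOf p.2) : ℂ)

theorem modelIntegral_sum_sum (V₁ V₂ : Potential) (hN : 0 < N) {T : ℝ} (hT : 0 < T)
    {F : Fin N → Fin N → Mat N → Mat N → ℂ} (hF : ∀ k l, Singular (F k l)) :
    modelIntegral V₁ V₂ T (fun M₁ M₂ => ∑ k, ∑ l, F k l M₁ M₂) =
      ∑ k, ∑ l, modelIntegral V₁ V₂ T (F k l) := by
  have h : ∀ k l, IntegrableOn _ _ _ := fun k l => (hF k l).hasAverage V₁ V₂ hN hT
  simp only [modelIntegral, Finset.sum_mul]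
  rw [integral_finsetSum _ fun k _ => integrable_finsetSum _ fun l _ => h k l]
  exact Finset.sum_congr rfl fun k _ => integral_finsetSum _ fun l _ => h k l

namespace DifferenceCalculus

variable (F : DifferenceCalculus N)

theorem tame_diag_fst : Tame fun M₁ (_ : Mat N) =>
    ∑ s ∈ Finset.range F.n, (F.A s M₁).trace * (F.B s M₁).trace :=
  tame_sum _ fun s _ => (F.tame_A_fst s).trace.mul (F.tame_B_fst s).trace

theorem tame_diag_snd : Tame fun (_ : Mat N) M₂ =>
    ∑ s ∈ Finset.range F.n, (F.A s (-M₂)).trace * (F.B s (-M₂)).trace :=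
  tame_sum _ fun s _ => (F.tame_A_snd s).trace.mul (F.tame_B_snd s).trace

theorem tame_mixed : Tame fun M₁ M₂ : Mat N =>
    ∑ s ∈ Finset.range F.n, (F.A s M₁).trace * (F.B s (-M₂)).trace :=
  tame_sum _ fun s _ => (F.tame_A_fst s).trace.mul (F.tame_B_snd s).trace

/-- The derivative of a matrix element of `F(M₁)`, as a linear form. -/
def derivFst (k l : Fin N) (M₁ : Mat N) : Mat N × Mat N →ₗ[ℂ] ℂ where
  toFun H := (∑ s ∈ Finset.range F.n, F.A s M₁ * H.1 * F.B s M₁) k l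
  map_add' H K := by
    simp only [Prod.fst_add, mul_add, add_mul, Finset.sum_add_distrib, Matrix.add_apply]
  map_smul' c H := by
    simp only [Prod.smul_fst, Matrix.mul_smul, Matrix.smul_mul, ← Finset.smul_sum,
      Matrix.smul_apply, RingHom.id_apply]

/-- The derivative of a matrix element of `F(-M₂)`, as a linear form. -/
def derivSnd (k l : Fin N) (M₂ : Mat N) : Mat N × Mat N →ₗ[ℂ] ℂ where
  toFun H := (∑ s ∈ Finset.range F.n, F.A s (-M₂) * (-H.2) * F.B s (-M₂)) k l
  map_add' H K := by
    simp only [Prod.snd_add, neg_add, mul_add, add_mul, Finset.sum_add_distrib, Matrix.add_apply]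
  map_smul' c H := by
    simp only [Prod.smul_snd, ← smul_neg, Matrix.mul_smul, Matrix.smul_mul, ← Finset.smul_sum,
      Matrix.smul_apply, RingHom.id_apply]

/-- This contraction over matrix units turns each term of the divergence of a matrix function into a
product of two traces. -/
theorem sum_mul_single_mul_apply (A B : Mat N) :
    ∑ k, ∑ l, (A * Matrix.single k l (1 : ℂ) * B : Mat N) k l = A.trace * B.trace := by
  have h : ∀ k l, (A * Matrix.single k l (1 : ℂ) * B : Mat N) k l = A k k * B l l := fun k l => by
    rw [Matrix.mul_apply, Finset.sum_eq_single l]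
    · simp
    · intro j _ hj
      rw [Matrix.mul_single_apply_of_ne _ _ _ _ _ hj, zero_mul]
    · simp
  simp only [h, ← Finset.mul_sum, ← Finset.sum_mul]
  rfl

theorem sum_mul_apply_single (A : Mat N) (φ : Mat N →ₗ[ℂ] ℂ) :
    ∑ k, ∑ l, A k l * φ (Matrix.single k l 1) = φ A := by
  conv_rhs => rw [Matrix.matrix_eq_sum_single A]
  simp only [map_sum]
  refine Finset.sum_congr rfl fun k _ => Finset.sum_congr rfl fun l _ => ?_
  rw [← smul_eq_mul, ← map_smul, Matrix.smul_single, smul_eq_mul, mul_one]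

variable (V₁ V₂ : Potential)

/-- The divergence theorem for the field `F(M₁)`: each matrix element is integrated by parts in the
direction of its own matrix unit, and the results are summed. -/
theorem modelIntegral_fst_eq_zero (hN : 0 < N) {T : ℝ} (hT : 0 < T) :
    modelIntegral V₁ V₂ T (fun M₁ M₂ : Mat N =>
      ∑ s ∈ Finset.range F.n, (F.A s M₁).trace * (F.B s M₁).trace
        + logDeriv V₁ V₂ T M₁ M₂ (F.toFun M₁, 0)) = 0 := by
  have ts : ∀ k l (K : Mat N × Mat N), Tame fun M₁ (_ : Mat N) => F.derivFst k l M₁ K :=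
    fun k l K => by
      simp only [derivFst, LinearMap.coe_mk, AddHom.coe_mk, Matrix.sum_apply]
      exact tame_sum _ fun s _ =>
        ((F.tame_A_fst s).mul (tameMat_const K.1)).mul (F.tame_B_fst s) k l
  have h := fun k l : Fin N => integral_direction_eq_zero V₁ V₂ hN hT
    (f := fun M₁ _ => F.toFun M₁ k l) (f' := fun M₁ _ => F.derivFst k l M₁)
    (F.tame_fst k l) (ts k l)
    (fun M₁ M₂ H₁ H₂ h₁ _ _ _ => F.hasMatDeriv M₁ H₁ h₁.isHermitian k l) (Matrix.single k l 1, 0)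
  have hs : ∀ k l : Fin N, Singular fun M₁ M₂ =>
      F.derivFst k l M₁ (Matrix.single k l 1, 0)
        + F.toFun M₁ k l * logDeriv V₁ V₂ T M₁ M₂ (Matrix.single k l 1, 0) := fun k l =>
    (ts k l _).singular.add ((F.tame_fst k l).mul (singular_logDeriv V₁ V₂ T _))
  have hsum := modelIntegral_sum_sum V₁ V₂ hN hT hs
  rw [← hsum.trans (Finset.sum_eq_zero fun k _ => Finset.sum_eq_zero fun l _ => h k l)]
  congr 1
  funext M₁ M₂
  simp only [Finset.sum_add_distrib]
  congr 1
  · simp only [derivFst, LinearMap.coe_mk, AddHom.coe_mk, Matrix.sum_apply]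
    rw [Finset.sum_congr rfl fun k _ => Finset.sum_comm, Finset.sum_comm]
    exact Finset.sum_congr rfl fun s _ => (sum_mul_single_mul_apply _ _).symm
  · exact (sum_mul_apply_single (F.toFun M₁)
      ((logDeriv V₁ V₂ T M₁ M₂).comp (LinearMap.inl ℂ (Mat N) (Mat N)))).symm

theorem modelIntegral_snd_eq_zero (hN : 0 < N) {T : ℝ} (hT : 0 < T) :
    modelIntegral V₁ V₂ T (fun M₁ M₂ : Mat N =>
      -∑ s ∈ Finset.range F.n, (F.A s (-M₂)).trace * (F.B s (-M₂)).trace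
        + logDeriv V₁ V₂ T M₁ M₂ (0, F.toFun (-M₂))) = 0 := by
  have ts : ∀ k l (K : Mat N × Mat N), Tame fun (_ : Mat N) M₂ => F.derivSnd k l M₂ K :=
    fun k l K => by
      simp only [derivSnd, LinearMap.coe_mk, AddHom.coe_mk, Matrix.sum_apply]
      exact tame_sum _ fun s _ =>
        ((F.tame_A_snd s).mul (tameMat_const (-K.2))).mul (F.tame_B_snd s) k l
  have h := fun k l : Fin N => integral_direction_eq_zero V₁ V₂ hN hT
    (f := fun _ M₂ => F.toFun (-M₂) k l) (f' := fun _ M₂ => F.derivSnd k l M₂)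
    (F.tame_snd k l) (ts k l)
    (fun M₁ M₂ H₁ H₂ _ h₂ _ _ => by
      have := F.hasMatDeriv (-M₂) (-H₂) h₂.isHermitian.neg k l
      simp only [smul_neg, ← neg_add] at this
      exact this) (0, Matrix.single k l 1)
  have hs : ∀ k l : Fin N, Singular fun M₁ M₂ =>
      F.derivSnd k l M₂ (0, Matrix.single k l 1)
        + F.toFun (-M₂) k l * logDeriv V₁ V₂ T M₁ M₂ (0, Matrix.single k l 1) := fun k l =>
    (ts k l _).singular.add ((F.tame_snd k l).mul (singular_logDeriv V₁ V₂ T _))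
  have hsum := modelIntegral_sum_sum V₁ V₂ hN hT hs
  rw [← hsum.trans (Finset.sum_eq_zero fun k _ => Finset.sum_eq_zero fun l _ => h k l)]
  congr 1
  funext M₁ M₂
  simp only [Finset.sum_add_distrib]
  congr 1
  · simp only [derivSnd, LinearMap.coe_mk, AddHom.coe_mk, Matrix.sum_apply, mul_neg, neg_mul,
      Matrix.neg_apply, Finset.sum_neg_distrib]
    congr 1
    rw [Finset.sum_congr rfl fun k _ => Finset.sum_comm, Finset.sum_comm]
    exact Finset.sum_congr rfl fun s _ => (sum_mul_single_mul_apply _ _).symm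
  · exact (sum_mul_apply_single (F.toFun (-M₂))
      ((logDeriv V₁ V₂ T M₁ M₂).comp (LinearMap.inr ℂ (Mat N) (Mat N)))).symm

/-- The difference is the logarithmic derivative along `(F(M₁), -F(-M₂))`. The tensor sum of this
direction is divisible by that of `(M₁, M₂)`, so the inverse from the Cauchy factor cancels and
leaves the divided difference. -/
theorem logDeriv_apply_sub (T : ℝ) {M₁ M₂ : Mat N} (h₁ : M₁.PosDef) (h₂ : M₂.PosDef) :
    logDeriv V₁ V₂ T M₁ M₂ (F.toFun M₁, 0) - logDeriv V₁ V₂ T M₁ M₂ (0, F.toFun (-M₂)) =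
      -∑ s ∈ Finset.range F.n, (F.A s M₁).trace * (F.B s (-M₂)).trace
        - (N / T : ℂ) * ((V₁.deriv M₁ * F.toFun M₁).trace
          - (V₂.deriv M₂ * F.toFun (-M₂)).trace) := by
  have hS := (tensorSum_posDef h₁ h₂).det_pos.ne'
  have e : tensorSum (F.toFun M₁) (-F.toFun (-M₂)) =
      F.toFun M₁ ⊗ₖ (1 : Mat N) - (1 : Mat N) ⊗ₖ F.toFun (-M₂) := by
    rw [tensorSum, ← neg_one_smul ℂ (F.toFun (-M₂)), Matrix.kronecker_smul, neg_one_smul,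
      sub_eq_add_neg]
  rw [← map_sub, Prod.mk_sub_mk, sub_zero, zero_sub, logDeriv_apply, e,
    F.kronecker_sub M₁ M₂ h₁.isHermitian h₂.isHermitian, ← mul_assoc,
    Matrix.nonsing_inv_mul _ hS.isUnit, one_mul, Matrix.trace_sum]
  simp only [Matrix.trace_kronecker, mul_neg, Matrix.trace_neg]
  ring

/-- The random variable whose average vanishes by the loop equation. -/
def loopVariable (T : ℝ) (M₁ M₂ : Mat N) : ℂ :=
  ∑ s ∈ Finset.range F.n, (F.A s M₁).trace * (F.B s M₁).trace
    + ∑ s ∈ Finset.range F.n, (F.A s (-M₂)).trace * (F.B s (-M₂)).trace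
    - ∑ s ∈ Finset.range F.n, (F.A s M₁).trace * (F.B s (-M₂)).trace
    - (N / T : ℂ) * ((V₁.deriv M₁ * F.toFun M₁).trace - (V₂.deriv M₂ * F.toFun (-M₂)).trace)

theorem modelIntegral_loopVariable (hN : 0 < N) {T : ℝ} (hT : 0 < T) :
    modelIntegral V₁ V₂ T (F.loopVariable V₁ V₂ T) = 0 := by
  -- For a direction depending on the matrices, expansion in matrix units reduces to fixed
  -- directions with tame coefficients.
  have sl : ∀ {K : Mat N → Mat N → Mat N × Mat N}, (TameMat fun M₁ M₂ => (K M₁ M₂).1) →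
      (TameMat fun M₁ M₂ => (K M₁ M₂).2) →
      Singular fun M₁ M₂ => logDeriv V₁ V₂ T M₁ M₂ (K M₁ M₂) := by
    intro K h₁ h₂
    have h : ∀ M₁ M₂, logDeriv V₁ V₂ T M₁ M₂ (K M₁ M₂) =
        ∑ k, ∑ l, (K M₁ M₂).1 k l * logDeriv V₁ V₂ T M₁ M₂ (Matrix.single k l 1, 0)
        + ∑ k, ∑ l, (K M₁ M₂).2 k l * logDeriv V₁ V₂ T M₁ M₂ (0, Matrix.single k l 1) :=
      fun M₁ M₂ => by
        have e₁ := sum_mul_apply_single (K M₁ M₂).1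
          ((logDeriv V₁ V₂ T M₁ M₂).comp (LinearMap.inl ℂ (Mat N) (Mat N)))
        have e₂ := sum_mul_apply_single (K M₁ M₂).2
          ((logDeriv V₁ V₂ T M₁ M₂).comp (LinearMap.inr ℂ (Mat N) (Mat N)))
        simp only [LinearMap.comp_apply, LinearMap.inl_apply, LinearMap.inr_apply] at e₁ e₂
        rw [e₁, e₂, ← map_add, Prod.mk_add_mk, add_zero, zero_add]
    simp only [h]
    exact HasGrowth.add
      (singular_sum _ fun k _ => singular_sum _ fun l _ =>
        (h₁ k l).mul (singular_logDeriv V₁ V₂ T _))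
      (singular_sum _ fun k _ => singular_sum _ fun l _ =>
        (h₂ k l).mul (singular_logDeriv V₁ V₂ T _))
  have t0 := tameMat_const (0 : Mat N)
  have a₁ := Singular.hasAverage (F.tame_diag_fst.singular.add (sl (K := fun M₁ _ => (F.toFun M₁, 0)) F.tame_fst t0)) V₁ V₂ hN hT
  have a₂ := Singular.hasAverage (F.tame_diag_snd.singular.neg.add 
    (sl (K := fun _ M₂ => (0, F.toFun (-M₂))) t0 F.tame_snd)) V₁ V₂ hN hT
  have h := integral_sub a₁ a₂
  have i₁ := F.modelIntegral_fst_eq_zero V₁ V₂ hN hT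
  have i₂ := F.modelIntegral_snd_eq_zero V₁ V₂ hN hT
  unfold modelIntegral at i₁ i₂ ⊢
  rw [i₁, i₂, sub_zero] at h
  rw [← h]
  refine setIntegral_congr_fun measurableSet_posDefPairs fun p hp => ?_
  have e := F.logDeriv_apply_sub V₁ V₂ T hp.1 hp.2
  simp only [loopVariable]
  rw [← sub_mul]
  congr 1
  linear_combination -e

end DifferenceCalculus

end LoopEquations

end CauchyModel
end

noncomputable section
namespace CauchyModel
open MeasureTheory Filter
open scoped Matrix Kronecker ComplexOrder Topology

/-! ### The quadratic identity -/

section QuadraticIdentity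

variable {N : ℕ}

/-- Completing the square: since `2U₁' + U₂' = V₁'(x)` and `U₁' + 2U₂' = V₂'(-x)`, the cross terms
are `V₁'(x) W₁ + V₂'(-x) W₂`, which are also the parts of `P₁ + P₂` containing the potentials at the
spectral parameter. The subtracted bracket is the loop variable up to normalization. -/
theorem quadratic_identity {K : Type*} [Field K] [Algebra ℂ K] (V₁ V₂ : Potential) (T : ℝ) (x : K)
    (M₁ M₂ : Mat N) :
    R V₁ V₂ T x M₁ M₂ = Y₁ V₁ V₂ T x M₁ ^ 2 + Y₂ V₁ V₂ T x M₂ ^ 2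
      + Y₁ V₁ V₂ T x M₁ * Y₂ V₁ V₂ T x M₂
      - (W₁ T x M₁ ^ 2 + W₂ T x M₂ ^ 2 + W₁ T x M₁ * W₂ T x M₂
        - (T / N : ℂ) • ((toK K (V₁.deriv M₁) *
            (x • (1 : Matrix (Fin N) (Fin N) K) - toK K M₁)⁻¹).trace
          - (toK K (V₂.deriv M₂) *
            (x • (1 : Matrix (Fin N) (Fin N) K) + toK K M₂)⁻¹).trace)) := by
  have : CharZero K := charZero_of_injective_algebraMap (algebraMap ℂ K).injective
  rw [R_eq]
  simp only [Y₁, Y₂, P₁, P₂, W₁, W₂, sub_mul, Matrix.trace_sub, Matrix.smul_mul, one_mul,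
    Matrix.trace_smul, smul_eq_mul, dU₁, dU₂]
  simp only [Algebra.smul_def]
  field_simp
  ring

theorem modelIntegral_congr (V₁ V₂ : Potential) (T : ℝ) {F G : Mat N → Mat N → ℂ}
    (h : ∀ M₁ M₂, M₁.PosDef → M₂.PosDef → F M₁ M₂ = G M₁ M₂) :
    modelIntegral V₁ V₂ T F = modelIntegral V₁ V₂ T G :=
  setIntegral_congr_fun measurableSet_posDefPairs fun p hp => by
    simp only [h _ _ hp.1 hp.2]

theorem HasAverage.congr {V₁ V₂ : Potential} {T : ℝ} {F G : Mat N → Mat N → ℂ}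
    (hF : HasAverage V₁ V₂ T F) (h : ∀ M₁ M₂, M₁.PosDef → M₂.PosDef → F M₁ M₂ = G M₁ M₂) :
    HasAverage V₁ V₂ T G :=
  IntegrableOn.congr_fun hF (fun p hp => by simp only [h _ _ hp.1 hp.2]) measurableSet_posDefPairs

theorem modelIntegral_add {V₁ V₂ : Potential} {T : ℝ} {F G : Mat N → Mat N → ℂ}
    (hF : HasAverage V₁ V₂ T F) (hG : HasAverage V₁ V₂ T G) :
    modelIntegral V₁ V₂ T (fun M₁ M₂ => F M₁ M₂ + G M₁ M₂)
      = modelIntegral V₁ V₂ T F + modelIntegral V₁ V₂ T G := by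
  simp only [modelIntegral, add_mul]
  exact integral_add hF hG

theorem modelIntegral_const_mul (V₁ V₂ : Potential) (T : ℝ) (c : ℂ) (F : Mat N → Mat N → ℂ) :
    modelIntegral V₁ V₂ T (fun M₁ M₂ => c * F M₁ M₂) = c * modelIntegral V₁ V₂ T F := by
  simp only [modelIntegral, mul_assoc]
  exact integral_const_mul _ _

theorem cauchyAverage_eq (V₁ V₂ : Potential) (T : ℝ) (F : Mat N → Mat N → ℂ) :
    cauchyAverage V₁ V₂ T F = 1 / (partitionFunction V₁ V₂ N T : ℂ) * modelIntegral V₁ V₂ T F :=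
  rfl

theorem DifferenceCalculus.singular_loopVariable (F : DifferenceCalculus N) (V₁ V₂ : Potential)
    (T : ℝ) : Singular (F.loopVariable V₁ V₂ T) := by
  have h : Singular fun M₁ M₂ : Mat N =>
      (N / T : ℂ) * ((V₁.deriv M₁ * F.toFun M₁).trace - (V₂.deriv M₂ * F.toFun (-M₂)).trace) :=
    HasGrowth.const_mul (HasGrowth.sub ((singularMat_deriv_fst V₁).mul_tameMat F.tame_fst).trace
      ((singularMat_deriv_snd V₂).mul_tameMat F.tame_snd).trace) _
  exact ((F.tame_diag_fst.singular.add F.tame_diag_snd.singular).sub F.tame_mixed.singular).sub h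

/-- The double traces cancel, and what remains is the loop variable of the constant function `M ^
0`, whose divided difference is empty. -/
theorem sum_I_eq (V₁ V₂ : Potential) (hN : 0 < N) {T : ℝ} (hT : 0 < T) (M₁ M₂ : Mat N) :
    I₁ V₁ T M₁ M₂ + I₂ V₂ T M₁ M₂ =
      -(T / N : ℂ) ^ 2 * (powCalculus N 0).loopVariable V₁ V₂ T M₁ M₂ := by
  have hN' : (N : ℂ) ≠ 0 := by exact_mod_cast hN.ne'
  have hT' : (T : ℂ) ≠ 0 := by exact_mod_cast hT.ne'
  simp only [I₁, I₂, DifferenceCalculus.loopVariable, powCalculus, Finset.range_zero,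
    Finset.sum_empty, pow_zero, mul_one]
  field_simp
  ring

theorem hasAverage_sum_I (V₁ V₂ : Potential) (hN : 0 < N) {T : ℝ} (hT : 0 < T) :
    HasAverage V₁ V₂ T fun M₁ M₂ : Mat N => I₁ V₁ T M₁ M₂ + I₂ V₂ T M₁ M₂ := by
  simp only [sum_I_eq V₁ V₂ hN hT]
  exact Singular.hasAverage (((powCalculus N 0).singular_loopVariable V₁ V₂ T).const_mul _)
    V₁ V₂ hN hT

theorem cauchyAverage_sum_I (V₁ V₂ : Potential) (hN : 0 < N) {T : ℝ} (hT : 0 < T) :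
    cauchyAverage V₁ V₂ T (fun M₁ M₂ : Mat N => I₁ V₁ T M₁ M₂ + I₂ V₂ T M₁ M₂) = 0 := by
  simp only [sum_I_eq V₁ V₂ hN hT]
  rw [cauchyAverage_eq, modelIntegral_const_mul,
    (powCalculus N 0).modelIntegral_loopVariable V₁ V₂ hN hT, mul_zero, mul_zero]

/-- The averaged identity, once the random variables differ by one of vanishing average. -/
theorem averaged_identity (V₁ V₂ : Potential) (hN : 0 < N) {T : ℝ} (hT : 0 < T)
    {f g h r L : Mat N → Mat N → ℂ} (hf : Tame f) (hg : Tame g) (hh : Tame h) (hL : Singular L)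
    (hL0 : modelIntegral V₁ V₂ T L = 0) (c z : ℂ)
    (e : ∀ M₁ M₂, M₁.PosDef → M₂.PosDef →
      r M₁ M₂ = f M₁ M₂ + g M₁ M₂ + h M₁ M₂ - c * L M₁ M₂) :
    HasAverage V₁ V₂ T f ∧ HasAverage V₁ V₂ T g ∧ HasAverage V₁ V₂ T h ∧ HasAverage V₁ V₂ T r ∧
      cauchyAverage V₁ V₂ T f + cauchyAverage V₁ V₂ T g + cauchyAverage V₁ V₂ T h =
        cauchyAverage V₁ V₂ T r - z * cauchyAverage V₁ V₂ T (fun M₁ M₂ : Mat N =>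
          I₁ V₁ T M₁ M₂ + I₂ V₂ T M₁ M₂) := by
  have af := hf.singular.hasAverage V₁ V₂ hN hT
  have ag := hg.singular.hasAverage V₁ V₂ hN hT
  have ah := hh.singular.hasAverage V₁ V₂ hN hT
  have afg := Singular.hasAverage (hf.singular.add hg.singular) V₁ V₂ hN hT
  have afgh := Singular.hasAverage ((hf.singular.add hg.singular).add hh.singular) V₁ V₂ hN hT
  have aL := Singular.hasAverage (hL.const_mul (-c)) V₁ V₂ hN hT
  have ar := Singular.hasAverage (((hf.singular.add hg.singular).add hh.singular).add
    (hL.const_mul (-c))) V₁ V₂ hN hT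
  have e' : ∀ M₁ M₂, M₁.PosDef → M₂.PosDef →
      f M₁ M₂ + g M₁ M₂ + h M₁ M₂ + -c * L M₁ M₂ = r M₁ M₂ := fun M₁ M₂ h₁ h₂ => by
    rw [e M₁ M₂ h₁ h₂]
    ring
  refine ⟨af, ag, ah, ar.congr e', ?_⟩
  have hr := modelIntegral_congr V₁ V₂ T e'
  rw [modelIntegral_add afgh aL, modelIntegral_add afg ah, modelIntegral_add af ag,
    modelIntegral_const_mul, hL0, mul_zero, add_zero] at hr
  -- The average of `I₁ + I₂` vanishes, so the factor `z` in front of it may be arbitrary.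
  rw [cauchyAverage_sum_I V₁ V₂ hN hT]
  simp only [cauchyAverage_eq, ← hr]
  ring

theorem toK_complex (M : Mat N) : toK ℂ M = M := by
  ext i j
  simp [toK]

theorem complex_identity (V₁ V₂ : Potential) (hN : 0 < N) {T : ℝ} (hT : 0 < T) {x : ℂ}
    (hx : x.im ≠ 0) :
    HasAverage V₁ V₂ T (fun M₁ _ : Mat N => Y₁ V₁ V₂ T x M₁ ^ 2) ∧
    HasAverage V₁ V₂ T (fun _ M₂ : Mat N => Y₂ V₁ V₂ T x M₂ ^ 2) ∧
    HasAverage V₁ V₂ T (fun M₁ M₂ : Mat N => Y₁ V₁ V₂ T x M₁ * Y₂ V₁ V₂ T x M₂) ∧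
    HasAverage V₁ V₂ T (fun M₁ M₂ : Mat N => R V₁ V₂ T x M₁ M₂) ∧
    cauchyAverage V₁ V₂ T (fun M₁ _ : Mat N => Y₁ V₁ V₂ T x M₁ ^ 2)
      + cauchyAverage V₁ V₂ T (fun _ M₂ : Mat N => Y₂ V₁ V₂ T x M₂ ^ 2)
      + cauchyAverage V₁ V₂ T (fun M₁ M₂ : Mat N => Y₁ V₁ V₂ T x M₁ * Y₂ V₁ V₂ T x M₂)
      = cauchyAverage V₁ V₂ T (fun M₁ M₂ : Mat N => R V₁ V₂ T x M₁ M₂)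
        - 1 / x * cauchyAverage V₁ V₂ T (fun M₁ M₂ : Mat N =>
            I₁ V₁ T M₁ M₂ + I₂ V₂ T M₁ M₂) := by
  have hN' : (N : ℂ) ≠ 0 := by exact_mod_cast hN.ne'
  have hT' : (T : ℂ) ≠ 0 := by exact_mod_cast hT.ne'
  have y₁ : Tame fun M₁ _ : Mat N => Y₁ V₁ V₂ T x M₁ := by
    simp only [Y₁, W₁, toK_complex, smul_eq_mul]
    exact (tame_const _).sub ((tameMat_resolvent_fst hx).trace.const_mul _)
  have y₂ : Tame fun _ M₂ : Mat N => Y₂ V₁ V₂ T x M₂ := by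
    simp only [Y₂, W₂, toK_complex, smul_eq_mul, ← sub_neg_eq_add (x • (1 : Mat N))]
    exact (tame_const _).sub ((tameMat_resolvent_snd hx).trace.const_mul _).neg
  refine averaged_identity V₁ V₂ hN hT (by simpa only [pow_two] using y₁.mul y₁)
    (by simpa only [pow_two] using y₂.mul y₂) (y₁.mul y₂)
    ((resolventCalculus N hx).singular_loopVariable V₁ V₂ T)
    ((resolventCalculus N hx).modelIntegral_loopVariable V₁ V₂ hN hT) ((T / N : ℂ) ^ 2) _
    fun M₁ M₂ _ _ => ?_
  rw [quadratic_identity]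
  simp only [W₁, W₂, toK_complex, smul_eq_mul, DifferenceCalculus.loopVariable, resolventCalculus,
    Finset.sum_range_one, sub_neg_eq_add]
  field_simp
  ring

end QuadraticIdentity

end CauchyModel
end

noncomputable section
namespace CauchyModel
open MeasureTheory Filter
open scoped Matrix Kronecker ComplexOrder Topology

/-! ### Formal expansions -/

section FormalExpansions

variable {N : ℕ}

/-- The formal series `∑_k f_k x^(-k-1)`. -/
def seriesOf (f : ℕ → ℂ) : FormalSeries :=
  HahnSeries.single 1 1 * HahnSeries.ofPowerSeries ℤ ℂ (PowerSeries.mk f)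

theorem coeff_seriesOf (f : ℕ → ℂ) (n : ℤ) :
    (seriesOf f).coeff n = if n ≤ 0 then 0 else f (n - 1).toNat := by
  rw [seriesOf, HahnSeries.coeff_single_mul, one_mul, PowerSeries.coeff_coe, PowerSeries.coeff_mk]
  by_cases h : n ≤ 0
  · rw [if_pos h, if_pos (by omega)]
  · rw [if_neg h, if_neg (by omega)]
    congr 1
    omega

theorem seriesOf_add (f g : ℕ → ℂ) : seriesOf f + seriesOf g = seriesOf fun k => f k + g k := by
  ext n
  rw [HahnSeries.coeff_add, coeff_seriesOf, coeff_seriesOf, coeff_seriesOf]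
  split_ifs <;> simp

theorem seriesOf_sub (f g : ℕ → ℂ) : seriesOf f - seriesOf g = seriesOf fun k => f k - g k := by
  ext n
  rw [HahnSeries.coeff_sub, coeff_seriesOf, coeff_seriesOf, coeff_seriesOf]
  split_ifs <;> simp

theorem smul_seriesOf (c : ℂ) (f : ℕ → ℂ) : c • seriesOf f = seriesOf fun k => c * f k := by
  ext n
  rw [HahnSeries.coeff_smul, coeff_seriesOf, coeff_seriesOf]
  split_ifs <;> simp

theorem sum_seriesOf {ι : Type*} (s : Finset ι) (f : ι → ℕ → ℂ) :
    ∑ i ∈ s, seriesOf (f i) = seriesOf fun k => ∑ i ∈ s, f i k := by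
  ext n
  rw [HahnSeries.coeff_sum, coeff_seriesOf]
  simp only [coeff_seriesOf]
  split_ifs <;> simp

theorem formalX_mul_seriesOf (f : ℕ → ℂ) :
    formalX * seriesOf f = algebraMap ℂ FormalSeries (f 0) + seriesOf fun k => f (k + 1) := by
  ext n
  rw [formalX, HahnSeries.coeff_single_mul, one_mul, HahnSeries.coeff_add, coeff_seriesOf,
    coeff_seriesOf, algebraMap_formalSeries, HahnSeries.coeff_single]
  rcases lt_trichotomy n 0 with h | h | h
  · rw [if_pos (by omega), if_neg (by omega), if_pos (by omega), add_zero]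
  · subst h
    simp
  · rw [if_neg (by omega), if_neg (by omega), if_neg (by omega), zero_add]
    congr 1
    omega

/-- The two prefactors `x⁻¹` lower the convolution index by one, which is precisely the index
pattern of the divided difference of `M ^ k`. -/
theorem seriesOf_mul (f g : ℕ → ℂ) :
    seriesOf f * seriesOf g =
      seriesOf fun k => ∑ s ∈ Finset.range k, f s * g (k - 1 - s) := by
  have h : (PowerSeries.mk fun k => ∑ s ∈ Finset.range k, f s * g (k - 1 - s)) =
      PowerSeries.X * (PowerSeries.mk f * PowerSeries.mk g) := by
    ext k
    cases k with
    | zero => simp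
    | succ k =>
      rw [PowerSeries.coeff_succ_X_mul, PowerSeries.coeff_mul, PowerSeries.coeff_mk,
        Finset.Nat.sum_antidiagonal_eq_sum_range_succ_mk]
      simp
  simp only [seriesOf]
  rw [h, map_mul, map_mul, HahnSeries.ofPowerSeries_X]
  ring

/-- The expansion of the resolvent `(x - M)⁻¹` in powers of `x⁻¹`. -/
def formalResolvent (M : Mat N) : Matrix (Fin N) (Fin N) FormalSeries :=
  Matrix.of fun i j => seriesOf fun k => (M ^ k) i j

theorem toK_mul_formalResolvent (A M : Mat N) (i j : Fin N) :
    (toK FormalSeries A * formalResolvent M) i j = seriesOf fun k => (A * M ^ k) i j := by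
  simp only [Matrix.mul_apply, toK, Matrix.map_apply, formalResolvent, Matrix.of_apply,
    ← Algebra.smul_def, smul_seriesOf, sum_seriesOf]

theorem inv_smul_one_sub_toK {K : Type*} [Field K] [Algebra ℂ K] {x : K} {M : Mat N}
    {G : Matrix (Fin N) (Fin N) K}
    (h : ∀ i j, x * G i j - (toK K M * G) i j = (1 : Matrix (Fin N) (Fin N) K) i j) :
    (x • (1 : Matrix (Fin N) (Fin N) K) - toK K M)⁻¹ = G := by
  refine Matrix.inv_eq_right_inv ?_
  ext i j
  rw [← h, sub_mul, smul_mul_assoc, one_mul]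
  rfl

theorem inv_formalX_sub (M : Mat N) :
    (formalX • (1 : Matrix (Fin N) (Fin N) FormalSeries) - toK FormalSeries M)⁻¹ =
      formalResolvent M := by
  refine inv_smul_one_sub_toK fun i j => ?_
  rw [toK_mul_formalResolvent, formalResolvent, Matrix.of_apply, formalX_mul_seriesOf]
  simp only [pow_succ', pow_zero, add_sub_cancel_right, Matrix.one_apply]
  split_ifs <;> simp

theorem toK_neg {K : Type*} [Field K] [Algebra ℂ K] (M : Mat N) : toK K (-M) = -toK K M := by
  ext i j
  simp [toK]

theorem inv_formalX_add (M : Mat N) :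
    (formalX • (1 : Matrix (Fin N) (Fin N) FormalSeries) + toK FormalSeries M)⁻¹ =
      formalResolvent (-M) := by
  rw [← inv_formalX_sub, toK_neg, sub_neg_eq_add]

theorem trace_formalResolvent (M : Mat N) :
    (formalResolvent M).trace = seriesOf fun k => (M ^ k).trace := by
  simp only [Matrix.trace, Matrix.diag_apply, formalResolvent, Matrix.of_apply, sum_seriesOf]

theorem trace_toK_mul_formalResolvent (A M : Mat N) :
    (toK FormalSeries A * formalResolvent M).trace = seriesOf fun k => (A * M ^ k).trace := by
  simp only [Matrix.trace, Matrix.diag_apply, toK_mul_formalResolvent, sum_seriesOf]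

theorem W₁_formalX (T : ℝ) (M : Mat N) :
    W₁ T formalX M = seriesOf fun k => (T / N : ℂ) * (M ^ k).trace := by
  rw [W₁, inv_formalX_sub, trace_formalResolvent, smul_seriesOf]

theorem W₂_formalX (T : ℝ) (M : Mat N) :
    W₂ T formalX M = seriesOf fun k => -(T / N : ℂ) * ((-M) ^ k).trace := by
  rw [W₂, inv_formalX_add, trace_formalResolvent, smul_seriesOf]
  ext n
  rw [HahnSeries.coeff_neg, coeff_seriesOf, coeff_seriesOf]
  split_ifs <;> simp

/-- The resolvent generates the powers, so the coefficient of `x^(-k-1)` in the error term is the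
loop variable of `M ^ k`. -/
theorem formal_quadratic_identity (V₁ V₂ : Potential) (hN : 0 < N) {T : ℝ} (hT : 0 < T)
    (M₁ M₂ : Mat N) :
    R V₁ V₂ T formalX M₁ M₂ = Y₁ V₁ V₂ T formalX M₁ ^ 2 + Y₂ V₁ V₂ T formalX M₂ ^ 2
      + Y₁ V₁ V₂ T formalX M₁ * Y₂ V₁ V₂ T formalX M₂
      - seriesOf fun k => (T / N : ℂ) ^ 2 * (powCalculus N k).loopVariable V₁ V₂ T M₁ M₂ := by
  have hN' : (N : ℂ) ≠ 0 := by exact_mod_cast hN.ne'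
  have hT' : (T : ℂ) ≠ 0 := by exact_mod_cast hT.ne'
  rw [quadratic_identity, inv_formalX_sub, inv_formalX_add, trace_toK_mul_formalResolvent,
    trace_toK_mul_formalResolvent, W₁_formalX, W₂_formalX, pow_two (seriesOf _),
    pow_two (seriesOf _), seriesOf_mul, seriesOf_mul, seriesOf_mul, seriesOf_add, seriesOf_add,
    seriesOf_sub, smul_seriesOf, seriesOf_sub]
  congr 2
  funext k
  have e : ∀ (a b : ℂ) (u v : ℕ → ℂ), ∑ s ∈ Finset.range k, a * u s * (b * v (k - 1 - s)) =
      a * b * ∑ s ∈ Finset.range k, u s * v (k - 1 - s) := fun a b u v => by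
    rw [Finset.mul_sum]
    exact Finset.sum_congr rfl fun s _ => by ring
  rw [e _ _ (fun s => (M₁ ^ s).trace) (fun s => (M₁ ^ s).trace),
    e _ _ (fun s => ((-M₂) ^ s).trace) (fun s => ((-M₂) ^ s).trace),
    e _ _ (fun s => (M₁ ^ s).trace) (fun s => ((-M₂) ^ s).trace)]
  simp only [DifferenceCalculus.loopVariable, powCalculus]
  field_simp
  ring

/-- A random series `∑_k f_k x^(-k-m)` whose coefficients are tame. -/
def FormalTame (F : Mat N → Mat N → FormalSeries) : Prop :=
  ∃ (m : ℤ) (f : ℕ → Mat N → Mat N → ℂ), (∀ k, Tame (f k)) ∧ ∀ M₁ M₂,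
    F M₁ M₂ = HahnSeries.single m 1 *
      HahnSeries.ofPowerSeries ℤ ℂ (PowerSeries.mk fun k => f k M₁ M₂)

variable {F G : Mat N → Mat N → FormalSeries}

theorem FormalTame.mul (hF : FormalTame F) (hG : FormalTame G) :
    FormalTame fun M₁ M₂ => F M₁ M₂ * G M₁ M₂ := by
  obtain ⟨m, f, hf, eF⟩ := hF
  obtain ⟨l, g, hg, eG⟩ := hG
  refine ⟨m + l, fun k M₁ M₂ => ∑ p ∈ Finset.HasAntidiagonal.antidiagonal k, f p.1 M₁ M₂ * g p.2 M₁ M₂,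
    fun k => tame_sum _ fun p _ => (hf _).mul (hg _), fun M₁ M₂ => ?_⟩
  have h : (PowerSeries.mk fun k => ∑ p ∈ Finset.HasAntidiagonal.antidiagonal k, f p.1 M₁ M₂ * g p.2 M₁ M₂) =
      (PowerSeries.mk fun k => f k M₁ M₂) * PowerSeries.mk fun k => g k M₁ M₂ := by
    ext k
    simp [PowerSeries.coeff_mul]
  simp only [eF, eG, h, map_mul]
  rw [← mul_one (1 : ℂ), ← HahnSeries.single_mul_single, mul_one]
  ring

theorem FormalTame.coeff (hF : FormalTame F) (n : ℤ) : Tame fun M₁ M₂ => (F M₁ M₂).coeff n := by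
  obtain ⟨m, f, hf, eF⟩ := hF
  simp only [eF, HahnSeries.coeff_single_mul, one_mul, PowerSeries.coeff_coe, PowerSeries.coeff_mk]
  split_ifs
  exacts [tame_const 0, hf _]

theorem formalTame_const (s : FormalSeries) : FormalTame (N := N) fun _ _ => s :=
  ⟨s.order, fun k _ _ => PowerSeries.coeff k s.powerSeriesPart, fun k => tame_const _, fun _ _ => by
    have h : (PowerSeries.mk fun k => PowerSeries.coeff k s.powerSeriesPart) = s.powerSeriesPart := by
      ext k
      rw [PowerSeries.coeff_mk]
    rw [h]
    exact (LaurentSeries.single_order_mul_powerSeriesPart s).symm⟩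

theorem formalTame_seriesOf {f : ℕ → Mat N → Mat N → ℂ} (hf : ∀ k, Tame (f k)) :
    FormalTame fun M₁ M₂ => seriesOf fun k => f k M₁ M₂ :=
  ⟨1, f, hf, fun _ _ => rfl⟩

/-- Expanding the product first means that only products of formal series are needed, and series
with different leading exponents never have to be aligned. -/
theorem FormalTame.coeff_const_sub_mul (hF : FormalTame F) (hG : FormalTame G)
    (u v : FormalSeries) (n : ℤ) :
    Tame fun M₁ M₂ => ((u - F M₁ M₂) * (v - G M₁ M₂)).coeff n := by
  have h : ∀ M₁ M₂, ((u - F M₁ M₂) * (v - G M₁ M₂)).coeff n = (u * v).coeff n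
      - (u * G M₁ M₂).coeff n - (F M₁ M₂ * v).coeff n + (F M₁ M₂ * G M₁ M₂).coeff n :=
    fun M₁ M₂ => by
      rw [← HahnSeries.coeff_sub, ← HahnSeries.coeff_sub, ← HahnSeries.coeff_add]
      congr 1
      ring
  simp only [h]
  exact (((tame_const _).sub (((formalTame_const u).mul hG).coeff n)).sub
    ((hF.mul (formalTame_const v)).coeff n)).add ((hF.mul hG).coeff n)

theorem formal_identity (V₁ V₂ : Potential) (hN : 0 < N) {T : ℝ} (hT : 0 < T) (n : ℤ) :
    HasAverage V₁ V₂ T (fun M₁ _ : Mat N => (Y₁ V₁ V₂ T formalX M₁ ^ 2).coeff n) ∧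
    HasAverage V₁ V₂ T (fun _ M₂ : Mat N => (Y₂ V₁ V₂ T formalX M₂ ^ 2).coeff n) ∧
    HasAverage V₁ V₂ T (fun M₁ M₂ : Mat N =>
      (Y₁ V₁ V₂ T formalX M₁ * Y₂ V₁ V₂ T formalX M₂).coeff n) ∧
    HasAverage V₁ V₂ T (fun M₁ M₂ : Mat N => (R V₁ V₂ T formalX M₁ M₂).coeff n) ∧
    cauchyAverage V₁ V₂ T (fun M₁ _ : Mat N => (Y₁ V₁ V₂ T formalX M₁ ^ 2).coeff n)
      + cauchyAverage V₁ V₂ T (fun _ M₂ : Mat N => (Y₂ V₁ V₂ T formalX M₂ ^ 2).coeff n)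
      + cauchyAverage V₁ V₂ T (fun M₁ M₂ : Mat N =>
          (Y₁ V₁ V₂ T formalX M₁ * Y₂ V₁ V₂ T formalX M₂).coeff n)
      = cauchyAverage V₁ V₂ T (fun M₁ M₂ : Mat N => (R V₁ V₂ T formalX M₁ M₂).coeff n)
        - (1 / formalX).coeff n * cauchyAverage V₁ V₂ T (fun M₁ M₂ : Mat N =>
            I₁ V₁ T M₁ M₂ + I₂ V₂ T M₁ M₂) := by
  have w₁ : FormalTame fun M₁ _ : Mat N => W₁ T formalX M₁ := by
    simp only [W₁_formalX]
    exact formalTame_seriesOf fun k => (tameMat_fst.pow k).trace.const_mul _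
  have w₂ : FormalTame fun _ M₂ : Mat N => W₂ T formalX M₂ := by
    simp only [W₂_formalX]
    exact formalTame_seriesOf fun k => (tameMat_snd.neg.pow k).trace.const_mul _
  -- The error series starts at `x⁻¹`: for `n ≤ 0` its coefficient is zero, and otherwise it comes
  -- from the power `k = n - 1`.
  have hL : ∃ L : Mat N → Mat N → ℂ, Singular L ∧ modelIntegral V₁ V₂ T L = 0 ∧
      ∀ M₁ M₂, (seriesOf fun k => (T / N : ℂ) ^ 2 *
        (powCalculus N k).loopVariable V₁ V₂ T M₁ M₂).coeff n = (T / N : ℂ) ^ 2 * L M₁ M₂ := by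
    by_cases h : n ≤ 0
    · refine ⟨fun _ _ => 0, singular_zero, by simp [modelIntegral], fun M₁ M₂ => ?_⟩
      rw [coeff_seriesOf, if_pos h, mul_zero]
    · refine ⟨(powCalculus N (n - 1).toNat).loopVariable V₁ V₂ T,
        DifferenceCalculus.singular_loopVariable _ V₁ V₂ T,
        DifferenceCalculus.modelIntegral_loopVariable _ V₁ V₂ hN hT, fun M₁ M₂ => ?_⟩
      rw [coeff_seriesOf, if_neg h]
  obtain ⟨L, sL, L0, eL⟩ := hL
  refine averaged_identity V₁ V₂ hN hT
    (h := fun M₁ M₂ => (Y₁ V₁ V₂ T formalX M₁ * Y₂ V₁ V₂ T formalX M₂).coeff n) ?_ ?_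
    (w₁.coeff_const_sub_mul w₂ _ _ n) sL L0
    ((T / N : ℂ) ^ 2) _ fun M₁ M₂ _ _ => ?_
  · simp only [pow_two]
    exact w₁.coeff_const_sub_mul w₁ _ _ n
  · simp only [pow_two]
    exact w₂.coeff_const_sub_mul w₂ _ _ n
  · rw [formal_quadratic_identity V₁ V₂ hN hT, HahnSeries.coeff_sub, HahnSeries.coeff_add,
      HahnSeries.coeff_add, eL]

end FormalExpansions

end CauchyModel
end

/-! ### The master loop equation -/

theorem mainTheorem5 (V₁ V₂ : Potential) (N : ℕ) (hN : 0 < N) (T : ℝ) (hT : 0 < T) :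
    -- the model is well defined
    (IntegrableOn (fun p : (Fin N → Fin N → ℝ) × (Fin N → Fin N → ℝ) =>
        weight V₁ V₂ T (hermitianOf p.1) (hermitianOf p.2)) (posDefPairs N) ∧
      0 < partitionFunction V₁ V₂ N T ∧
      HasAverage V₁ V₂ T (fun M₁ M₂ : Mat N =>
        I₁ V₁ T M₁ M₂ + I₂ V₂ T M₁ M₂)) ∧
    -- the identity between functions of the spectral parameter
    (∀ x : ℂ, x.im ≠ 0 →
      HasAverage V₁ V₂ T (fun M₁ _M₂ : Mat N =>
        Y₁ V₁ V₂ T x M₁ ^ 2) ∧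
      HasAverage V₁ V₂ T (fun _M₁ M₂ : Mat N =>
        Y₂ V₁ V₂ T x M₂ ^ 2) ∧
      HasAverage V₁ V₂ T (fun M₁ M₂ : Mat N =>
        Y₁ V₁ V₂ T x M₁ * Y₂ V₁ V₂ T x M₂) ∧
      HasAverage V₁ V₂ T (fun M₁ M₂ : Mat N =>
        R V₁ V₂ T x M₁ M₂) ∧
      cauchyAverage V₁ V₂ T (fun M₁ _M₂ : Mat N =>
          Y₁ V₁ V₂ T x M₁ ^ 2)
        + cauchyAverage V₁ V₂ T (fun _M₁ M₂ : Mat N =>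
            Y₂ V₁ V₂ T x M₂ ^ 2)
        + cauchyAverage V₁ V₂ T (fun M₁ M₂ : Mat N =>
            Y₁ V₁ V₂ T x M₁ * Y₂ V₁ V₂ T x M₂)
      = cauchyAverage V₁ V₂ T (fun M₁ M₂ : Mat N =>
            R V₁ V₂ T x M₁ M₂)
        - 1 / x * cauchyAverage V₁ V₂ T (fun M₁ M₂ : Mat N =>
            I₁ V₁ T M₁ M₂ + I₂ V₂ T M₁ M₂)) ∧
    -- the identity between formal expansions, coefficient by coefficient
    (∀ n : ℤ,
      HasAverage V₁ V₂ T (fun M₁ _M₂ : Mat N =>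
        (Y₁ V₁ V₂ T formalX M₁ ^ 2).coeff n) ∧
      HasAverage V₁ V₂ T (fun _M₁ M₂ : Mat N =>
        (Y₂ V₁ V₂ T formalX M₂ ^ 2).coeff n) ∧
      HasAverage V₁ V₂ T (fun M₁ M₂ : Mat N =>
        (Y₁ V₁ V₂ T formalX M₁ *
          Y₂ V₁ V₂ T formalX M₂).coeff n) ∧
      HasAverage V₁ V₂ T (fun M₁ M₂ : Mat N =>
        (R V₁ V₂ T formalX M₁ M₂).coeff n) ∧
      cauchyAverage V₁ V₂ T (fun M₁ _M₂ : Mat N =>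
          (Y₁ V₁ V₂ T formalX M₁ ^ 2).coeff n)
        + cauchyAverage V₁ V₂ T (fun _M₁ M₂ : Mat N =>
            (Y₂ V₁ V₂ T formalX M₂ ^ 2).coeff n)
        + cauchyAverage V₁ V₂ T (fun M₁ M₂ : Mat N =>
            (Y₁ V₁ V₂ T formalX M₁ *
              Y₂ V₁ V₂ T formalX M₂).coeff n)
      = cauchyAverage V₁ V₂ T (fun M₁ M₂ : Mat N =>
            (R V₁ V₂ T formalX M₁ M₂).coeff n)
        - (1 / formalX).coeff n *
          cauchyAverage V₁ V₂ T (fun M₁ M₂ : Mat N =>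
            I₁ V₁ T M₁ M₂ + I₂ V₂ T M₁ M₂)) :=
  ⟨⟨integrableOn_weight V₁ V₂ hN hT, partitionFunction_pos V₁ V₂ hN hT,
      hasAverage_sum_I V₁ V₂ hN hT⟩,
    fun _ hx => complex_identity V₁ V₂ hN hT hx, fun n => formal_identity V₁ V₂ hN hT n⟩
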